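/- **Terms.** Let $t$ be a term in the variables $x_1,\dots,x_k$, the constants $0,1$ and the binary operations $x+y$, $x-y$, $x\cdot 2^{y}$, $x\cdot 2^{-y}$ (no multiplication), and let $\eta:\{x_1,\dots,x_k\}\to\mathbb Z$. The operations are interpreted in $\mathbb Z$; $x\cdot 2^{\pm y}$ is partial, being defined exactly when the rational number $x\cdot 2^{\pm y}$ is an integer, and $t(\eta(X))$ is defined if all operations in its evaluation are. Let $|t|$ be the number of operations that occur in $t$, let $\sigma_x(t),\sigma_0(t),\sigma_1(t)$ be the numbers of occurrences in $t$ of the variable $x$ and of the constants $0$ and $1$, and let $s_x=\lceil\log_2(|\eta(x)|+1)\rceil$. **Circuits.** A constant power circuit $\mathcal P$ is a finite non-empty directed acyclic graph without multiple edges, with edge labels $\mu(e)\in\{1,-1\}$, a non-empty set $M$ of marked vertices and signs $\nu:M\to\{1,-1\}$. Put $\mathcal E(v)=0$ if $v$ is a leaf (has no outgoing edges; a *zero vertex*) and $\mathcal E(v)=2^{\sum_{e:v\to u}\mu(e)\mathcal E(u)}\in\mathbb R$ otherwise, and $\mathcal E(\mathcal P)=\sum_{v\in M}\nu(v)\mathcal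 E(v)$. The circuit is *proper* if $\mathcal E(v)\in\mathbb N$ for all $v$, and it *properly represents* $n\in\mathbb Z$ if moreover $\mathcal E(\mathcal P)=n$. It is *standard* if either it consists of a single vertex, marked with sign $1$, or every vertex is reachable from a marked one, there is a unique zero vertex $z$, $z$ is unmarked, and each edge into $z$ is the only edge leaving its origin and has label $1$. It is *reduced* if it is standard, distinct vertices have distinct $\mathcal E$-values, and no two edges $v\to v_1$, $v\to v_2$ with opposite labels satisfy $\mathcal E(v_1)=\mathcal E(v_2)$ or $\mathcal E(v_1)=2\mathcal E(v_2)$. It is *normal* if it is proper and reduced and, for every vertex $v$, the binary sum $\sum_{e:v\to u}\mu(e)\mathcal E(u)$, and also the binary sum $\sum_{v\in M}\nu(v)\mathcal E(v)$, is compact, that is, the exponents of the powers of $2$ in it differ pairwise by at least $2$ (zero vertices contribute no term). **Statement.** There is an algorithm which, given $t$ and the binary notations of the integers $\eta(x_1),\dots,\eta(x_k)$, decides whether $t(\eta(X))$ is defined and, if it is, outputs a normal power circuit $\mathcal P_t$ that properly represents $t(\eta(X))$; up to isomorphism it is the only normal circuit that properly represents this integer. The algorithm has time complexity $$O\Big((|t|+1)^4\Big(\sum_{i=1}^k\sigma_{x_i}(t)\,(s_{x_i}+2)+2\sigma_1(t)+\sigma_0(t)\Big)^3\Big)$$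 with an absolute implied constant. Time is the number of steps of a random access machine with indirect addressing and with addition and truncated subtraction as its arithmetic operations, on words of $O(\log L)$ bits. The input consists of $L$ words: the number of symbols of $t$, the symbols of $t$ in postfix order (one word each), the addresses of the numerals of the $\eta(x_i)$, and these numerals (sign, number of binary digits, digits). Input is accessed by address. The output is $0$ if $t(\eta(X))$ is undefined, and otherwise $1$ followed by the number of vertices, the list of marks and the matrix of edge labels of $\mathcal P_t$. -/

import Mathlib

namespace PowerCircuits

/-! ### Multiplication-free terms and their partial values in the integers -/

/-- Terms in the language `{+, -, x * 2 ^ y, x * 2 ^ (-y), 0, 1}` with variables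
`x_0, ..., x_(k-1)`. -/
inductive ExpTerm (k : ℕ) : Type
  | zero : ExpTerm k
  | one : ExpTerm k
  | var (x : Fin k) : ExpTerm k
  | add (t u : ExpTerm k) : ExpTerm k
  | sub (t u : ExpTerm k) : ExpTerm k
  | mulPow (t u : ExpTerm k) : ExpTerm k
  | divPow (t u : ExpTerm k) : ExpTerm k

/-- The partial operation `x * 2 ^ y` on the integers: it is defined exactly when the rational
number `x * 2 ^ y` is an integer. -/
def shift (x y : ℤ) : Option ℤ :=
  if 0 ≤ y then some (x * 2 ^ y.toNat)
  else if (2 : ℤ) ^ (-y).toNat ∣ x then some (x / 2 ^ (-y).toNat)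
  else none

namespace ExpTerm

variable {k : ℕ}

/-- The value of a term under an assignment; `none` means that the value is undefined, which
happens as soon as the value of some subterm is undefined. -/
def eval (η : Fin k → ℤ) : ExpTerm k → Option ℤ
  | zero => some 0
  | one => some 1
  | var x => some (η x)
  | add t u => (eval η t).bind fun a => (eval η u).bind fun b => some (a + b)
  | sub t u => (eval η t).bind fun a => (eval η u).bind fun b => some (a - b)
  | mulPow t u => (eval η t).bind fun a => (eval η u).bind fun b => shift a b
  | divPow t u => (eval η t).bind fun a => (eval η u).bind fun b => shift a (-b)

/-- The number of operations that occur in a term. -/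
def numOps : ExpTerm k → ℕ
  | zero => 0
  | one => 0
  | var _ => 0
  | add t u => numOps t + numOps u + 1
  | sub t u => numOps t + numOps u + 1
  | mulPow t u => numOps t + numOps u + 1
  | divPow t u => numOps t + numOps u + 1

/-- The number of occurrences of the variable `x` in a term. -/
def numVar (x : Fin k) : ExpTerm k → ℕ
  | zero => 0
  | one => 0
  | var y => if y = x then 1 else 0
  | add t u => numVar x t + numVar x u
  | sub t u => numVar x t + numVar x u
  | mulPow t u => numVar x t + numVar x u
  | divPow t u => numVar x t + numVar x u

/-- The number of occurrences of the constant `1` in a term. -/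
def numOne : ExpTerm k → ℕ
  | zero => 0
  | one => 1
  | var _ => 0
  | add t u => numOne t + numOne u
  | sub t u => numOne t + numOne u
  | mulPow t u => numOne t + numOne u
  | divPow t u => numOne t + numOne u

/-- The number of occurrences of the constant `0` in a term. -/
def numZero : ExpTerm k → ℕ
  | zero => 1
  | one => 0
  | var _ => 0
  | add t u => numZero t + numZero u
  | sub t u => numZero t + numZero u
  | mulPow t u => numZero t + numZero u
  | divPow t u => numZero t + numZero u

/-- The postfix notation of a term, one word for each symbol. -/
def tokens : ExpTerm k → List ℕ
  | zero => [0]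
  | one => [1]
  | var x => [6 + x.val]
  | add t u => tokens t ++ tokens u ++ [2]
  | sub t u => tokens t ++ tokens u ++ [3]
  | mulPow t u => tokens t ++ tokens u ++ [4]
  | divPow t u => tokens t ++ tokens u ++ [5]

end ExpTerm

/-- The binary notation of an integer: sign (`1` for negative integers), number of binary digits
of the absolute value, then these digits, the least significant one first. -/
def numeral (n : ℤ) : List ℕ :=
  (if n < 0 then 1 else 0) :: n.natAbs.bits.length :: n.natAbs.bits.map (fun b => cond b 1 0)

/-- The input array that presents a term together with an assignment of its variables: the number
of symbols of the term, the symbols in postfix order, for each variable the address (in this array)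
of the numeral of the integer assigned to it, and finally the numerals. -/
def encodeInput {k : ℕ} (t : ExpTerm k) (η : Fin k → ℤ) : List ℕ :=
  [t.tokens.length] ++ t.tokens ++
    List.ofFn (fun i : Fin k => 1 + t.tokens.length + k +
      ∑ j : Fin k, if j < i then (numeral (η j)).length else 0) ++
    (List.ofFn fun i : Fin k => numeral (η i)).flatten

/-! ### Constant power circuits -/

/-- A constant power circuit with vertex set `V` (to be used for finite `V`): `edge u v` is the
label `1` or `-1` of the edge from `u` to `v`, or `0` if there is no such edge; `mark v` is the
sign `1` or `-1` of the vertex `v` if it is marked, and `0` if it is unmarked. -/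
structure PowerCircuit (V : Type) where
  edge : V → V → SignType
  mark : V → SignType
  acyclic : ∀ v, ¬ Relation.TransGen (fun a b => edge a b ≠ 0) v v
  marked_nonempty : ∃ v, mark v ≠ 0

namespace PowerCircuit

variable {V : Type} [Fintype V]

theorem wf (P : PowerCircuit V) : WellFounded fun b a : V => P.edge a b ≠ 0 := by
  have hirr : Std.Irrefl (Relation.TransGen fun b a : V => P.edge a b ≠ 0) :=
    ⟨fun v hv => P.acyclic v (Relation.transGen_swap.mp hv)⟩
  have htr : IsTrans V (Relation.TransGen fun b a : V => P.edge a b ≠ 0) :=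
    ⟨fun _ _ _ h h' => h.trans h'⟩
  have hr := Finite.wellFounded_of_trans_of_irrefl (Relation.TransGen fun b a : V => P.edge a b ≠ 0)
  exact WellFounded.mono hr fun _ _ h => Relation.TransGen.single h

/-- A leaf, that is, a vertex without outgoing edges. In a constant circuit the leaves are the
zero vertices. -/
def IsLeaf (P : PowerCircuit V) (v : V) : Prop := ∀ u, P.edge v u = 0

open Classical in
/-- The real number represented by a vertex; see `value_eq` for the recursion. -/
noncomputable def value (P : PowerCircuit V) : V → ℝ :=
  P.wf.fix fun v ih =>
    if P.IsLeaf v then 0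
    else (2 : ℝ) ^ (∑ u, if h : P.edge v u ≠ 0 then (P.edge v u : ℝ) * ih u h else 0)

/-- The signed sum of the values of the children of a vertex. -/
noncomputable def exponent (P : PowerCircuit V) (v : V) : ℝ :=
  ∑ u, (P.edge v u : ℝ) * P.value u

open Classical in
theorem value_eq (P : PowerCircuit V) (v : V) :
    P.value v = if P.IsLeaf v then 0 else (2 : ℝ) ^ P.exponent v := by
  have h1 := P.wf.fix_eq (C := fun _ => ℝ) (fun v ih =>
    if P.IsLeaf v then 0
    else (2 : ℝ) ^ (∑ u, if h : P.edge v u ≠ 0 then (P.edge v u : ℝ) * ih u h else 0)) v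
  refine Eq.trans h1 ?_
  unfold exponent
  congr 2
  refine Finset.sum_congr rfl fun u _ => ?_
  by_cases h : P.edge v u = 0
  · simp [h]
  · rw [dif_pos h]
    rfl

/-- The real number represented by the circuit. -/
noncomputable def total (P : PowerCircuit V) : ℝ := ∑ v, (P.mark v : ℝ) * P.value v

/-- A circuit is proper if the values of all its vertices are natural numbers. -/
def IsProper (P : PowerCircuit V) : Prop := ∀ v, ∃ m : ℕ, P.value v = m

/-- The circuit properly represents the integer `n`. -/
def ProperlyRepresents (P : PowerCircuit V) (n : ℤ) : Prop :=
  P.IsProper ∧ P.total = n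

/-- Every vertex can be reached from a marked vertex along a directed path. -/
def IsTrimmed (P : PowerCircuit V) : Prop :=
  ∀ v, ∃ m, P.mark m ≠ 0 ∧ Relation.ReflTransGen (fun a b => P.edge a b ≠ 0) m v

/-- The trivial circuit: a single vertex, which is marked (with the sign `1`, by convention). -/
def IsTrivial (P : PowerCircuit V) : Prop :=
  ∃ z, (∀ v, v = z) ∧ P.mark z = 1

/-- A circuit in the standard form: the trivial circuit (in this form `0` is represented), or a
trimmed circuit with a unique zero vertex, which is unmarked, and such that an edge into
the zero vertex is the only edge with its origin (and has the label `1`, by convention). -/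
def IsStandard (P : PowerCircuit V) : Prop :=
  P.IsTrivial ∨
    (P.IsTrimmed ∧
      ∃ z, P.mark z = 0 ∧ (∀ v, P.IsLeaf v ↔ v = z) ∧
        ∀ v, P.edge v z ≠ 0 → P.edge v z = 1 ∧ ∀ u, P.edge v u ≠ 0 → u = z)

/-- There are no two edges with a common origin and with opposite labels whose termini have the
same value. -/
def NoRedundant (P : PowerCircuit V) : Prop :=
  ∀ v u w, P.edge v u ≠ 0 → P.edge v u = -P.edge v w → P.value u ≠ P.value w

/-- There are no two edges with a common origin and with opposite labels such that the value of the
terminus of one of them is twice the value of the terminus of the other one. -/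
def NoSuperfluous (P : PowerCircuit V) : Prop :=
  ∀ v u w, P.edge v u ≠ 0 → P.edge v u = -P.edge v w → P.value u ≠ 2 * P.value w

/-- Reduced circuits. -/
def IsReduced (P : PowerCircuit V) : Prop :=
  P.IsStandard ∧ (∀ u v, P.value u = P.value v → u = v) ∧ P.NoRedundant ∧ P.NoSuperfluous

/-- The exponents of the powers of two that are the values of the vertices in `S` differ pairwise
by at least two. (Zero vertices contribute no power of two to a binary sum.) -/
def CompactOn (P : PowerCircuit V) (S : Set V) : Prop :=
  ∀ u ∈ S, ∀ w ∈ S, ¬ P.IsLeaf u → ¬ P.IsLeaf w → u ≠ w →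
    2 ≤ |P.exponent u - P.exponent w|

/-- Normal circuits: proper and reduced, and the binary sums in the exponents of all vertices and
the binary sum over the marked vertices are compact. -/
def IsNormal (P : PowerCircuit V) : Prop :=
  P.IsProper ∧ P.IsReduced ∧ (∀ v, P.CompactOn {u | P.edge v u ≠ 0}) ∧
    P.CompactOn {v | P.mark v ≠ 0}

/-- Isomorphism of constant power circuits. -/
def Isomorphic {W : Type} (P : PowerCircuit V) (Q : PowerCircuit W) : Prop :=
  ∃ φ : V ≃ W, (∀ u v, Q.edge (φ u) (φ v) = P.edge u v) ∧ ∀ v, Q.mark (φ v) = P.mark v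

/-- `P` is, up to isomorphism, the normal circuit that represents the integer `n`. -/
def IsNormalCircuitOf (P : PowerCircuit V) (n : ℤ) : Prop :=
  P.IsNormal ∧ P.ProperlyRepresents n ∧
    ∀ (W : Type) [Fintype W] (Q : PowerCircuit W),
      Q.IsNormal → Q.ProperlyRepresents n → P.Isomorphic Q

end PowerCircuit

/-- The word that stands for a sign. -/
def signCode : SignType → ℕ
  | .zero => 0
  | .pos => 1
  | .neg => 2

/-- The presentation of a circuit with the vertices `0, ..., n - 1` as a list of words: the number
of vertices, the marks of the vertices, and the matrix of the edge labels, row by row. -/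
def encodeCircuit {n : ℕ} (P : PowerCircuit (Fin n)) : List ℕ :=
  n :: (List.ofFn fun v => signCode (P.mark v)) ++
    (List.ofFn fun v => List.ofFn fun u => signCode (P.edge v u)).flatten

/-! ### A random access machine

The machine has registers, a random access memory, a read-only input array and a write-only output
list, all of which hold natural numbers (words). A program uses a fixed finite set of
registers. -/

/-- Programs. Arguments named `d`, `a`, `b` are numbers of registers. -/
inductive Cmd : Type
  /-- do nothing -/
  | skip : Cmd
  /-- `R d := c` -/
  | const (d c : ℕ) : Cmd
  /-- `R d := R a + R b` -/
  | add (d a b : ℕ) : Cmd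
  /-- `R d := R a - R b`, or `0` if this is negative -/
  | sub (d a b : ℕ) : Cmd
  /-- `R d := memory[R a]` -/
  | load (d a : ℕ) : Cmd
  /-- `memory[R a] := R b` -/
  | store (a b : ℕ) : Cmd
  /-- `R d := input[R a]`, or `0` beyond the end of the input -/
  | read (d a : ℕ) : Cmd
  /-- append `R a` to the output -/
  | write (a : ℕ) : Cmd
  /-- first `p`, then `q` -/
  | seq (p q : Cmd) : Cmd
  /-- `p` if `R a` is nonzero, and `q` otherwise -/
  | ite (a : ℕ) (p q : Cmd) : Cmd
  /-- repeat `p` as long as `R a` is nonzero -/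
  | loop (a : ℕ) (p : Cmd) : Cmd

/-- States of the machine. -/
structure State where
  reg : ℕ → ℕ
  mem : ℕ → ℕ
  out : List ℕ

/-- The state at the start of a computation. -/
def State.init : State := ⟨fun _ => 0, fun _ => 0, []⟩

/-- `Exec inp B p s s' n`: with the input array `inp`, the program `p` started in the state `s`
halts in the state `s'` after exactly `n` steps, and all words computed on the way are at most `B`.
Every elementary command and every test of a register counts as one step. -/
inductive Exec (inp : List ℕ) (B : ℕ) : Cmd → State → State → ℕ → Prop
  | skip (s : State) : Exec inp B .skip s s 1
  | const (s : State) (d c : ℕ) (h : c ≤ B) :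
      Exec inp B (.const d c) s { s with reg := Function.update s.reg d c } 1
  | add (s : State) (d a b : ℕ) (h : s.reg a + s.reg b ≤ B) :
      Exec inp B (.add d a b) s
        { s with reg := Function.update s.reg d (s.reg a + s.reg b) } 1
  | sub (s : State) (d a b : ℕ) :
      Exec inp B (.sub d a b) s
        { s with reg := Function.update s.reg d (s.reg a - s.reg b) } 1
  | load (s : State) (d a : ℕ) :
      Exec inp B (.load d a) s { s with reg := Function.update s.reg d (s.mem (s.reg a)) } 1
  | store (s : State) (a b : ℕ) :
      Exec inp B (.store a b) s { s with mem := Function.update s.mem (s.reg a) (s.reg b) } 1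
  | read (s : State) (d a : ℕ) (h : inp.getD (s.reg a) 0 ≤ B) :
      Exec inp B (.read d a) s
        { s with reg := Function.update s.reg d (inp.getD (s.reg a) 0) } 1
  | write (s : State) (a : ℕ) :
      Exec inp B (.write a) s { s with out := s.out ++ [s.reg a] } 1
  | seq (p q : Cmd) (s s' s'' : State) (m n : ℕ) (hp : Exec inp B p s s' m)
      (hq : Exec inp B q s' s'' n) : Exec inp B (.seq p q) s s'' (m + n)
  | ite_true (a : ℕ) (p q : Cmd) (s s' : State) (n : ℕ) (ha : s.reg a ≠ 0)
      (hp : Exec inp B p s s' n) : Exec inp B (.ite a p q) s s' (n + 1)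
  | ite_false (a : ℕ) (p q : Cmd) (s s' : State) (n : ℕ) (ha : s.reg a = 0)
      (hq : Exec inp B q s s' n) : Exec inp B (.ite a p q) s s' (n + 1)
  | loop_done (a : ℕ) (p : Cmd) (s : State) (ha : s.reg a = 0) : Exec inp B (.loop a p) s s 1
  | loop_step (a : ℕ) (p : Cmd) (s s' s'' : State) (m n : ℕ) (ha : s.reg a ≠ 0)
      (hp : Exec inp B p s s' m) (hl : Exec inp B (.loop a p) s' s'' n) :
      Exec inp B (.loop a p) s s'' (m + n + 1)

/-- On the input `inp` the program `p` halts after exactly `n` steps with the output `out`, and all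
words computed on the way are at most `B`. -/
def RunsTo (p : Cmd) (inp : List ℕ) (B : ℕ) (out : List ℕ) (n : ℕ) : Prop :=
  ∃ s : State, Exec inp B p State.init s n ∧ s.out = out

end PowerCircuits

namespace PowerCircuits

/-! ### Signed binary expansions in non-adjacent form -/

/-! A compact binary sum is a non-adjacent form (NAF), and every integer has exactly one
(`exists_naf`, `isNaf_ext`). Passing from a number to the exponents in its NAF, and from these to
the exponents in theirs, yields finitely many natural numbers (`Reach`), since the exponents in the
NAF of a natural number are smaller than it. They are forced to be the exponents of the nonzero
vertices of every normal circuit for `n ≠ 0`, and the labels and marks are forced to be the digits.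
Hence such a circuit exists and is unique (`coded_of_isNormal`, `Coded.isomorphic`,
`Coded.isNormalCircuitOf`).

The algorithm keeps a pool of exponents. Each is stored with its NAF, written in indices of earlier
pool members, with its rank in the natural order, and with the index of its successor if that is
known. Intermediate integers are NAFs over the pool. Adding a signed power of two to a NAF is an
upward carry; ranks and successors make each of its steps cost constant time, provided that the
successors it needs are known (`CarryOk`). Addition is a sequence of such insertions. Multiplication
by `2 ^ y` adds `y` to every exponent, which is again an addition of NAFs. The result is an integer
exactly if no new exponent is negative, because the lowest exponent of a NAF is the 2-adic valuation
(`two_pow_dvd_val_iff`).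

For the running time let `S` be the weight in the statement and `N` the number of operations plus
one. A subterm of weight `a` with `o` operations has a value with a NAF of length at most `a`, whose
exponents have NAFs of length at most `a + o` (`ListOk`). Indeed, lengths add up in a sum and are
kept by a shift; an exponent of a sum exceeds one of a summand by at most one (`mem_addList`); an
exponent of a shift is `x + y`. Before each operation three rounds provide the successors that it
can need. A round replaces each exponent without known successor by at most one other such exponent,
and an operation adds at most `S` of them, so after `r` operations there are at most `1 + r * S`.
Hence the pool has size `O(N ^ 2 * S)`. Finding one successor means comparing a list of length
`O(S)` with the whole pool; this happens `O(N * S)` times per round, which gives `O(N ^ 3 * S ^ 3)`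
for an operation and `O(N ^ 4 * S ^ 3)` in total. The initial pool of `32 * S + 1` small numbers,
which serves the carries in the computation of successors, costs `O(S ^ 3)`. The output costs `O(S)`
for each pair of pool members, again `O(N ^ 4 * S ^ 3)`.

The program is written in a While language in which words grow by at most a constant per step, so
that they stay polynomial in the input length. Its translation to the random access machine costs a
constant factor (`exec_compile`). -/

/-- The sign denoted by a Boolean: `true` stands for `-1`. -/
def sgn (b : Bool) : ℤ := if b then -1 else 1

@[simp] theorem sgn_true : sgn true = -1 := rfl
@[simp] theorem sgn_false : sgn false = 1 := rfl
@[simp] theorem sgn_not (b : Bool) : sgn (!b) = -sgn b := by cases b <;> rfl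

/-- The integer denoted by a list of signed powers of two. -/
def val : List (ℕ × Bool) → ℤ
  | [] => 0
  | x :: L => sgn x.2 * 2 ^ x.1 + val L

@[simp] theorem val_nil : val [] = 0 := rfl
@[simp] theorem val_cons (x : ℕ × Bool) (L) : val (x :: L) = sgn x.2 * 2 ^ x.1 + val L := rfl

theorem val_append (L L' : List (ℕ × Bool)) : val (L ++ L') = val L + val L' := by
  induction L with
  | nil => simp
  | cons x L ih => simp [ih, add_assoc]

/-- Ascending non-adjacent forms. -/
def IsNaf (L : List (ℕ × Bool)) : Prop := L.Pairwise fun x y => x.1 + 2 ≤ y.1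

theorem isNaf_nil : IsNaf [] := List.Pairwise.nil

theorem isNaf_cons {x : ℕ × Bool} {L} :
    IsNaf (x :: L) ↔ (∀ y ∈ L, x.1 + 2 ≤ y.1) ∧ IsNaf L := List.pairwise_cons

/-- Addition of a signed power of two to a non-adjacent form. -/
def ins : ℕ → Bool → List (ℕ × Bool) → List (ℕ × Bool)
  | e, b, [] => [(e, b)]
  | e, b, (f, c) :: L =>
    if e = f then (if b = c then ins (e + 1) b L else L)
    else if e < f then
      -- Neighbouring powers merge by `2^e + 2^(e+1) = 2^(e+2) - 2^e` and `2^(e+1) - 2^e = 2^e`.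
      if f = e + 1 then (if b = c then (e, !b) :: ins (f + 1) b L else (e, c) :: L)
      else (e, b) :: (f, c) :: L
    else if e = f + 1 then (if b = c then (f, !b) :: ins (e + 1) b L else (f, b) :: L)
    else (f, c) :: ins e b L

theorem val_ins (e : ℕ) (b : Bool) (L) : val (ins e b L) = val L + sgn b * 2 ^ e := by
  induction L generalizing e with
  | nil => simp [ins]
  | cons x L ih =>
    obtain ⟨f, c⟩ := x
    unfold ins
    split_ifs with h1 h2 h3 h4 h2 h4 h2
    · subst h1 h2; simp [ih]; ring
    · subst h1
      have h5 : sgn c = - sgn b := by revert h2; cases b <;> cases c <;> simp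
      simp [h5]
    · subst h4 h2; simp [ih]; ring
    · subst h4
      have h5 : sgn c = - sgn b := by revert h2; cases b <;> cases c <;> simp
      simp [h5]; ring
    · simp; ring
    · subst h4 h2; simp [ih]; ring
    · subst h4
      have h5 : sgn c = - sgn b := by revert h2; cases b <;> cases c <;> simp
      simp [h5]; ring
    · simp [ih]; ring

theorem length_ins (e : ℕ) (b : Bool) (L) : (ins e b L).length ≤ L.length + 1 := by
  induction L generalizing e with
  | nil => simp [ins]
  | cons x L ih =>
    obtain ⟨f, c⟩ := x
    unfold ins
    have h1 := ih (e + 1)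
    have h2 := ih (f + 1)
    have h3 := ih e
    split_ifs <;> (try simp only [List.length_cons]) <;> omega

theorem le_of_mem_ins {k e : ℕ} {b : Bool} {L} (he : k ≤ e) (hL : ∀ x ∈ L, k ≤ x.1) :
    ∀ x ∈ ins e b L, k ≤ x.1 := by
  induction L generalizing e with
  | nil => simpa [ins]
  | cons x L ih =>
    obtain ⟨f, c⟩ := x
    simp only [List.mem_cons, forall_eq_or_imp] at hL
    have h1 := ih (e := e + 1) (by omega) hL.2
    have h2 := ih (e := f + 1) (by omega) hL.2
    have h3 := ih he hL.2
    unfold ins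
    split_ifs <;> try simp only [List.mem_cons, forall_eq_or_imp]
    all_goals first | exact h1 | exact hL.2 | exact ⟨he, h2⟩ | exact ⟨he, hL.2⟩ | exact ⟨he, hL⟩
                    | exact ⟨hL.1, h1⟩ | exact hL | exact ⟨hL.1, h3⟩

/-- Whenever an entry is written at some position and the insertion goes on behind it, the insertion
continues at least two positions higher; `le_of_mem_ins` then preserves the gap. -/
theorem isNaf_ins {e : ℕ} {b : Bool} {L} (hL : IsNaf L) : IsNaf (ins e b L) := by
  induction L generalizing e with
  | nil => simp [ins, IsNaf]
  | cons x L ih =>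
    obtain ⟨f, c⟩ := x
    have hL' := isNaf_cons.1 hL
    obtain ⟨h1, h2⟩ := hL'
    simp only at h1
    unfold ins
    split_ifs with h3 h4 h4 h5 h6 h5 h6
    · exact ih h2
    · exact h2
    · refine isNaf_cons.2 ⟨fun x hx => ?_, ih h2⟩
      exact le_of_mem_ins (k := e + 2) (by omega) (fun y hy => by have := h1 y hy; omega) x hx
    · exact isNaf_cons.2 ⟨fun x hx => by have := h1 x hx; simp only; omega, h2⟩
    · refine isNaf_cons.2 ⟨fun x hx => ?_, hL⟩
      rcases List.mem_cons.1 hx with rfl | hx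
      · simp only; omega
      · have := h1 x hx; simp only; omega
    · refine isNaf_cons.2 ⟨fun x hx => ?_, ih h2⟩
      exact le_of_mem_ins (k := f + 2) (by omega) (fun y hy => by have := h1 y hy; omega) x hx
    · exact isNaf_cons.2 ⟨fun x hx => h1 x hx, h2⟩
    · refine isNaf_cons.2 ⟨fun x hx => ?_, ih h2⟩
      exact le_of_mem_ins (k := f + 2) (by omega) (fun y hy => by have := h1 y hy; omega) x hx

theorem isNaf_pair {L} (h : IsNaf L) {x y : ℕ × Bool} (hx : x ∈ L) (hy : y ∈ L) :
    x = y ∨ x.1 + 2 ≤ y.1 ∨ y.1 + 2 ≤ x.1 := by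
  induction L with
  | nil => simp at hx
  | cons z L ih =>
    obtain ⟨h1, h2⟩ := isNaf_cons.1 h
    rcases List.mem_cons.1 hx with hx' | hx' <;> rcases List.mem_cons.1 hy with hy' | hy'
    · exact Or.inl (hx'.trans hy'.symm)
    · exact Or.inr (Or.inl (hx' ▸ h1 y hy'))
    · exact Or.inr (Or.inr (hy' ▸ h1 x hx'))
    · exact ih h2 hx' hy'

theorem isNaf_append_singleton {L} {x : ℕ × Bool} :
    IsNaf (L ++ [x]) ↔ IsNaf L ∧ ∀ y ∈ L, y.1 + 2 ≤ x.1 := by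
  simp [IsNaf, List.pairwise_append]

/-- A geometric series: the entries below `x` have absolute values at most `2^(x.1-2), 2^(x.1-4),
…`, whose sum stays below a third of `2^x.1`. -/
theorem tail_bound {L} {x : ℕ × Bool} (h : IsNaf (L ++ [x])) : 3 * |val L| < 2 ^ x.1 := by
  induction L using List.reverseRecOn generalizing x with
  | nil => simp
  | append_singleton L y ih =>
    obtain ⟨h1, h2⟩ := isNaf_append_singleton.1 h
    have h3 := ih h1
    have h4 : y.1 + 2 ≤ x.1 := h2 y (by simp)
    have h5 : (2 : ℤ) ^ (y.1 + 2) ≤ 2 ^ x.1 := pow_le_pow_right₀ (by norm_num) h4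
    rw [val_append, val_cons, val_nil, add_zero]
    have h6 : |sgn y.2 * 2 ^ y.1| = 2 ^ y.1 := by
      rw [abs_mul, abs_of_pos (a := (2 : ℤ) ^ y.1) (by positivity)]
      cases y.2 <;> simp
    have h7 := abs_add_le (val L) (sgn y.2 * 2 ^ y.1)
    rw [pow_add] at h5
    omega

/-- By `tail_bound` the value differs from its leading term by less than a third of that term. This
fixes the sign and pins the size well enough to compare leading exponents. -/
theorem top_bound {L} {x : ℕ × Bool} (h : IsNaf (L ++ [x])) :
    2 * 2 ^ x.1 < 3 * (sgn x.2 * val (L ++ [x])) ∧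
      3 * (sgn x.2 * val (L ++ [x])) < 4 * 2 ^ x.1 := by
  have h1 := tail_bound h
  rw [val_append, val_cons, val_nil, add_zero]
  have h2 := abs_lt.1 (show |val L| < |val L| + 1 by omega)
  rcases abs_cases (val L) with h3 | h3 <;> cases x.2 <;> simp <;> constructor <;> linarith

theorem top_neg {L} {e : ℕ} (h : IsNaf (L ++ [(e, true)])) : val (L ++ [(e, true)]) < 0 := by
  have := (top_bound h).1
  have h2 : (0 : ℤ) < 2 ^ e := by positivity
  simp at this ⊢
  linarith

theorem top_pos {L} {e : ℕ} (h : IsNaf (L ++ [(e, false)])) : 0 < val (L ++ [(e, false)]) := by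
  have := (top_bound h).1
  have h2 : (0 : ℤ) < 2 ^ e := by positivity
  simp at this ⊢
  linarith

/-- The sign of a difference is that of the dominant leading term. -/
theorem top_dominates {L L'} {x y : ℕ × Bool} (h : IsNaf (L ++ [x])) (h' : IsNaf (L' ++ [y]))
    (hlt : y.1 < x.1) : 0 < sgn x.2 * (val (L ++ [x]) - val (L' ++ [y])) := by
  have h1 := (top_bound h).1
  have h2 := (top_bound h').1
  have h3 := (top_bound h').2
  have h4 : (2 : ℤ) ^ (y.1 + 1) ≤ 2 ^ x.1 := pow_le_pow_right₀ (by norm_num) hlt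
  have h5 : (0 : ℤ) < 2 ^ y.1 := by positivity
  rw [pow_succ] at h4
  rw [mul_sub]
  revert h1 h2 h3
  cases x.2 <;> cases y.2 <;> simp <;> intros <;> linarith

theorem isNaf_prefix {L L'} (h : IsNaf (L ++ L')) : IsNaf L := (List.pairwise_append.1 h).1

/-- Read from the top: equal values have equal leading exponents by `top_dominates` and equal
leading signs by `top_pos` and `top_neg`; cancel the leading terms and repeat. -/
theorem isNaf_ext {L L' : List (ℕ × Bool)} (h : IsNaf L) (h' : IsNaf L') (hv : val L = val L') :
    L = L' := by
  induction L using List.reverseRecOn generalizing L' with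
  | nil =>
    rcases List.eq_nil_or_concat' L' with rfl | ⟨M, ⟨f, c⟩, rfl⟩
    · rfl
    · cases c
      · have := top_pos h'; simp at hv; omega
      · have := top_neg h'; simp at hv; omega
  | append_singleton L x ih =>
    rcases List.eq_nil_or_concat' L' with rfl | ⟨M, y, rfl⟩
    · obtain ⟨f, c⟩ := x
      cases c
      · have := top_pos h; simp at hv; omega
      · have := top_neg h; simp at hv; omega
    · rcases lt_trichotomy x.1 y.1 with h1 | h1 | h1
      · have := top_dominates h' h h1
        rw [hv] at this; simp at this
      · obtain ⟨e, b⟩ := x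
        obtain ⟨f, c⟩ := y
        simp only at h1
        subst h1
        have hbc : b = c := by
          cases b <;> cases c <;> try rfl
          · have := top_pos h; have := top_neg h'; omega
          · have := top_neg h; have := top_pos h'; omega
        subst hbc
        rw [val_append, val_append] at hv
        rw [ih (isNaf_prefix h) (isNaf_prefix h') (by linarith)]
      · have := top_dominates h h' h1
        rw [hv] at this; simp at this

theorem two_pow_le_of_mem {L} (h : IsNaf L) {x : ℕ × Bool} (hx : x ∈ L) :
    2 ^ (x.1 + 1) < 3 * |val L| := by
  rcases List.eq_nil_or_concat' L with rfl | ⟨M, y, rfl⟩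
  · simp at hx
  · have h1 := (top_bound h).1
    have hle : x.1 ≤ y.1 := by
      rcases List.mem_append.1 hx with hx | hx
      · have := (isNaf_append_singleton.1 h).2 x hx; omega
      · simp at hx; rw [hx]
    have h2 : (2 : ℤ) ^ (x.1 + 1) ≤ 2 ^ (y.1 + 1) := pow_le_pow_right₀ (by norm_num) (by omega)
    have h3 : sgn y.2 * val (M ++ [y]) ≤ |val (M ++ [y])| := by
      cases y.2
      · simpa using le_abs_self _
      · simpa using neg_le_abs _
    rw [pow_succ] at h2 ⊢
    rw [pow_succ] at h2
    linarith

/-- From `2^(x.1+1) < 3n` and `3k ≤ 2^(k+1)` for all `k`. This strict descent makes circuits built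
from digits acyclic and permits induction on exponents. -/
theorem lt_of_mem_naf {L} (h : IsNaf L) {n : ℕ} (hn : val L = n) {x : ℕ × Bool} (hx : x ∈ L) :
    x.1 < n := by
  have h1 := two_pow_le_of_mem h hx
  rw [hn, Nat.abs_cast] at h1
  by_contra hc
  have h2 : n + 1 ≤ x.1 + 1 := by omega
  have h3 : 2 ^ (n + 1) ≤ 2 ^ (x.1 + 1) := Nat.pow_le_pow_right (by norm_num) h2
  have h4 : 2 ^ (x.1 + 1) < 3 * n := by exact_mod_cast h1
  have h5 : ∀ k : ℕ, 3 * k ≤ 2 ^ (k + 1) := by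
    intro k
    rcases Nat.lt_or_ge k 3 with h | h
    · interval_cases k <;> norm_num
    · induction k, h using Nat.le_induction with
      | base => norm_num
      | succ k hk ih => rw [pow_succ]; omega
  have := h5 n
  omega

theorem two_mul_length_le {L} {x : ℕ × Bool} (h : IsNaf (L ++ [x])) : 2 * L.length ≤ x.1 := by
  induction L using List.reverseRecOn generalizing x with
  | nil => simp
  | append_singleton L y ih =>
    have h1 := ih (isNaf_append_singleton.1 h).1
    have h2 := (isNaf_append_singleton.1 h).2 y (by simp)
    simp; omega

/-- Short expansions of small numbers. -/
theorem length_le_of_val_le {L} (h : IsNaf L) {n s : ℕ} (hn : val L = n) (hs : n ≤ 32 * s) :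
    L.length ≤ s + 4 := by
  rcases List.eq_nil_or_concat' L with rfl | ⟨M, y, rfl⟩
  · simp
  · have h1 := two_pow_le_of_mem h (x := y) (by simp)
    rw [hn, Nat.abs_cast] at h1
    have h2 := two_mul_length_le h
    by_contra hc
    simp at hc
    have h4 : 2 ^ (y.1 + 1) < 3 * n := by exact_mod_cast h1
    -- More than `s + 4` entries force a leading exponent of at least `2 * (s + 4)`, hence `512 *
    -- 4^s < 3n ≤ 96 * s`, which is absurd.
    have h3 : 2 ^ (2 * (s + 4) + 1) ≤ 2 ^ (y.1 + 1) := Nat.pow_le_pow_right (by norm_num) (by omega)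
    have h5 : 2 ^ (2 * (s + 4) + 1) = 512 * (2 ^ s * 2 ^ s) := by
      rw [show 2 * (s + 4) + 1 = s + s + 9 by ring, pow_add, pow_add]; ring
    have h6 : s < 2 ^ s := Nat.lt_two_pow_self
    have h7 : 2 ^ s ≤ 2 ^ s * 2 ^ s := Nat.le_mul_self _
    omega

/-- The integer `n` has a non-adjacent form of length at most `w`. -/
def Wt (n : ℤ) (w : ℕ) : Prop := ∃ L, IsNaf L ∧ val L = n ∧ L.length ≤ w

/-- By uniqueness, a bound proved for some expansion applies to the one that is found in memory. -/
theorem Wt.length_le {n : ℤ} {w : ℕ} (h : Wt n w) {L} (hL : IsNaf L) (hv : val L = n) :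
    L.length ≤ w := by
  obtain ⟨M, h1, h2, h3⟩ := h
  rwa [isNaf_ext hL h1 (hv.trans h2.symm)]

theorem Wt.mono {n : ℤ} {w w' : ℕ} (h : Wt n w) (hw : w ≤ w') : Wt n w' := by
  obtain ⟨M, h1, h2, h3⟩ := h
  exact ⟨M, h1, h2, h3.trans hw⟩

theorem Wt.add_one {n : ℤ} {w : ℕ} (h : Wt n w) : Wt (n + 1) (w + 1) := by
  obtain ⟨M, h1, h2, h3⟩ := h
  exact ⟨ins 0 false M, isNaf_ins h1, by simp [val_ins, h2], (length_ins _ _ _).trans (by omega)⟩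

theorem Wt.natCast (n : ℕ) : Wt n n := by
  induction n with
  | zero => exact ⟨[], isNaf_nil, by simp, by simp⟩
  | succ n ih => push_cast; exact ih.add_one

theorem Wt.natCast_of_le {n s : ℕ} (h : n ≤ 32 * s) : Wt n (s + 4) := by
  obtain ⟨L, h1, h2, -⟩ := Wt.natCast n
  exact ⟨L, h1, h2, length_le_of_val_le h1 h2 h⟩

/-- Addition (or subtraction, if `flip` is `true`) of expansions. -/
def addList (flip : Bool) (L M : List (ℕ × Bool)) : List (ℕ × Bool) :=
  M.foldl (fun L x => ins x.1 (xor flip x.2) L) L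

theorem addList_append_singleton (flip L M x) :
    addList flip L (M ++ [x]) = ins x.1 (xor flip x.2) (addList flip L M) := by
  simp [addList]

theorem sgn_xor (a b : Bool) : sgn (xor a b) = sgn a * sgn b := by cases a <;> cases b <;> rfl

theorem val_addList (flip L M) : val (addList flip L M) = val L + sgn flip * val M := by
  induction M using List.reverseRecOn with
  | nil => simp [addList]
  | append_singleton M x ih =>
    rw [addList_append_singleton, val_ins, ih, val_append, sgn_xor]; simp; ring

theorem isNaf_addList {flip L M} (h : IsNaf L) : IsNaf (addList flip L M) := by
  induction M using List.reverseRecOn with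
  | nil => simpa [addList]
  | append_singleton M x ih => rw [addList_append_singleton]; exact isNaf_ins ih

theorem length_addList (flip L M) : (addList flip L M).length ≤ L.length + M.length := by
  induction M using List.reverseRecOn with
  | nil => simp [addList]
  | append_singleton M x ih =>
    rw [addList_append_singleton]
    have := length_ins x.1 (xor flip x.2) (addList flip L M)
    simp; omega

theorem Wt.add {n m : ℤ} {w w' : ℕ} (h : Wt n w) (h' : Wt m w') (flip : Bool) :
    Wt (n + sgn flip * m) (w + w') := by
  obtain ⟨L, h1, h2, h3⟩ := h
  obtain ⟨M, h4, h5, h6⟩ := h'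
  exact ⟨addList flip L M, isNaf_addList h1, by rw [val_addList, h2, h5],
    (length_addList _ _ _).trans (by omega)⟩

/-! ### The digits of the non-adjacent form of an integer -/

/-- The lowest digit. -/
def lowDigit (n : ℤ) : ℤ := if n % 2 = 0 then 0 else if n % 4 = 1 then 1 else -1

/-- The digits. -/
def digit : ℕ → ℤ → ℤ
  | 0, n => lowDigit n
  | i + 1, n => digit i ((n - lowDigit n) / 2)

/-- Digits without two nonzero neighbours can be peeled off from below: if the sum is odd then `f 1
= 0`, so the residue modulo four determines `f 0`. The number `N` is only a cut-off beyond which `f`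
vanishes. -/
theorem digit_eq_of_sum (i : ℕ) : ∀ (f : ℕ → ℤ) (N : ℕ), (∀ i, f i = -1 ∨ f i = 0 ∨ f i = 1) →
    (∀ i, f i ≠ 0 → f (i + 1) = 0) → (∀ i, N ≤ i → f i = 0) →
    digit i (∑ j ∈ Finset.range N, f j * 2 ^ j) = f i := by
  have step : ∀ (f : ℕ → ℤ) (N : ℕ), (∀ i, N ≤ i → f i = 0) →
      ∑ j ∈ Finset.range N, f j * 2 ^ j =
        2 * (∑ j ∈ Finset.range N, f (j + 1) * 2 ^ j) + f 0 := by
    intro f N hz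
    have h1 : ∑ j ∈ Finset.range (N + 1), f j * 2 ^ j = ∑ j ∈ Finset.range N, f j * 2 ^ j := by
      rw [Finset.sum_range_succ, hz N le_rfl]; simp
    rw [← h1, Finset.sum_range_succ', Finset.mul_sum]
    simp only [pow_zero, mul_one]
    congr 1
    exact Finset.sum_congr rfl fun j _ => by ring
  have low : ∀ (f : ℕ → ℤ) (N : ℕ), (∀ i, f i = -1 ∨ f i = 0 ∨ f i = 1) →
      (∀ i, f i ≠ 0 → f (i + 1) = 0) → (∀ i, N ≤ i → f i = 0) →
      lowDigit (∑ j ∈ Finset.range N, f j * 2 ^ j) = f 0 := by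
    intro f N h1 h2 h3
    rw [step f N h3, step (fun j => f (j + 1)) N (fun i hi => h3 _ (by omega))]
    generalize (∑ j ∈ Finset.range N, f (j + 1 + 1) * 2 ^ j) = s
    have h5 := h2 0
    unfold lowDigit
    rcases h1 0 with h | h | h <;> simp only [h] at h5 ⊢ <;> simp at h5 ⊢
    · simp only [h5]; omega
    · simp only [h5]; omega
  induction i with
  | zero => exact low
  | succ i ih =>
    intro f N h1 h2 h3
    unfold digit
    rw [low f N h1 h2 h3, step f N h3]
    rw [show ∀ x y : ℤ, (2 * x + y - y) / 2 = x by intros; omega]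
    exact ih (fun j => f (j + 1)) N (fun i => h1 _) (fun i => h2 _) (fun i hi => h3 _ (by omega))

/-- The digit at the position `i` of a list of signed powers of two. -/
def coeff (L : List (ℕ × Bool)) (i : ℕ) : ℤ :=
  if (i, false) ∈ L then 1 else if (i, true) ∈ L then -1 else 0

theorem coeff_cons {x : ℕ × Bool} {L} (h : IsNaf (x :: L)) (i : ℕ) :
    coeff (x :: L) i = coeff L i + if i = x.1 then sgn x.2 else 0 := by
  obtain ⟨e, b⟩ := x
  obtain ⟨h1, -⟩ := isNaf_cons.1 h
  by_cases hi : i = e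
  · subst hi
    have h2 : ∀ c, (i, c) ∉ L := fun c hc => by have := h1 _ hc; simp at this
    cases b <;> simp [coeff, h2]
  · simp [coeff, hi]

theorem val_eq_sum_coeff {L} (h : IsNaf L) {N : ℕ} (hN : ∀ x ∈ L, x.1 < N) :
    val L = ∑ j ∈ Finset.range N, coeff L j * 2 ^ j := by
  induction L with
  | nil => simp [coeff]
  | cons x L ih =>
    simp only [coeff_cons h, add_mul, Finset.sum_add_distrib]
    rw [← ih (isNaf_cons.1 h).2 (fun y hy => hN y (by simp [hy]))]
    simp only [ite_mul, zero_mul, Finset.sum_ite_eq', Finset.mem_range, val_cons]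
    rw [if_pos (hN x (by simp))]
    ring

theorem coeff_ne_zero {L} {i : ℕ} : coeff L i ≠ 0 ↔ ∃ b, (i, b) ∈ L := by
  unfold coeff
  split_ifs with h1 h2
  · simp; tauto
  · simp; tauto
  · simp; tauto

theorem digit_val {L} (h : IsNaf L) (i : ℕ) : digit i (val L) = coeff L i := by
  obtain ⟨N, hN⟩ : ∃ N, ∀ x ∈ L, x.1 < N :=
    ⟨(L.map (·.1)).sum + 1, fun x hx =>
      Nat.lt_succ_of_le (List.le_sum_of_mem (List.mem_map_of_mem hx))⟩
  rw [val_eq_sum_coeff h hN]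
  refine digit_eq_of_sum i _ N (fun j => ?_) (fun j hj => ?_) (fun j hj => ?_)
  · unfold coeff; split_ifs <;> simp
  · obtain ⟨b, hb⟩ := coeff_ne_zero.1 hj
    by_contra hc
    obtain ⟨c, hc⟩ := coeff_ne_zero.1 hc
    have := isNaf_pair h hb hc
    simp at this; omega
  · by_contra hc
    obtain ⟨c, hc⟩ := coeff_ne_zero.1 hc
    have := hN _ hc
    simp at this; omega

theorem lowDigit_spec (n : ℤ) : (lowDigit n = 0 ∧ n % 2 = 0) ∨ (lowDigit n = 1 ∧ n % 4 = 1) ∨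
    (lowDigit n = -1 ∧ n % 4 = 3) := by
  unfold lowDigit; split_ifs <;> omega

/-- One column of a schoolbook addition with digits `da`, `db` and carry `c`. If `da = db = c ≠ 0`,
the outgoing carry would be `2c`; the invariant rules this out and reproduces itself. If both digits
vanish and a carry still leaves the column, then `a' + b'` is odd, so the next column has a nonzero
digit. -/
theorem carry_spec {a b c a' b' c' da db dn la lb : ℤ} (ha : a = 2 * a' + da)
    (hb : b = 2 * b' + db) (hn : a + b + c = 2 * (a' + b' + c') + dn)
    (h1 : (da = 0 ∧ a % 2 = 0) ∨ (da = 1 ∧ a % 4 = 1) ∨ (da = -1 ∧ a % 4 = 3))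
    (h2 : (db = 0 ∧ b % 2 = 0) ∨ (db = 1 ∧ b % 4 = 1) ∨ (db = -1 ∧ b % 4 = 3))
    (h3 : (dn = 0 ∧ (a + b + c) % 2 = 0) ∨ (dn = 1 ∧ (a + b + c) % 4 = 1) ∨
      (dn = -1 ∧ (a + b + c) % 4 = 3))
    (h4 : (la = 0 ∧ a' % 2 = 0) ∨ (la = 1 ∧ a' % 4 = 1) ∨ (la = -1 ∧ a' % 4 = 3))
    (h5 : (lb = 0 ∧ b' % 2 = 0) ∨ (lb = 1 ∧ b' % 4 = 1) ∨ (lb = -1 ∧ b' % 4 = 3))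
    (hc : c = 0 ∨ ((c = 1 ∨ c = -1) ∧ ¬ (da = c ∧ db = c))) :
    (c' = 0 ∨ ((c' = 1 ∨ c' = -1) ∧ ¬ (la = c' ∧ lb = c'))) ∧
      (c' ≠ 0 → da = 0 → db = 0 → la ≠ 0 ∨ lb ≠ 0) := by
  have h6 : 2 * c' = da + db + c - dn := by omega
  rcases h1 with ⟨rfl, h1⟩ | ⟨rfl, h1⟩ | ⟨rfl, h1⟩ <;>
  rcases h2 with ⟨rfl, h2⟩ | ⟨rfl, h2⟩ | ⟨rfl, h2⟩ <;>
  rcases h3 with ⟨rfl, h3⟩ | ⟨rfl, h3⟩ | ⟨rfl, h3⟩ <;>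
  rcases hc with rfl | ⟨rfl | rfl, hc⟩ <;> omega

/-- Induction over the columns with the invariant of `carry_spec`. The general carry `c` is needed
for the induction only; the application has `c = 0`. -/
theorem digit_add (i : ℕ) : ∀ a b c : ℤ, (c = 0 ∨ ((c = 1 ∨ c = -1) ∧
    ¬ (lowDigit a = c ∧ lowDigit b = c))) → digit i (a + b + c) ≠ 0 →
    digit i a ≠ 0 ∨ digit i b ≠ 0 ∨ (∃ j, i = j + 1 ∧ (digit j a ≠ 0 ∨ digit j b ≠ 0)) ∨
      (i = 0 ∧ c ≠ 0) := by
  induction i with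
  | zero =>
    intro a b c _ h
    simp only [digit] at h ⊢
    have h1 := lowDigit_spec a
    have h2 := lowDigit_spec b
    have h3 := lowDigit_spec (a + b + c)
    simp
    omega
  | succ i ih =>
    intro a b c hc h
    simp only [digit] at h
    have h1 := lowDigit_spec a
    have h2 := lowDigit_spec b
    have h3 := lowDigit_spec (a + b + c)
    obtain ⟨a', ha'⟩ : ∃ a', a = 2 * a' + lowDigit a := ⟨(a - lowDigit a) / 2, by omega⟩
    obtain ⟨b', hb'⟩ : ∃ b', b = 2 * b' + lowDigit b := ⟨(b - lowDigit b) / 2, by omega⟩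
    obtain ⟨n, hn⟩ : ∃ n, a + b + c = 2 * n + lowDigit (a + b + c) :=
      ⟨(a + b + c - lowDigit (a + b + c)) / 2, by omega⟩
    rw [show (a + b + c - lowDigit (a + b + c)) / 2 = n by omega] at h
    have h4 := lowDigit_spec a'
    have h5 := lowDigit_spec b'
    simp only [digit]
    rw [show (a - lowDigit a) / 2 = a' by omega, show (b - lowDigit b) / 2 = b' by omega]
    generalize hda : lowDigit a = da at *
    generalize hdb : lowDigit b = db at *
    generalize lowDigit (a + b + c) = dn at *
    obtain ⟨c', rfl⟩ : ∃ c', n = a' + b' + c' := ⟨n - a' - b', by ring⟩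
    obtain ⟨h7, h10⟩ := carry_spec ha' hb' hn h1 h2 h3 h4 h5 hc
    clear h1 h2 h3 h4 h5 hc
    rcases ih _ _ c' h7 h with h8 | h8 | ⟨j, rfl, h8⟩ | ⟨rfl, h7'⟩
    · exact Or.inl h8
    · exact Or.inr (Or.inl h8)
    · refine Or.inr (Or.inr (Or.inl ⟨j + 1, rfl, ?_⟩))
      simp only [digit]
      rwa [hda, hdb, show (a - da) / 2 = a' by omega, show (b - db) / 2 = b' by omega]
    -- The digit arises from the carry into its column. It is charged to the digits of the column
    -- below, or, if these vanish, to those of its own column by the last clause of `carry_spec`.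
    · by_cases h9 : da = 0 ∧ db = 0
      · simp only [digit]
        obtain ⟨rfl, rfl⟩ := h9
        rcases h10 h7' rfl rfl with h | h
        · exact Or.inl h
        · exact Or.inr (Or.inl h)
      · refine Or.inr (Or.inr (Or.inl ⟨0, rfl, ?_⟩))
        simp only [digit, hda, hdb]
        omega

theorem digit_neg (i : ℕ) (n : ℤ) : digit i (-n) = - digit i n := by
  induction i generalizing n with
  | zero =>
    simp only [digit]
    have := lowDigit_spec n
    have := lowDigit_spec (-n)
    omega
  | succ i ih =>
    simp only [digit]
    have h1 := lowDigit_spec n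
    have h2 := lowDigit_spec (-n)
    rw [← ih]
    congr 1
    omega

/-- The exponents in a sum come from those in the summands, increased by at most one. -/
theorem mem_addList {flip : Bool} {L M : List (ℕ × Bool)} (hL : IsNaf L) (hM : IsNaf M)
    {x : ℕ × Bool} (hx : x ∈ addList flip L M) :
    ∃ y, (y ∈ L ∨ y ∈ M) ∧ (x.1 = y.1 ∨ x.1 = y.1 + 1) := by
  have h1 : digit x.1 (val L + sgn flip * val M + 0) ≠ 0 := by
    rw [add_zero, ← val_addList, digit_val (isNaf_addList hL)]
    exact coeff_ne_zero.2 ⟨x.2, hx⟩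
  have hM' : ∀ i, digit i (sgn flip * val M) ≠ 0 → ∃ b, (i, b) ∈ M := by
    intro i hi
    rw [← coeff_ne_zero, ← digit_val hM]
    cases flip
    · simpa using hi
    · simpa [digit_neg] using hi
  have hL' : ∀ i, digit i (val L) ≠ 0 → ∃ b, (i, b) ∈ L := by
    intro i hi
    rwa [← coeff_ne_zero, ← digit_val hL]
  rcases digit_add _ _ _ _ (Or.inl rfl) h1 with h | h | ⟨j, hj, h | h⟩ | h
  · obtain ⟨b, hb⟩ := hL' _ h
    exact ⟨_, Or.inl hb, Or.inl rfl⟩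
  · obtain ⟨b, hb⟩ := hM' _ h
    exact ⟨_, Or.inr hb, Or.inl rfl⟩
  · obtain ⟨b, hb⟩ := hL' _ h
    exact ⟨_, Or.inl hb, Or.inr hj⟩
  · obtain ⟨b, hb⟩ := hM' _ h
    exact ⟨_, Or.inr hb, Or.inr hj⟩
  · simp at h

/-! ### The successors that an addition needs -/

/-- The exponents in `D` suffice for the carries in `ins e b L`. -/
def CarryOk (D : ℕ → Prop) : ℕ → List (ℕ × Bool) → Prop
  | _, [] => True
  | e, x :: L =>
    if e = x.1 then D e ∧ CarryOk D (e + 1) L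
    else if e < x.1 then (x.1 = e + 1 → D e ∧ D x.1 ∧ CarryOk D (x.1 + 1) L)
    else if e = x.1 + 1 then D x.1 ∧ D e ∧ CarryOk D (e + 1) L
    else D x.1 ∧ CarryOk D e L

/-- Every entry that is passed raises the carry by at most two, whence the bound `e + 2 * L.length`;
and a successor is requested only at positions not above some entry of the list. The second
restriction serves the construction of the initial pool, where only successors of smaller numbers
are known, and the first one serves the later rounds. -/
theorem carryOk_of_low {D : ℕ → Prop} {L e} (hL : IsNaf L) (he : ∀ x ∈ L, e ≤ x.1)
    (h : ∀ k, k ≤ e + 2 * L.length → (∃ x ∈ L, k ≤ x.1) → D k) : CarryOk D e L := by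
  induction L generalizing e with
  | nil => trivial
  | cons x L ih =>
    obtain ⟨h1, h2⟩ := isNaf_cons.1 hL
    have hx := he x (by simp)
    simp only [List.length_cons] at h
    have h3 : ∀ k, k ≤ e + 2 → (∀ y ∈ L, k ≤ y.1) → CarryOk D k L := fun k hk hy =>
      ih h2 hy fun j hj hy => h j (by omega) (by obtain ⟨y, hy, h⟩ := hy; exact ⟨y, by simp [hy], h⟩)
    unfold CarryOk
    split_ifs with h4 h5 h6
    · exact ⟨h e (by omega) ⟨x, by simp, hx⟩, h3 _ (by omega) fun y hy => by
        have := h1 y hy; omega⟩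
    · intro h6
      exact ⟨h e (by omega) ⟨x, by simp, hx⟩, h _ (by omega) ⟨x, by simp, le_rfl⟩,
        h3 _ (by omega) fun y hy => by have := h1 y hy; omega⟩
    · omega
    · omega

/-- The successor of `e + 1` matters only if the insertion meets an entry at `e - 1`, since `2^e +
2^(e-1) = 2^(e+1) - 2^(e-1)` moves the carry to `e + 1`. From then on no entry lies below the carry,
and the carry moves to positions `x.1 + 1` for entries `x`. -/
theorem carryOk_of_succ {D : ℕ → Prop} {L e} (hL : IsNaf L) (he : D e)
    (he' : D (e + 1) ∨ ∀ x ∈ L, e ≤ x.1) (h : ∀ x ∈ L, D x.1 ∧ D (x.1 + 1)) : CarryOk D e L := by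
  induction L generalizing e with
  | nil => trivial
  | cons x L ih =>
    obtain ⟨h1, h2⟩ := isNaf_cons.1 hL
    simp only [List.mem_cons, forall_eq_or_imp] at h he'
    unfold CarryOk
    split_ifs with h4 h5 h6
    · refine ⟨he, ih h2 (h4 ▸ h.1.2) (Or.inr fun y hy => ?_) h.2⟩
      have := h1 y hy; omega
    · intro h6
      refine ⟨he, h.1.1, ih h2 h.1.2 (Or.inr fun y hy => ?_) h.2⟩
      have := h1 y hy; omega
    · refine ⟨h.1.1, he, ih h2 ?_ (Or.inr fun y hy => ?_) h.2⟩
      · rcases he' with he' | he'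
        · exact he'
        · omega
      · have := h1 y hy; omega
    · refine ⟨h.1.1, ih h2 he ?_ h.2⟩
      rcases he' with he' | he'
      · exact Or.inl he'
      · omega

/-! ### A While language with arrays

The words that a program of this language computes grow only by constants in each step. -/

/-- Programs; `d`, `a`, `b` are numbers of registers, and `c` is the number of an array, or a
constant. -/
inductive Prog : Type
  | const (d c : ℕ) : Prog
  | mov (d a : ℕ) : Prog
  | inc (d c : ℕ) : Prog
  | sub (d a b : ℕ) : Prog
  | ld (d c a : ℕ) : Prog
  | st (c a b : ℕ) : Prog
  | read (d a b : ℕ) : Prog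
  | write (a : ℕ) : Prog
  | seq (p q : Prog) : Prog
  | ifEq (a b : ℕ) (p q : Prog) : Prog
  | ifLt (a b : ℕ) (p q : Prog) : Prog
  | loop (a b : ℕ) (p : Prog) : Prog

infixr:60 " ;; " => Prog.seq

/-- States, with a counter `tm` for the time that has passed. -/
structure St where
  reg : ℕ → ℕ
  arr : ℕ → ℕ → ℕ
  out : List ℕ
  tm : ℕ

namespace St

def set (s : St) (d v : ℕ) : St := { s with reg := Function.update s.reg d v, tm := s.tm + 1 }

def put (s : St) (c i v : ℕ) : St :=
  { s with arr := Function.update s.arr c (Function.update (s.arr c) i v), tm := s.tm + 1 }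

def emit (s : St) (v : ℕ) : St := { s with out := s.out ++ [v], tm := s.tm + 1 }

def tick (s : St) : St := { s with tm := s.tm + 1 }

variable (s : St) (d v c i r j : ℕ)

@[simp] theorem set_reg : (s.set d v).reg r = if r = d then v else s.reg r := by
  simp [set, Function.update_apply]
@[simp] theorem set_arr : (s.set d v).arr = s.arr := rfl
@[simp] theorem set_out : (s.set d v).out = s.out := rfl
@[simp] theorem set_tm : (s.set d v).tm = s.tm + 1 := rfl
@[simp] theorem put_reg : (s.put c i v).reg = s.reg := rfl
@[simp] theorem put_arr :
    (s.put c i v).arr r j = if r = c then (if j = i then v else s.arr c j) else s.arr r j := by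
  by_cases h : r = c
  · subst h; simp [put, Function.update_apply]
  · simp [put, h]
@[simp] theorem put_out : (s.put c i v).out = s.out := rfl
@[simp] theorem put_tm : (s.put c i v).tm = s.tm + 1 := rfl
@[simp] theorem emit_reg : (s.emit v).reg = s.reg := rfl
@[simp] theorem emit_arr : (s.emit v).arr = s.arr := rfl
@[simp] theorem emit_out : (s.emit v).out = s.out ++ [v] := rfl
@[simp] theorem emit_tm : (s.emit v).tm = s.tm + 1 := rfl
@[simp] theorem tick_reg : s.tick.reg = s.reg := rfl
@[simp] theorem tick_arr : s.tick.arr = s.arr := rfl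
@[simp] theorem tick_out : s.tick.out = s.out := rfl
@[simp] theorem tick_tm : s.tick.tm = s.tm + 1 := rfl

end St

/-- Big-step semantics. -/
inductive Run (inp : List ℕ) : Prog → St → St → Prop
  | const (s d c) : Run inp (.const d c) s (s.set d c)
  | mov (s d a) : Run inp (.mov d a) s (s.set d (s.reg a))
  | inc (s d c) : Run inp (.inc d c) s (s.set d (s.reg d + c))
  | sub (s d a b) : Run inp (.sub d a b) s (s.set d (s.reg a - s.reg b))
  | ld (s d c a) : Run inp (.ld d c a) s (s.set d (s.arr c (s.reg a)))
  | st (s c a b) : Run inp (.st c a b) s (s.put c (s.reg a) (s.reg b))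
  | read (s d a b) : Run inp (.read d a b) s (s.set d (inp.getD (s.reg a + s.reg b) 0))
  | write (s a) : Run inp (.write a) s (s.emit (s.reg a))
  | seq {p q s s' s''} (hp : Run inp p s s') (hq : Run inp q s' s'') : Run inp (.seq p q) s s''
  | eq_true {a b p q s s'} (h : s.reg a = s.reg b) (hp : Run inp p s.tick s') :
      Run inp (.ifEq a b p q) s s'
  | eq_false {a b p q s s'} (h : s.reg a ≠ s.reg b) (hq : Run inp q s.tick s') :
      Run inp (.ifEq a b p q) s s'
  | lt_true {a b p q s s'} (h : s.reg a < s.reg b) (hp : Run inp p s.tick s') :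
      Run inp (.ifLt a b p q) s s'
  | lt_false {a b p q s s'} (h : ¬ s.reg a < s.reg b) (hq : Run inp q s.tick s') :
      Run inp (.ifLt a b p q) s s'
  | loop_done {a b p s} (h : ¬ s.reg a < s.reg b) : Run inp (.loop a b p) s s.tick
  | loop_step {a b p s s' s''} (h : s.reg a < s.reg b) (hp : Run inp p s.tick s')
      (hl : Run inp (.loop a b p) s' s'') : Run inp (.loop a b p) s s''

theorem Run.tm_le {inp p s s'} (h : Run inp p s s') : s.tm ≤ s'.tm := by
  induction h <;> (try simp only [St.set_tm, St.put_tm, St.emit_tm, St.tick_tm] at *) <;> omega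

/-- Total correctness: started in `s`, the program halts in a state that satisfies `Q`. -/
def wp (inp : List ℕ) (p : Prog) (Q : St → Prop) (s : St) : Prop := ∃ s', Run inp p s s' ∧ Q s'

section wp

variable {inp : List ℕ} {Q Q' : St → Prop} {s : St} {p q : Prog} {d a b c : ℕ}

theorem wp_mono (h : wp inp p Q s) (hQ : ∀ s', Q s' → Q' s') : wp inp p Q' s := by
  obtain ⟨s', h1, h2⟩ := h
  exact ⟨s', h1, hQ s' h2⟩

@[simp] theorem wp_const : wp inp (.const d c) Q s ↔ Q (s.set d c) :=
  ⟨fun ⟨_, h, hQ⟩ => by cases h; exact hQ, fun h => ⟨_, .const .., h⟩⟩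
@[simp] theorem wp_mov : wp inp (.mov d a) Q s ↔ Q (s.set d (s.reg a)) :=
  ⟨fun ⟨_, h, hQ⟩ => by cases h; exact hQ, fun h => ⟨_, .mov .., h⟩⟩
@[simp] theorem wp_inc : wp inp (.inc d c) Q s ↔ Q (s.set d (s.reg d + c)) :=
  ⟨fun ⟨_, h, hQ⟩ => by cases h; exact hQ, fun h => ⟨_, .inc .., h⟩⟩
@[simp] theorem wp_sub : wp inp (.sub d a b) Q s ↔ Q (s.set d (s.reg a - s.reg b)) :=
  ⟨fun ⟨_, h, hQ⟩ => by cases h; exact hQ, fun h => ⟨_, .sub .., h⟩⟩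
@[simp] theorem wp_ld : wp inp (.ld d c a) Q s ↔ Q (s.set d (s.arr c (s.reg a))) :=
  ⟨fun ⟨_, h, hQ⟩ => by cases h; exact hQ, fun h => ⟨_, .ld .., h⟩⟩
@[simp] theorem wp_st : wp inp (.st c a b) Q s ↔ Q (s.put c (s.reg a) (s.reg b)) :=
  ⟨fun ⟨_, h, hQ⟩ => by cases h; exact hQ, fun h => ⟨_, .st .., h⟩⟩
@[simp] theorem wp_read :
    wp inp (.read d a b) Q s ↔ Q (s.set d (inp.getD (s.reg a + s.reg b) 0)) :=
  ⟨fun ⟨_, h, hQ⟩ => by cases h; exact hQ, fun h => ⟨_, .read .., h⟩⟩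
@[simp] theorem wp_write : wp inp (.write a) Q s ↔ Q (s.emit (s.reg a)) :=
  ⟨fun ⟨_, h, hQ⟩ => by cases h; exact hQ, fun h => ⟨_, .write .., h⟩⟩
@[simp] theorem wp_seq : wp inp (p ;; q) Q s ↔ wp inp p (fun s' => wp inp q Q s') s :=
  ⟨fun ⟨_, h, hQ⟩ => by cases h with | seq h1 h2 => exact ⟨_, h1, _, h2, hQ⟩,
    fun ⟨_, h1, _, h2, hQ⟩ => ⟨_, .seq h1 h2, hQ⟩⟩
@[simp] theorem wp_ifEq : wp inp (.ifEq a b p q) Q s ↔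
    (s.reg a = s.reg b → wp inp p Q s.tick) ∧ (s.reg a ≠ s.reg b → wp inp q Q s.tick) := by
  constructor
  · rintro ⟨_, h, hQ⟩
    cases h with
    | eq_true h hp => exact ⟨fun _ => ⟨_, hp, hQ⟩, fun h' => absurd h h'⟩
    | eq_false h hp => exact ⟨fun h' => absurd h' h, fun _ => ⟨_, hp, hQ⟩⟩
  · rintro ⟨h1, h2⟩
    by_cases h : s.reg a = s.reg b
    · obtain ⟨s', h3, h4⟩ := h1 h; exact ⟨s', .eq_true h h3, h4⟩
    · obtain ⟨s', h3, h4⟩ := h2 h; exact ⟨s', .eq_false h h3, h4⟩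
@[simp] theorem wp_ifLt : wp inp (.ifLt a b p q) Q s ↔
    (s.reg a < s.reg b → wp inp p Q s.tick) ∧ (¬ s.reg a < s.reg b → wp inp q Q s.tick) := by
  constructor
  · rintro ⟨_, h, hQ⟩
    cases h with
    | lt_true h hp => exact ⟨fun _ => ⟨_, hp, hQ⟩, fun h' => absurd h h'⟩
    | lt_false h hp => exact ⟨fun h' => absurd h' h, fun _ => ⟨_, hp, hQ⟩⟩
  · rintro ⟨h1, h2⟩
    by_cases h : s.reg a < s.reg b
    · obtain ⟨s', h3, h4⟩ := h1 h; exact ⟨s', .lt_true h h3, h4⟩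
    · obtain ⟨s', h3, h4⟩ := h2 h; exact ⟨s', .lt_false h h3, h4⟩

theorem wp_loop_unfold : wp inp (.loop a b p) Q s ↔
    (s.reg a < s.reg b → wp inp p (fun s' => wp inp (.loop a b p) Q s') s.tick) ∧
      (¬ s.reg a < s.reg b → Q s.tick) := by
  constructor
  · rintro ⟨_, h, hQ⟩
    cases h with
    | loop_done h => exact ⟨fun h' => absurd h' h, fun _ => hQ⟩
    | loop_step h hp hl => exact ⟨fun _ => ⟨_, hp, _, hl, hQ⟩, fun h' => absurd h h'⟩
  · rintro ⟨h1, h2⟩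
    by_cases h : s.reg a < s.reg b
    · obtain ⟨s', h3, s'', h4, h5⟩ := h1 h; exact ⟨s'', .loop_step h h3 h4, h5⟩
    · exact ⟨_, .loop_done h, h2 h⟩

/-- The rule for loops, with an invariant `I` and a variant `μ`. -/
theorem wp_loop (I : St → Prop) (μ : St → ℕ) (hs : I s)
    (hstep : ∀ s, I s → s.reg a < s.reg b → wp inp p (fun s' => I s' ∧ μ s' < μ s) s.tick)
    (hend : ∀ s, I s → ¬ s.reg a < s.reg b → Q s.tick) : wp inp (.loop a b p) Q s := by
  generalize hn : μ s = n
  induction n using Nat.strong_induction_on generalizing s with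
  | _ n ih =>
    rw [wp_loop_unfold]
    refine ⟨fun h => wp_mono (hstep s hs h) fun s' h' => ih _ (by omega) h'.1 rfl, hend s hs⟩

end wp

/-! ### Translation to the random access machine -/

/-- Put the address of the entry `R a` of the array `c` into register `0`. -/
def addrCmd (c a : ℕ) : Cmd :=
  -- Four doublings produce `16 * R a`.
  .seq (.add 0 (a + 2) (a + 2)) (.seq (.add 0 0 0) (.seq (.add 0 0 0) (.seq (.add 0 0 0)
    (.seq (.const 1 c) (.add 0 0 1)))))

/-- The translation of programs: the registers are shifted by two, and sixteen arrays are
interleaved. -/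
def compile : Prog → Cmd
  | .const d c => .const (d + 2) c
  | .mov d a => .seq (.const 0 0) (.add (d + 2) (a + 2) 0)
  | .inc d c => .seq (.const 0 c) (.add (d + 2) (d + 2) 0)
  | .sub d a b => .sub (d + 2) (a + 2) (b + 2)
  | .ld d c a => .seq (addrCmd c a) (.load (d + 2) 0)
  | .st c a b => .seq (addrCmd c a) (.store 0 (b + 2))
  | .read d a b => .seq (.add 0 (a + 2) (b + 2)) (.read (d + 2) 0)
  | .write a => .write (a + 2)
  | .seq p q => .seq (compile p) (compile q)
  -- With truncated subtraction, `(a - b) + (b - a)` is zero exactly if `a = b`.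
  | .ifEq a b p q => .seq (.sub 0 (a + 2) (b + 2)) (.seq (.sub 1 (b + 2) (a + 2))
      (.seq (.add 0 0 1) (.ite 0 (compile q) (compile p))))
  | .ifLt a b p q => .seq (.sub 0 (b + 2) (a + 2)) (.ite 0 (compile p) (compile q))
  -- Register `0` holds `b - a`, which is nonzero exactly if `a < b`; it is recomputed at the end of
  -- every pass because the body destroys it.
  | .loop a b p => .seq (.sub 0 (b + 2) (a + 2))
      (.loop 0 (.seq (compile p) (.sub 0 (b + 2) (a + 2))))

/-- Constants are small, and at most sixteen arrays are used. -/
def Prog.wf : Prog → Bool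
  | .const _ c => decide (c ≤ 64)
  | .inc _ c => decide (c ≤ 64)
  | .ld _ c _ => decide (c < 16)
  | .st c _ _ => decide (c < 16)
  | .seq p q => p.wf && q.wf
  | .ifEq _ _ p q => p.wf && q.wf
  | .ifLt _ _ p q => p.wf && q.wf
  | .loop _ _ p => p.wf
  | _ => true

/-- The machine state `σ` represents the state `s`. -/
structure Represents (s : St) (σ : State) : Prop where
  reg : ∀ r, σ.reg (r + 2) = s.reg r
  mem : ∀ c < 16, ∀ i, σ.mem (16 * i + c) = s.arr c i
  out : σ.out = s.out

/-- The words in `s` are at most `X`, up to the growth in the time that has passed. -/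
structure Bounded (X : ℕ) (s : St) : Prop where
  reg : ∀ r, s.reg r ≤ X + 64 * s.tm
  arr : ∀ c i, s.arr c i ≤ X + 64 * s.tm

theorem Bounded.tick {X s} (h : Bounded X s) : Bounded X s.tick :=
  ⟨fun r => by have := h.reg r; simp; omega, fun c i => by have := h.arr c i; simp; omega⟩

theorem Bounded.set {X s} (h : Bounded X s) {d v : ℕ} (hv : v ≤ X + 64 * (s.tm + 1)) :
    Bounded X (s.set d v) :=
  ⟨fun r => by have := h.reg r; simp; split_ifs <;> omega,
    fun c i => by have := h.arr c i; simp; omega⟩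

theorem Bounded.put {X s} (h : Bounded X s) {c i v : ℕ} (hv : v ≤ X + 64 * (s.tm + 1)) :
    Bounded X (s.put c i v) :=
  ⟨fun r => by have := h.reg r; simp; omega,
    fun c' j => by have := h.arr c' j; have := h.arr c j; simp; split_ifs <;> omega⟩

theorem exec_addrCmd {inp B} {s : St} {σ : State} (hr : Represents s σ) (c a : ℕ)
    (h : 32 * s.reg a + c + 64 ≤ B) : ∃ σ', Exec inp B (addrCmd c a) σ σ' 6 ∧
      σ'.reg 0 = 16 * s.reg a + c ∧ Represents s σ' := by
  have ha := hr.reg a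
  refine ⟨_, .seq _ _ _ _ _ 1 5 (.add _ _ _ _ ?_) (.seq _ _ _ _ _ 1 4 (.add _ _ _ _ ?_)
    (.seq _ _ _ _ _ 1 3 (.add _ _ _ _ ?_) (.seq _ _ _ _ _ 1 2 (.add _ _ _ _ ?_)
    (.seq _ _ _ _ _ 1 1 (.const _ _ _ ?_) (.add _ _ _ _ ?_))))), ?_, ?_, ?_, ?_⟩
  all_goals try simp [ha]
  all_goals try omega
  · intro r; exact hr.reg r
  · exact hr.mem
  · exact hr.out

theorem represents_set {s : St} {σ : State} (hr : Represents s σ) (d v : ℕ) :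
    Represents (s.set d v) { σ with reg := Function.update σ.reg (d + 2) v } :=
  ⟨fun r => by simp [Function.update_apply, hr.reg], hr.mem, hr.out⟩

theorem represents_scratch {s : St} {σ : State} (hr : Represents s σ) {d v : ℕ} (hd : d < 2) :
    Represents s { σ with reg := Function.update σ.reg d v } :=
  ⟨fun r => by
    have : r + 2 ≠ d := by omega
    simp [hr.reg, this], hr.mem, hr.out⟩

theorem represents_tick {s : St} {σ : State} (hr : Represents s σ) : Represents s.tick σ :=
  ⟨hr.reg, hr.mem, hr.out⟩

/-- Each unit of `tm` pays for sixteen machine steps and lets the words grow by at most `64`. The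
factor `32` in the bound leaves room for the interleaved addresses `16 * i + c`. -/
theorem exec_compile {inp : List ℕ} {X B : ℕ} (hinp : ∀ i, inp.getD i 0 ≤ X) {p s s'}
    (h : Run inp p s s') : p.wf = true → ∀ σ, Represents s σ → Bounded X s →
      32 * (X + 64 * s'.tm) + 128 ≤ B → ∃ σ' n, Exec inp B (compile p) σ σ' n ∧
        Represents s' σ' ∧ Bounded X s' ∧ n + 16 * s.tm ≤ 16 * s'.tm := by
  induction h with
  | const s d c =>
    intro hw σ hr hb hB
    simp [Prog.wf] at hw hB
    exact ⟨_, _, .const _ _ _ (by omega), represents_set hr d c, hb.set (by omega), by simp; omega⟩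
  | mov s d a =>
    intro hw σ hr hb hB
    simp at hB
    have h1 := hb.reg a
    refine ⟨_, _, .seq _ _ _ _ _ _ _ (.const _ _ _ (by omega)) (.add _ _ _ _ ?_), ?_,
      hb.set (by omega), by simp; omega⟩
    · simp [hr.reg]; omega
    · simpa [hr.reg] using represents_set (represents_scratch hr (d := 0) (v := 0) (by omega)) d _
  | inc s d c =>
    intro hw σ hr hb hB
    simp [Prog.wf] at hw hB
    have h1 := hb.reg d
    refine ⟨_, _, .seq _ _ _ _ _ _ _ (.const _ _ _ (by omega)) (.add _ _ _ _ ?_), ?_,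
      hb.set (by omega), by simp; omega⟩
    · simp [hr.reg]; omega
    · simpa [hr.reg] using represents_set (represents_scratch hr (d := 0) (v := c) (by omega)) d _
  | sub s d a b =>
    intro hw σ hr hb hB
    have h1 := hb.reg a
    refine ⟨_, _, .sub _ _ _ _, ?_, hb.set (by omega), by simp; omega⟩
    simpa [hr.reg] using represents_set hr d _
  | ld s d c a =>
    intro hw σ hr hb hB
    simp [Prog.wf] at hw hB
    have h1 := hb.reg a
    have h2 := hb.arr c (s.reg a)
    obtain ⟨σ', h3, h4, h5⟩ := exec_addrCmd (inp := inp) (B := B) hr c a (by omega)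
    refine ⟨_, _, .seq _ _ _ _ _ _ _ h3 (.load _ _ _), ?_, hb.set (by omega), by simp; omega⟩
    rw [h4, h5.mem c hw]
    exact represents_set h5 d _
  | st s c a b =>
    intro hw σ hr hb hB
    simp [Prog.wf] at hw hB
    have h1 := hb.reg a
    have h2 := hb.reg b
    obtain ⟨σ', h3, h4, h5⟩ := exec_addrCmd (inp := inp) (B := B) hr c a (by omega)
    refine ⟨_, _, .seq _ _ _ _ _ _ _ h3 (.store _ _ _), ?_, hb.put (by omega), by simp; omega⟩
    refine ⟨h5.reg, fun c' hc' i => ?_, h5.out⟩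
    rw [h4, h5.reg b]
    simp only [Function.update_apply, St.put_arr]
    by_cases hcc : c' = c
    · subst hcc
      simp [h5.mem c' hc']
    · rw [if_neg (by omega), if_neg hcc, h5.mem c' hc']
  | read s d a b =>
    intro hw σ hr hb hB
    simp at hB
    have h1 := hb.reg a
    have h2 := hb.reg b
    have h3 := hinp (s.reg a + s.reg b)
    refine ⟨_, _, .seq _ _ _ _ _ _ _ (.add _ _ _ _ ?_) (.read _ _ _ ?_), ?_,
      hb.set (by omega), by simp; omega⟩
    · simp [hr.reg]; omega
    · simp only [Function.update_self, hr.reg]; omega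
    · simpa [hr.reg] using represents_set (represents_scratch hr (d := 0)
        (v := s.reg a + s.reg b) (by omega)) d _
  | write s a =>
    intro hw σ hr hb hB
    refine ⟨_, _, .write _ _, ⟨hr.reg, hr.mem, ?_⟩, ⟨hb.tick.reg, hb.tick.arr⟩, by simp; omega⟩
    simp [hr.out, hr.reg]
  | @seq p q s s' s'' hp hq ih1 ih2 =>
    intro hw σ hr hb hB
    simp [Prog.wf] at hw
    have h0 := hq.tm_le
    obtain ⟨σ', n, h1, h2, h3, h4⟩ := ih1 hw.1 σ hr hb (by omega)
    obtain ⟨σ'', n', h5, h6, h7, h8⟩ := ih2 hw.2 σ' h2 h3 hB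
    exact ⟨σ'', _, .seq _ _ _ _ _ _ _ h1 h5, h6, h7, by omega⟩
  | @eq_true a b p q s s' h hp ih =>
    intro hw σ hr hb hB
    simp [Prog.wf] at hw
    have h1 := hb.reg a
    have h0 := hp.tm_le
    simp at h0
    obtain ⟨σ', n, h1, h2, h3, h4⟩ := ih hw.1 _ (represents_tick (represents_scratch
      (represents_scratch (represents_scratch hr (d := 0) (v := 0) (by omega)) (d := 1) (v := 0)
        (by omega)) (d := 0) (v := 0) (by omega))) hb.tick hB
    refine ⟨σ', _, .seq _ _ _ _ _ _ _ (.sub _ _ _ _) (.seq _ _ _ _ _ _ _ (.sub _ _ _ _)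
      (.seq _ _ _ _ _ _ _ (.add _ _ _ _ ?_) (.ite_false _ _ _ _ _ n ?_ ?_))), h2, h3, ?_⟩
    · simp [hr.reg, h]
    · simp [hr.reg, h]
    · simpa [hr.reg, h] using h1
    · simp at h4; omega
  | @eq_false a b p q s s' h hp ih =>
    intro hw σ hr hb hB
    simp [Prog.wf] at hw
    have h1 := hb.reg a
    have h2 := hb.reg b
    have h0 := hp.tm_le
    simp at h0
    obtain ⟨σ', n, h1, h2, h3, h4⟩ := ih hw.2 _ (represents_tick (represents_scratch
      (represents_scratch (represents_scratch hr (d := 0) (v := s.reg a - s.reg b) (by omega))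
        (d := 1) (v := s.reg b - s.reg a) (by omega)) (d := 0)
        (v := s.reg a - s.reg b + (s.reg b - s.reg a)) (by omega))) hb.tick hB
    refine ⟨σ', _, .seq _ _ _ _ _ _ _ (.sub _ _ _ _) (.seq _ _ _ _ _ _ _ (.sub _ _ _ _)
      (.seq _ _ _ _ _ _ _ (.add _ _ _ _ ?_) (.ite_true _ _ _ _ _ n ?_ ?_))), h2, h3, ?_⟩
    · simp [hr.reg]; omega
    · simp [hr.reg]; omega
    · simpa [hr.reg] using h1
    · simp at h4; omega
  | @lt_true a b p q s s' h hp ih =>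
    intro hw σ hr hb hB
    simp [Prog.wf] at hw
    obtain ⟨σ', n, h1, h2, h3, h4⟩ := ih hw.1 _ (represents_tick
      (represents_scratch hr (d := 0) (v := s.reg b - s.reg a) (by omega))) hb.tick hB
    refine ⟨σ', _, .seq _ _ _ _ _ _ _ (.sub _ _ _ _) (.ite_true _ _ _ _ _ n ?_ ?_), h2, h3, ?_⟩
    · simp [hr.reg]; omega
    · simpa [hr.reg] using h1
    · simp at h4; omega
  | @lt_false a b p q s s' h hp ih =>
    intro hw σ hr hb hB
    simp [Prog.wf] at hw
    obtain ⟨σ', n, h1, h2, h3, h4⟩ := ih hw.2 _ (represents_tick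
      (represents_scratch hr (d := 0) (v := s.reg b - s.reg a) (by omega))) hb.tick hB
    refine ⟨σ', _, .seq _ _ _ _ _ _ _ (.sub _ _ _ _) (.ite_false _ _ _ _ _ n ?_ ?_), h2, h3, ?_⟩
    · simp [hr.reg]; omega
    · simpa [hr.reg] using h1
    · simp at h4; omega
  | @loop_done a b p s h =>
    intro hw σ hr hb hB
    refine ⟨_, _, .seq _ _ _ _ _ _ _ (.sub _ _ _ _) (.loop_done _ _ _ ?_),
      represents_tick (represents_scratch hr (by omega)), hb.tick, by simp; omega⟩
    simp [hr.reg]; omega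
  | @loop_step a b p s s' s'' h hp hl ih1 ih2 =>
    intro hw σ hr hb hB
    have h0 := hl.tm_le
    obtain ⟨σ', n, h1, h2, h3, h4⟩ := ih1 (by simpa [Prog.wf] using hw) _ (represents_tick
      (represents_scratch hr (d := 0) (v := s.reg b - s.reg a) (by omega))) hb.tick (by omega)
    obtain ⟨σ'', n', h5, h6, h7, h8⟩ := ih2 hw σ' h2 h3 hB
    -- The execution of the remaining loop begins with a computation of its test. That subtraction
    -- is reassigned to the end of the pass just made, where the body of the compiled loop has it.
    unfold compile at h5
    cases h5 with
    | seq _ _ _ σ₁ _ m m' h9 h10 =>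
      cases h9 with
      | sub =>
        refine ⟨σ'', _, .seq _ _ _ _ _ _ _ (.sub _ _ _ _) (.loop_step _ _ _ _ _ _ _ ?_
          (.seq _ _ _ _ _ n 1 ?_ (.sub _ _ _ _)) h10), h6, h7, ?_⟩
        · simp [hr.reg]; omega
        · simpa [hr.reg] using h1
        · simp at h4; omega

/-! ### Lists and pools in memory

Registers: `0`, `3` and `4` hold the constants `0`, `1` and `3`; register `1` holds the size of the
pool and register `2` the first free position of the heap. Arrays: the rows of the pool start and
end at the positions in the arrays `0` and `1`; array `2` holds the ranks of the exponents in the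
pool and array `3` the successors; the arrays `4` and `5` are the heap (indices and signs). -/

/-- The word that stands for a sign in the heap. -/
def code (b : Bool) : ℕ := if b then 2 else 1

theorem code_inj {b c : Bool} : code b = code c ↔ b = c := by cases b <;> cases c <;> simp [code]
theorem three_sub_code (b : Bool) : 3 - code b = code (!b) := by cases b <;> rfl

/-- The heap segment from `a` to `b` holds the list `L`; the exponents are given by their indices
in the pool `E`. -/
structure HeapList (A : ℕ → ℕ → ℕ) (E : List ℕ) (a b : ℕ) (L : List (ℕ × Bool)) : Prop where
  len : a + L.length = b
  get : ∀ q (h : q < L.length), E[A 4 (a + q)]? = some L[q].1 ∧ A 5 (a + q) = code L[q].2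

/-- Lists persist as long as the heap is only written beyond them and the pool is only extended:
indices keep their meaning. -/
theorem HeapList.congr {A A' : ℕ → ℕ → ℕ} {E E' : List ℕ} {a b L} (h : HeapList A E a b L)
    (hA : ∀ x < b, A' 4 x = A 4 x ∧ A' 5 x = A 5 x) (hE : E <+: E') : HeapList A' E' a b L := by
  refine ⟨h.len, fun q hq => ?_⟩
  have h1 := h.get q hq
  have h2 := hA (a + q) (by have := h.len; omega)
  rw [h2.1, h2.2]
  refine ⟨?_, h1.2⟩
  obtain ⟨F, rfl⟩ := hE
  rw [List.getElem?_append_left (List.getElem?_eq_some_iff.1 h1.1).1]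
  exact h1.1

theorem heapList_nil (A E a) : HeapList A E a a [] := ⟨by simp, by simp⟩

theorem HeapList.snoc {A A' : ℕ → ℕ → ℕ} {E : List ℕ} {a p e b L} (h : HeapList A E a p L)
    (hA : ∀ x < p, A' 4 x = A 4 x ∧ A' 5 x = A 5 x) (hi : E[A' 4 p]? = some e)
    (hs : A' 5 p = code b) : HeapList A' E a (p + 1) (L ++ [(e, b)]) := by
  have h0 := h.len
  refine ⟨by simp; omega, fun q hq => ?_⟩
  by_cases hq' : q < L.length
  · rw [List.getElem_append_left hq', (hA (a + q) (by omega)).1, (hA (a + q) (by omega)).2]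
    exact h.get q hq'
  · have : q = L.length := by simp at hq; omega
    subst this
    simp [h0, hi, hs]

theorem HeapList.cons_inv {A : ℕ → ℕ → ℕ} {E : List ℕ} {a p L} (h : HeapList A E a p L)
    (hap : a < p) : ∃ e b M, L = (e, b) :: M ∧ E[A 4 a]? = some e ∧ A 5 a = code b ∧
      HeapList A E (a + 1) p M := by
  have h0 := h.len
  cases L with
  | nil => simp at h0; omega
  | cons x M =>
    obtain ⟨e, b⟩ := x
    have h1 := h.get 0 (by simp)
    refine ⟨e, b, M, rfl, by simpa using h1.1, by simpa using h1.2, by simp at h0; omega,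
      fun q hq => ?_⟩
    have h2 := h.get (q + 1) (by simpa)
    rw [show a + 1 + q = a + (q + 1) by ring]
    simpa using h2

theorem HeapList.nil_inv {A : ℕ → ℕ → ℕ} {E : List ℕ} {a p L} (h : HeapList A E a p L)
    (hap : ¬ a < p) : L = [] := by
  have := h.len
  exact List.length_eq_zero_iff.1 (by omega)

theorem HeapList.snoc_inv {A : ℕ → ℕ → ℕ} {E : List ℕ} {a p L} (h : HeapList A E a p L)
    (hap : a < p) : ∃ e b M, L = M ++ [(e, b)] ∧ E[A 4 (p - 1)]? = some e ∧ A 5 (p - 1) = code b ∧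
      HeapList A E a (p - 1) M := by
  have h0 := h.len
  rcases List.eq_nil_or_concat' L with rfl | ⟨M, ⟨e, b⟩, rfl⟩
  · simp at h0; omega
  · have h1 := h.get M.length (by simp)
    simp at h0 h1
    rw [show a + M.length = p - 1 by omega] at h1
    refine ⟨e, b, M, rfl, h1.1, h1.2, by omega, fun q hq => ?_⟩
    have h2 := h.get q (by simp; omega)
    rwa [List.getElem_append_left hq] at h2

/-- The pool `E` of exponents is stored in the arrays. -/
structure Pool (A : ℕ → ℕ → ℕ) (hp : ℕ) (E : List ℕ) : Prop where
  zero : E[0]? = some 0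
  nodup : E.Nodup
  rank : ∀ {i e : ℕ}, E[i]? = some e → A 2 i = E.countP (· < e)
  -- An expansion refers to earlier pool members only. The pool is therefore acyclic along its
  -- indices, which the search for reachable vertices exploits.
  row : ∀ {i e : ℕ}, E[i]? = some e → ∃ L, HeapList A (E.take i) (A 0 i) (A 1 i) L ∧ IsNaf L ∧
    val L = (e : ℤ) ∧ A 1 i ≤ hp
  -- The entry `0` stands for an unknown successor; no confusion arises, as index `0` belongs to the
  -- exponent `0`, which is no successor.
  succ : ∀ {i e : ℕ}, E[i]? = some e → A 3 i ≠ 0 → E[A 3 i]? = some (e + 1)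

/-- The successor of the exponent `e` is known. -/
def HasSucc (A : ℕ → ℕ → ℕ) (E : List ℕ) (e : ℕ) : Prop := ∃ i, E[i]? = some e ∧ A 3 i ≠ 0

/-- The count is strictly larger for `b` because `a` itself is counted below `b` but not below `a`.
So ranks replace comparisons of exponents, which may be astronomically large. -/
theorem countP_lt_iff {E : List ℕ} {a b : ℕ} (ha : a ∈ E) :
    E.countP (· < a) < E.countP (· < b) ↔ a < b := by
  have mono : ∀ {a b : ℕ}, a ≤ b → E.countP (· < a) ≤ E.countP (· < b) := fun h =>
    List.countP_mono_left fun x _ hx => by simp at hx ⊢; omega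
  constructor
  · intro h
    by_contra hc
    have := mono (not_lt.1 hc)
    omega
  · intro h
    induction E with
    | nil => simp at ha
    | cons x E ih =>
      have mono' : ∀ E : List ℕ, E.countP (· < a) ≤ E.countP (· < b) := fun E =>
        List.countP_mono_left fun x _ hx => by simp at hx ⊢; omega
      have h1 := mono' E
      rw [List.countP_cons, List.countP_cons]
      by_cases hx : x = a
      · subst hx; simp [h]; omega
      · have := ih ((List.mem_cons.1 ha).resolve_left (Ne.symm hx)) (fun h =>
          List.countP_mono_left fun x _ hx => by simp at hx ⊢; omega)
        by_cases h2 : x < a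
        · simp [h2, h2.trans h]; omega
        · simp [h2]; split_ifs <;> omega

theorem Pool.inj {A hp E} (h : Pool A hp E) {i j e : ℕ} (hi : E[i]? = some e)
    (hj : E[j]? = some e) : i = j := by
  obtain ⟨h1, h2⟩ := List.getElem?_eq_some_iff.1 hi
  exact (List.getElem?_inj h1 h.nodup).1 (hi.trans hj.symm)

theorem Pool.rank_lt {A hp E} (h : Pool A hp E) {i j e f : ℕ} (hi : E[i]? = some e)
    (hj : E[j]? = some f) : A 2 i < A 2 j ↔ e < f := by
  rw [h.rank hi, h.rank hj]
  exact countP_lt_iff (List.mem_of_getElem? hi)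

theorem Pool.idx_eq {A hp E} (h : Pool A hp E) {i j e f : ℕ} (hi : E[i]? = some e)
    (hj : E[j]? = some f) : i = j ↔ e = f := by
  constructor
  · rintro rfl; simpa using hi.symm.trans hj
  · rintro rfl; exact h.inj hi hj

theorem Pool.succ_of_has {A hp E} (h : Pool A hp E) {i e : ℕ} (hi : E[i]? = some e)
    (hs : HasSucc A E e) : E[A 3 i]? = some (e + 1) := by
  obtain ⟨j, hj, hj'⟩ := hs
  rw [h.inj hi hj]
  exact h.succ hj hj'

/-- Adjacency of exponents becomes an equality of indices. It is reliable only if the successor is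
recorded whenever `f` is one, and only for `f ≠ 0`, since an unknown successor is coded by the index
of `0`. -/
theorem Pool.succ_eq {A hp E} (h : Pool A hp E) {i j e f : ℕ} (hi : E[i]? = some e)
    (hj : E[j]? = some f) (hs : f = e + 1 → HasSucc A E e) (hj0 : f ≠ 0) :
    A 3 i = j ↔ f = e + 1 := by
  constructor
  · rintro rfl
    have h1 : A 3 i ≠ 0 := by
      intro h0
      rw [h0, h.zero] at hj
      simp at hj; omega
    simpa using hj.symm.trans (h.succ hi h1)
  · intro hf
    have := h.succ_of_has hi (hs hf)
    exact h.inj this (hf ▸ hj)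

theorem Pool.congr {A A' : ℕ → ℕ → ℕ} {hp hp' E} (h : Pool A hp E)
    (hA : ∀ x < hp, A' 4 x = A 4 x ∧ A' 5 x = A 5 x) (hc : ∀ c < 4, A' c = A c) (hh : hp ≤ hp') :
    Pool A' hp' E := by
  refine ⟨h.zero, h.nodup, fun hi => ?_, fun {i e} hi => ?_, fun hi => ?_⟩
  · rw [hc 2 (by omega)]; exact h.rank hi
  · obtain ⟨L, h1, h2, h3, h4⟩ := h.row hi
    rw [hc 0 (by omega), hc 1 (by omega)]
    exact ⟨L, h1.congr (fun x hx => hA x (by omega)) (List.prefix_refl _), h2, h3, by omega⟩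
  · rw [hc 3 (by omega)]; exact h.succ hi

/-- What a routine leaves unchanged that only appends to the heap and uses the registers from `5`
to `k - 1`. -/
structure Frame (k : ℕ) (s s' : St) : Prop where
  reg : ∀ r, r < 2 ∨ r = 3 ∨ r = 4 ∨ k ≤ r → s'.reg r = s.reg r
  out : s'.out = s.out
  hp : s.reg 2 ≤ s'.reg 2
  heap : ∀ x < s.reg 2, s'.arr 4 x = s.arr 4 x ∧ s'.arr 5 x = s.arr 5 x
  arr : ∀ c, c ≠ 4 → c ≠ 5 → s'.arr c = s.arr c

theorem Frame.refl (k s) : Frame k s s := ⟨by simp, rfl, le_rfl, by simp, by simp⟩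

theorem Frame.trans {k k' s s' s''} (h : Frame k s s') (h' : Frame k' s' s'') (hk : k ≤ k') :
    Frame k' s s'' :=
  ⟨fun r hr => by rw [h'.reg r hr, h.reg r (by omega)], h'.out.trans h.out, h.hp.trans h'.hp,
    fun x hx => by
      have h1 := h.heap x hx
      have h2 := h'.heap x (lt_of_lt_of_le hx h.hp)
      exact ⟨h2.1.trans h1.1, h2.2.trans h1.2⟩,
    fun c h4 h5 => (h'.arr c h4 h5).trans (h.arr c h4 h5)⟩

theorem Frame.pool {k s s' E} (h : Frame k s s') (hP : Pool s.arr (s.reg 2) E) :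
    Pool s'.arr (s'.reg 2) E :=
  hP.congr h.heap (fun c hc => h.arr c (by omega) (by omega)) h.hp

theorem Frame.heapList {k s s' E a b L} (h : Frame k s s') (hL : HeapList s.arr E a b L)
    (hb : b ≤ s.reg 2) : HeapList s'.arr E a b L :=
  hL.congr (fun x hx => h.heap x (by omega)) (List.prefix_refl _)

theorem Frame.hasSucc {k s s' E e} (h : Frame k s s') (hs : HasSucc s.arr E e) :
    HasSucc s'.arr E e := by
  obtain ⟨i, h1, h2⟩ := hs
  exact ⟨i, h1, by rwa [h.arr 3 (by omega) (by omega)]⟩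

/-- The constant registers. -/
structure Consts (s : St) : Prop where
  zero : s.reg 0 = 0
  one : s.reg 3 = 1
  three : s.reg 4 = 3

theorem Frame.consts {k s s'} (h : Frame k s s') (hc : Consts s) : Consts s' :=
  ⟨by rw [h.reg 0 (by omega), hc.zero], by rw [h.reg 3 (by omega), hc.one],
    by rw [h.reg 4 (by omega), hc.three]⟩

/-- Append an entry to the heap. -/
def St.push (s : St) (i c : ℕ) : St := ((s.put 4 (s.reg 2) i).put 5 (s.reg 2) c).set 2 (s.reg 2 + 1)

@[simp] theorem St.push_reg (s : St) (i c r : ℕ) :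
    (s.push i c).reg r = if r = 2 then s.reg 2 + 1 else s.reg r := by simp [push]
@[simp] theorem St.push_out (s : St) (i c : ℕ) : (s.push i c).out = s.out := rfl
@[simp] theorem St.push_tm (s : St) (i c : ℕ) : (s.push i c).tm = s.tm + 3 := rfl
@[simp] theorem St.push_arr (s : St) (i c r j : ℕ) :
    (s.push i c).arr r j = if r = 5 then (if j = s.reg 2 then c else s.arr 5 j) else
      if r = 4 then (if j = s.reg 2 then i else s.arr 4 j) else s.arr r j := by
  simp [push]

def pushP (a b : ℕ) : Prog := .st 4 2 a ;; .st 5 2 b ;; .inc 2 1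

theorem wp_pushP {inp Q s} {a b : ℕ} :
    wp inp (pushP a b) Q s ↔ Q (s.push (s.reg a) (s.reg b)) := by
  simp [pushP, St.push]

theorem Frame.of_set {k s s'} {d v : ℕ} (h : Frame k s s') (hd : 5 ≤ d) (hd' : d < k) :
    Frame k s (s'.set d v) :=
  ⟨fun r hr => by simp [show r ≠ d by omega, h.reg r hr], h.out,
    by simp [show 2 ≠ d by omega, h.hp], h.heap, h.arr⟩

theorem Frame.of_tick {k s s'} (h : Frame k s s') : Frame k s s'.tick :=
  ⟨h.reg, h.out, h.hp, h.heap, h.arr⟩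

theorem Frame.of_push {k s s'} {i c : ℕ} (h : Frame k s s') (hk : 5 ≤ k) : Frame k s (s'.push i c) :=
  ⟨fun r hr => by simp [show r ≠ 2 by omega, h.reg r hr], h.out,
    by have := h.hp; simp; omega, fun x hx => by
      have := h.hp
      simp [show x ≠ s'.reg 2 by omega, h.heap x hx],
    fun d h4 h5 => by funext x; simp [h4, h5, h.arr d h4 h5]⟩

theorem HeapList.push {s : St} {E a p O i c e b} (h : HeapList s.arr E a p O) (hp : s.reg 2 = p)
    (hi : E[i]? = some e) (hc : c = code b) : HeapList (s.push i c).arr E a (p + 1) (O ++ [(e, b)]) := by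
  refine h.snoc (fun x hx => ?_) ?_ ?_
  · simp [show x ≠ s.reg 2 by omega]
  · simpa [hp] using hi
  · simpa [hp] using hc

theorem HeapList.of_push {s : St} {E a p O i c} (h : HeapList s.arr E a p O) (hp : p ≤ s.reg 2) :
    HeapList (s.push i c).arr E a p O :=
  h.congr (fun x hx => by simp [show x ≠ s.reg 2 by omega]) (List.prefix_refl _)

/-- One step of the addition of a signed power of two to a list. -/
def insBody : Prog :=
  .ld 16 4 10 ;; .ld 17 5 10 ;; .inc 10 1 ;;
  -- Register `15` is `1` as long as the power of two has not been absorbed; afterwards the rest of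
  -- the list is merely copied.
  .ifEq 15 0 (pushP 16 17)
  (.ifEq 12 16
    (.ifEq 13 17 (.ld 12 3 12) (.mov 15 0))
    (.ld 18 2 12 ;; .ld 19 2 16 ;;
     .ifLt 18 19
       (.ld 20 3 12 ;;
        .ifEq 20 16
          (.ifEq 13 17 (.sub 17 4 13 ;; pushP 12 17 ;; .ld 12 3 16) (pushP 12 17 ;; .mov 15 0))
          (pushP 12 13 ;; pushP 16 17 ;; .mov 15 0))
       (.ld 20 3 16 ;;
        .ifEq 20 12
          (.ifEq 13 17 (.sub 17 4 13 ;; pushP 16 17 ;; .ld 12 3 12) (pushP 16 13 ;; .mov 15 0))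
          (pushP 16 17))))

/-- Add the power of two with the index in register `12` and the sign in register `13` to the list
from `10` to `11`. The result is appended to the heap; register `14` points to its start. -/
def insP : Prog :=
  .mov 14 2 ;; .mov 15 3 ;; .loop 10 11 insBody ;; .ifEq 15 0 (.mov 15 0) (pushP 12 13)

/-- `O` has been written and `R` has not been read yet. What is missing from the result is either
`R` itself or `ins e b R`, so each branch of the loop body unfolds the recursion of `ins` once. The
budget is `20` per unread entry. -/
structure InsInv (s : St) (E : List ℕ) (b : Bool) (res : List (ℕ × Bool)) (n : ℕ) (s1 : St) :
    Prop where
  frame : Frame 30 s s1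
  finish : s1.reg 11 = s.reg 11
  start : s1.reg 14 = s.reg 2
  lists : ∃ O R, HeapList s1.arr E (s.reg 2) (s1.reg 2) O ∧
    HeapList s1.arr E (s1.reg 10) (s1.reg 11) R ∧ s1.tm + 20 * R.length ≤ s.tm + n ∧
    (s1.reg 15 = 0 ∧ O ++ R = res ∨ s1.reg 15 = 1 ∧ s1.reg 13 = code b ∧
      ∃ e, E[s1.reg 12]? = some e ∧ CarryOk (HasSucc s.arr E) e R ∧ O ++ ins e b R = res)

theorem wp_insBody {inp s E b res n s1} (hP : Pool s.arr (s.reg 2) E) (hc : Consts s)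
    (hle : s.reg 11 ≤ s.reg 2) (hI : InsInv s E b res n s1) (hlt : s1.reg 10 < s1.reg 11) :
    wp inp insBody (fun s2 => InsInv s E b res n s2 ∧
      s2.reg 11 - s2.reg 10 < s1.reg 11 - s1.reg 10) s1.tick := by
  obtain ⟨hf, hpb, hoa, O, R, hO, hR, ht, hor⟩ := hI
  obtain ⟨f, c, M, rfl, hf4, hf5, hM⟩ := hR.cons_inv hlt
  have hP1 := hf.pool hP
  have hc1 := hf.consts hc
  have hz := hc1.zero
  have h3 := hc1.three
  have hhp := hf.hp
  simp only [List.length_cons] at ht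
  have hvar : s1.reg 11 - (s1.reg 10 + 1) < s1.reg 11 - s1.reg 10 := by omega
  simp only [insBody, wp_seq, wp_ld, wp_inc, wp_ifEq, wp_ifLt, wp_mov, wp_sub, wp_pushP]
  simp [hf5, hz, h3]
  rcases hor with ⟨hgo, hres⟩ | ⟨hgo, hb, e, he, hok, hres⟩
  · simp only [hgo]
    refine ⟨fun _ => ?_, fun h => absurd trivial h⟩
    refine ⟨⟨?_, by simpa, by simpa, O ++ [(f, c)], M, ?_, ?_, by simp; omega,
      Or.inl ⟨by simpa, by simpa using hres⟩⟩, hvar⟩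
    · repeat' (first | exact hf | refine Frame.of_push ?_ (by norm_num) |
        refine Frame.of_set ?_ (by norm_num) (by norm_num) | refine Frame.of_tick ?_)
    · simp; exact HeapList.push hO (by simp) hf4 rfl
    · simp; exact HeapList.of_push hM (by simp; omega)
  · simp only [hgo, one_ne_zero, false_implies, true_and, not_false_eq_true, true_implies]
    rw [hb]
    -- The tests on indices, ranks and sign codes are translated into the tests on exponents and
    -- signs that `ins` makes.
    simp only [code_inj, hP1.idx_eq he hf4, hP1.rank_lt he hf4, three_sub_code]
    unfold ins at hres
    unfold CarryOk at hok
    simp only at hok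
    refine ⟨fun hef => ?_, fun hef => ?_⟩
    · subst hef
      simp only [if_true] at hres hok
      refine ⟨fun hbc => ?_, fun hbc => ?_⟩
      · rw [if_pos hbc] at hres
        refine ⟨⟨?_, by simpa, by simpa, O, M, ?_, ?_, by simp; omega,
          Or.inr ⟨by simpa, by simpa, e + 1, ?_, hok.2, hres⟩⟩, hvar⟩
        · repeat' (first | exact hf | refine Frame.of_push ?_ (by norm_num) |
            refine Frame.of_set ?_ (by norm_num) (by norm_num) | refine Frame.of_tick ?_)
        · simpa
        · simpa
        · simpa using hP1.succ_of_has he (hf.hasSucc hok.1)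
      · rw [if_neg hbc] at hres
        refine ⟨⟨?_, by simpa, by simpa, O, M, ?_, ?_, by simp; omega,
          Or.inl ⟨by simp, hres⟩⟩, hvar⟩
        · repeat' (first | exact hf | refine Frame.of_push ?_ (by norm_num) |
            refine Frame.of_set ?_ (by norm_num) (by norm_num) | refine Frame.of_tick ?_)
        · simpa
        · simpa
    · rw [if_neg hef] at hres hok
      refine ⟨fun hlt' => ?_, fun hlt' => ?_⟩
      · rw [if_pos hlt'] at hres hok
        rw [hP1.succ_eq he hf4 (fun h => hf.hasSucc (hok h).1) (by omega)]
        refine ⟨fun hfe => ?_, fun hfe => ?_⟩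
        · rw [if_pos hfe] at hres
          have hok' := hok hfe
          refine ⟨fun hbc => ?_, fun hbc => ?_⟩
          · rw [if_pos hbc] at hres
            refine ⟨⟨?_, by simpa, by simpa, O ++ [(e, !b)], M, ?_, ?_, by simp; omega,
              Or.inr ⟨by simpa, by simpa, f + 1, ?_, hok'.2.2, by simpa using hres⟩⟩, hvar⟩
            · repeat' (first | exact hf | refine Frame.of_push ?_ (by norm_num) |
                refine Frame.of_set ?_ (by norm_num) (by norm_num) | refine Frame.of_tick ?_)
            · simp; exact HeapList.push (by simpa using hO) (by simp) he rfl
            · simp; exact HeapList.of_push (by simpa using hM) (by simp; omega)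
            · simpa using hP1.succ_of_has hf4 (hf.hasSucc hok'.2.1)
          · rw [if_neg hbc] at hres
            refine ⟨⟨?_, by simpa, by simpa, O ++ [(e, c)], M, ?_, ?_, by simp; omega,
              Or.inl ⟨by simp, by simpa using hres⟩⟩, hvar⟩
            · repeat' (first | exact hf | refine Frame.of_push ?_ (by norm_num) |
                refine Frame.of_set ?_ (by norm_num) (by norm_num) | refine Frame.of_tick ?_)
            · simp; exact HeapList.push (by simpa using hO) (by simp) he rfl
            · simp; exact HeapList.of_push (by simpa using hM) (by simp; omega)
        · rw [if_neg hfe] at hres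
          refine ⟨⟨?_, by simpa, by simpa, O ++ [(e, b)] ++ [(f, c)], M, ?_, ?_, by simp; omega,
            Or.inl ⟨by simp, by simpa using hres⟩⟩, hvar⟩
          · repeat' (first | exact hf | refine Frame.of_push ?_ (by norm_num) |
              refine Frame.of_set ?_ (by norm_num) (by norm_num) | refine Frame.of_tick ?_)
          · simp only [St.set_reg, St.push_reg, St.tick_reg, St.set_arr]
            exact HeapList.push (HeapList.push (by simpa using hO) (by simp) he rfl) (by simp)
              hf4 rfl
          · simp; exact HeapList.of_push (HeapList.of_push (by simpa using hM) (by simp; omega))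
              (by simp; omega)
      · rw [← not_lt, hP1.rank_lt he hf4] at hlt'
        rw [if_neg hlt'] at hres hok
        have hs : e = f + 1 → HasSucc s1.arr E f := fun h => by
          rw [if_pos h] at hok; exact hf.hasSucc hok.1
        rw [hP1.succ_eq hf4 he hs (by omega)]
        refine ⟨fun hfe => ?_, fun hfe => ?_⟩
        · rw [if_pos hfe] at hres hok
          refine ⟨fun hbc => ?_, fun hbc => ?_⟩
          · rw [if_pos hbc] at hres
            refine ⟨⟨?_, by simpa, by simpa, O ++ [(f, !b)], M, ?_, ?_, by simp; omega,
              Or.inr ⟨by simpa, by simpa, e + 1, ?_, hok.2.2, by simpa using hres⟩⟩, hvar⟩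
            · repeat' (first | exact hf | refine Frame.of_push ?_ (by norm_num) |
                refine Frame.of_set ?_ (by norm_num) (by norm_num) | refine Frame.of_tick ?_)
            · simp; exact HeapList.push (by simpa using hO) (by simp) hf4 rfl
            · simp; exact HeapList.of_push (by simpa using hM) (by simp; omega)
            · simpa using hP1.succ_of_has he (hf.hasSucc hok.2.1)
          · rw [if_neg hbc] at hres
            refine ⟨⟨?_, by simpa, by simpa, O ++ [(f, b)], M, ?_, ?_, by simp; omega,
              Or.inl ⟨by simp, by simpa using hres⟩⟩, hvar⟩
            · repeat' (first | exact hf | refine Frame.of_push ?_ (by norm_num) |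
                refine Frame.of_set ?_ (by norm_num) (by norm_num) | refine Frame.of_tick ?_)
            · simp; exact HeapList.push (by simpa using hO) (by simp) hf4 rfl
            · simp; exact HeapList.of_push (by simpa using hM) (by simp; omega)
        · rw [if_neg hfe] at hres hok
          refine ⟨⟨?_, by simpa, by simpa, O ++ [(f, c)], M, ?_, ?_, by simp; omega,
            Or.inr ⟨by simpa, by simpa, e, by simpa, hok.2, by simpa using hres⟩⟩, hvar⟩
          · repeat' (first | exact hf | refine Frame.of_push ?_ (by norm_num) |
              refine Frame.of_set ?_ (by norm_num) (by norm_num) | refine Frame.of_tick ?_)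
          · simp; exact HeapList.push (by simpa using hO) (by simp) hf4 rfl
          · simp; exact HeapList.of_push (by simpa using hM) (by simp; omega)

theorem wp_insP {inp s E L b e} (hP : Pool s.arr (s.reg 2) E) (hc : Consts s)
    (hL : HeapList s.arr E (s.reg 10) (s.reg 11) L) (hle : s.reg 11 ≤ s.reg 2)
    (he : E[s.reg 12]? = some e) (hb : s.reg 13 = code b)
    (hok : CarryOk (HasSucc s.arr E) e L) :
    wp inp insP (fun s' => Frame 30 s s' ∧ HeapList s'.arr E (s'.reg 14) (s'.reg 2) (ins e b L) ∧
      s'.reg 14 = s.reg 2 ∧ s'.tm ≤ s.tm + 20 * (L.length + 1)) s := by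
  simp only [insP, wp_seq, wp_mov]
  have h3 := hc.one
  refine wp_mono (Q := fun s2 => InsInv s E b (ins e b L) (20 * L.length + 3) s2 ∧
    ¬ s2.reg 10 < s2.reg 11) ?_ ?_
  · refine wp_loop (InsInv s E b (ins e b L) (20 * L.length + 2)) (fun s => s.reg 11 - s.reg 10)
      ?_ (fun s1 hI hlt => wp_insBody hP hc hle hI hlt) ?_
    · refine ⟨?_, by simp, by simp, [], L, ?_, by simpa, by simp; omega,
        Or.inr ⟨by simpa, by simpa, e, by simpa, hok, by simp⟩⟩
      · exact ((Frame.refl _ _).of_set (by norm_num) (by norm_num)).of_set (by norm_num)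
          (by norm_num)
      · simp; exact heapList_nil _ _ _
    · rintro s1 ⟨hf, h1, h2, O, R, h3, h4, h5, h6⟩ hlt
      exact ⟨⟨hf.of_tick, h1, h2, O, R, h3, h4, by simp; omega, h6⟩, hlt⟩
  · rintro s2 ⟨⟨hf, h1, h2, O, R, h4, h5, h6, h7⟩, hlt⟩
    obtain rfl := h5.nil_inv hlt
    have hz := (hf.consts hc).zero
    simp only [wp_ifEq, wp_mov, wp_pushP, hz]
    rcases h7 with ⟨hgo, hres⟩ | ⟨hgo, hb', e', he', -, hres⟩
    · simp only [hgo]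
      simp at hres h6
      refine ⟨fun _ => ⟨?_, ?_, ?_, ?_⟩, fun h => absurd rfl h⟩
      · exact hf.of_tick.of_set (by norm_num) (by norm_num)
      · simpa [h2, ← hres] using h4
      · simpa using h2
      · simp; omega
    · simp only [hgo]
      simp [ins] at hres h6
      refine ⟨fun h => absurd h (by simp), fun _ => ⟨?_, ?_, ?_, ?_⟩⟩
      · exact hf.of_tick.of_push (by norm_num)
      · simp [h2, ← hres]
        exact HeapList.push h4 (by simp) he' hb'
      · simpa using h2
      · simp; omega

/-! ### Comparison of two expansions -/

/-- What a routine leaves unchanged that only uses the registers from `5` to `k - 1`. -/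
structure Quiet (k : ℕ) (s s' : St) : Prop where
  reg : ∀ r, r < 5 ∨ k ≤ r → s'.reg r = s.reg r
  out : s'.out = s.out
  arr : s'.arr = s.arr

theorem Quiet.refl (k s) : Quiet k s s := ⟨by simp, rfl, rfl⟩

theorem Quiet.trans {k k' s s' s''} (h : Quiet k s s') (h' : Quiet k' s' s'') (hk : k ≤ k') :
    Quiet k' s s'' :=
  ⟨fun r hr => by rw [h'.reg r hr, h.reg r (by omega)], h'.out.trans h.out, h'.arr.trans h.arr⟩

theorem Quiet.frame {k s s'} (h : Quiet k s s') : Frame k s s' :=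
  ⟨fun r hr => h.reg r (by omega), h.out, (h.reg 2 (by omega)).ge, by simp [h.arr],
    by simp [h.arr]⟩

theorem Quiet.of_set {k s s'} {d v : ℕ} (h : Quiet k s s') (hd : 5 ≤ d) (hd' : d < k) :
    Quiet k s (s'.set d v) :=
  ⟨fun r hr => by simp [show r ≠ d by omega, h.reg r hr], h.out, h.arr⟩

theorem Quiet.of_tick {k s s'} (h : Quiet k s s') : Quiet k s s'.tick := ⟨h.reg, h.out, h.arr⟩

theorem Quiet.consts {k s s'} (h : Quiet k s s') (hc : Consts s) : Consts s' := h.frame.consts hc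

/-- One step of the comparison of two lists from the top. -/
def cmpBody : Prog :=
  .ifLt 10 11
    (.ifLt 12 13
      (.sub 11 11 3 ;; .sub 13 13 3 ;; .ld 16 4 11 ;; .ld 17 5 11 ;; .ld 18 4 13 ;; .ld 19 5 13 ;;
        .ifEq 16 18
          (.ifEq 17 19 (.mov 15 3) (.mov 14 17 ;; .mov 15 0))
          (.mov 15 0 ;; .ld 20 2 16 ;; .ld 21 2 18 ;; .ifLt 20 21 (.sub 14 4 19) (.mov 14 17)))
      (.mov 15 0 ;; .sub 11 11 3 ;; .ld 14 5 11))
    (.mov 15 0 ;; .ifLt 12 13 (.sub 13 13 3 ;; .ld 19 5 13 ;; .sub 14 4 19) (.mov 15 0))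

/-- Compare the list from `10` to `11` with the list from `12` to `13`. Register `14` becomes `0`,
`1` or `2` if the first one is equal to, greater than, or less than the second one. -/
def cmpP : Prog := .const 14 0 ;; .mov 15 3 ;; .loop 0 15 cmpBody

/-- The outcome of a comparison with the difference `d`. -/
def CmpRes (r : ℕ) (d : ℤ) : Prop := (r = 0 ∧ d = 0) ∨ (r = 1 ∧ 0 < d) ∨ (r = 2 ∧ d < 0)

theorem cmpRes_code {b : Bool} {d : ℤ} (h : 0 < sgn b * d) : CmpRes (code b) d := by
  cases b
  · exact Or.inr (Or.inl ⟨rfl, by simpa using h⟩)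
  · exact Or.inr (Or.inr ⟨rfl, by simpa using h⟩)

/-- Register `15` is `1` while the comparison is undecided. Until then only equal leading entries
have been dropped, which leaves the difference `d` unchanged. The flag contributes to the variant
because the deciding pass need not shorten the first list. -/
structure CmpInv (s : St) (E : List ℕ) (d : ℤ) (n : ℕ) (s1 : St) : Prop where
  quiet : Quiet 30 s s1
  time : s1.tm + 20 * (s1.reg 15 + (s1.reg 11 - s1.reg 10)) ≤ s.tm + n
  lists : (s1.reg 15 = 0 ∧ CmpRes (s1.reg 14) d) ∨ (s1.reg 15 = 1 ∧ s1.reg 14 = 0 ∧ ∃ L M,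
    HeapList s.arr E (s1.reg 10) (s1.reg 11) L ∧ HeapList s.arr E (s1.reg 12) (s1.reg 13) M ∧
    IsNaf L ∧ IsNaf M ∧ val L - val M = d)

/-- The highest difference decides: the larger leading exponent wins with its sign by
`top_dominates`, equal exponents with opposite signs are separated by these signs, and an exhausted
list has the value `0`. -/
theorem wp_cmpBody {inp s E d n s1} (hP : Pool s.arr (s.reg 2) E) (hc : Consts s)
    (hI : CmpInv s E d n s1) (hlt : s1.reg 0 < s1.reg 15) :
    wp inp cmpBody (fun s2 => CmpInv s E d n s2 ∧
      s2.reg 15 + (s2.reg 11 - s2.reg 10) < s1.reg 15 + (s1.reg 11 - s1.reg 10)) s1.tick := by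
  obtain ⟨hq, ht, hor⟩ := hI
  have hc1 := hq.consts hc
  have hz := hc1.zero
  have h1 := hc1.one
  have h3 := hc1.three
  rcases hor with ⟨h0, -⟩ | ⟨hgo, h14, L, M, hL, hM, hLn, hMn, hd⟩
  · omega
  simp only [hgo] at ht ⊢
  simp only [cmpBody, wp_seq, wp_ld, wp_ifEq, wp_ifLt, wp_mov, wp_sub]
  simp [hz, h3, h1, hq.arr]
  refine ⟨fun h10 => ?_, fun h10 => ?_⟩
  · obtain ⟨e, b, L', rfl, he, hb, hL'⟩ := hL.snoc_inv h10
    refine ⟨fun h12 => ?_, fun h12 => ?_⟩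
    · obtain ⟨f, c, M', rfl, hf, hc', hM'⟩ := hM.snoc_inv h12
      simp only [hb, hc', code_inj, hP.idx_eq he hf, hP.rank_lt he hf, three_sub_code]
      refine ⟨fun hef => ⟨fun hbc => ?_, fun hbc => ?_⟩, fun hef => ⟨fun hlt => ?_, fun hlt => ?_⟩⟩
      · subst hef hbc
        refine ⟨⟨?_, by simp; omega, Or.inr ⟨by simp, by simpa, L', M', by simpa, by simpa,
          isNaf_prefix hLn, isNaf_prefix hMn, ?_⟩⟩, by omega⟩
        · repeat' (first | exact hq |
            refine Quiet.of_set ?_ (by norm_num) (by norm_num) | refine Quiet.of_tick ?_)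
        · rw [val_append, val_append] at hd; linarith
      · subst hef
        refine ⟨⟨?_, by simp; omega, Or.inl ⟨by simp, ?_⟩⟩, by omega⟩
        · repeat' (first | exact hq |
            refine Quiet.of_set ?_ (by norm_num) (by norm_num) | refine Quiet.of_tick ?_)
        · simp
          refine cmpRes_code ?_
          rw [← hd]
          cases b <;> cases c <;> simp at hbc
          · have := top_pos hLn; have := top_neg hMn; simp; omega
          · have := top_neg hLn; have := top_pos hMn; simp; omega
      · refine ⟨⟨?_, by simp; omega, Or.inl ⟨by simp, ?_⟩⟩, by omega⟩
        · repeat' (first | exact hq |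
            refine Quiet.of_set ?_ (by norm_num) (by norm_num) | refine Quiet.of_tick ?_)
        · simp
          refine cmpRes_code ?_
          have := top_dominates hMn hLn hlt
          rw [← hd, sgn_not]
          simp only at this
          linarith
      · rw [← not_lt, hP.rank_lt he hf] at hlt
        refine ⟨⟨?_, by simp; omega, Or.inl ⟨by simp, ?_⟩⟩, by omega⟩
        · repeat' (first | exact hq |
            refine Quiet.of_set ?_ (by norm_num) (by norm_num) | refine Quiet.of_tick ?_)
        · simp
          refine cmpRes_code ?_
          have := top_dominates hLn hMn (by simp only; omega)
          rw [← hd]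
          simpa using this
    · obtain rfl := hM.nil_inv (by omega)
      refine ⟨⟨?_, by simp; omega, Or.inl ⟨by simp, ?_⟩⟩, by omega⟩
      · repeat' (first | exact hq |
          refine Quiet.of_set ?_ (by norm_num) (by norm_num) | refine Quiet.of_tick ?_)
      · simp [hb]
        refine cmpRes_code ?_
        rw [← hd]
        cases b
        · have := top_pos hLn; simp; omega
        · have := top_neg hLn; simp; omega
  · obtain rfl := hL.nil_inv (by omega)
    refine ⟨fun h12 => ?_, fun h12 => ?_⟩
    · obtain ⟨f, c, M', rfl, hf, hc', hM'⟩ := hM.snoc_inv h12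
      refine ⟨?_, by simp; omega, Or.inl ⟨by simp, ?_⟩⟩
      · repeat' (first | exact hq |
          refine Quiet.of_set ?_ (by norm_num) (by norm_num) | refine Quiet.of_tick ?_)
      · simp [hc', three_sub_code]
        refine cmpRes_code ?_
        rw [← hd]
        cases c
        · have := top_pos hMn; simp; omega
        · have := top_neg hMn; simp; omega
    · obtain rfl := hM.nil_inv (by omega)
      refine ⟨?_, by simp; omega, Or.inl ⟨by simp, ?_⟩⟩
      · repeat' (first | exact hq |
          refine Quiet.of_set ?_ (by norm_num) (by norm_num) | refine Quiet.of_tick ?_)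
      · simp [h14]
        exact Or.inl ⟨rfl, by simpa using hd.symm⟩

theorem wp_cmpP {inp s E L M} (hP : Pool s.arr (s.reg 2) E) (hc : Consts s)
    (hL : HeapList s.arr E (s.reg 10) (s.reg 11) L) (hM : HeapList s.arr E (s.reg 12) (s.reg 13) M)
    (hLn : IsNaf L) (hMn : IsNaf M) :
    wp inp cmpP (fun s' => Quiet 30 s s' ∧ CmpRes (s'.reg 14) (val L - val M) ∧
      s'.tm ≤ s.tm + 20 * (L.length + 2)) s := by
  simp only [cmpP, wp_seq, wp_mov, wp_const]
  have h3 := hc.one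
  have hlen := hL.len
  refine wp_loop (CmpInv s E (val L - val M) (20 * L.length + 22))
    (fun s => s.reg 15 + (s.reg 11 - s.reg 10))
      ?_ (fun s1 hI hlt => wp_cmpBody hP hc hI hlt) ?_
  · refine ⟨?_, by simp; omega,
      Or.inr ⟨by simpa, by simp, L, M, by simpa, by simpa, hLn, hMn, rfl⟩⟩
    exact ((Quiet.refl _ _).of_set (by norm_num) (by norm_num)).of_set (by norm_num)
          (by norm_num)
  · rintro s1 ⟨hq, ht, hor⟩ hlt
    rw [(hq.consts hc).zero] at hlt
    rcases hor with ⟨h15, h⟩ | ⟨h15, -⟩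
    · exact ⟨hq.of_tick, h, by simp; omega⟩
    · omega

/-! ### Finding an exponent in the pool, or adding it -/

theorem getElem?_snoc {E : List ℕ} {e i x : ℕ} :
    (E ++ [e])[i]? = some x ↔ E[i]? = some x ∨ (i = E.length ∧ x = e) := by
  rcases lt_trichotomy i E.length with h | h | h
  · rw [List.getElem?_append_left h]
    constructor
    · exact Or.inl
    · rintro (h' | h'); exacts [h', by omega]
  · subst h
    simp [eq_comm]
  · rw [List.getElem?_eq_none (by simp; omega), List.getElem?_eq_none (by omega)]
    simp; omega

theorem lt_length_of_getElem? {E : List ℕ} {i x : ℕ} (h : E[i]? = some x) : i < E.length :=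
  (List.getElem?_eq_some_iff.1 h).1

/-- Compare a list with the row of index `R 34` of the pool. -/
def findBody : Prog :=
  .mov 10 30 ;; .mov 11 31 ;; .ld 12 0 34 ;; .ld 13 1 34 ;; cmpP ;;
  .ifEq 14 0 (.mov 33 34) (.ifEq 14 3 (.inc 32 1) (.mov 14 0)) ;; .inc 34 1

/-- Increase the rank of a row of the pool unless it is less than `R 32`. -/
def rankBody : Prog :=
  .ld 10 2 34 ;; .ifLt 10 32 (.mov 14 0) (.inc 10 1 ;; .st 2 34 10) ;; .inc 34 1

/-- Find the index of an exponent, given by the list from `30` to `31`, in the pool; if necessary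
it is added to the pool. The index is put into register `33`. -/
def findP : Prog :=
  .const 32 0 ;; .mov 33 1 ;; .const 34 0 ;; .loop 34 1 findBody ;;
  .ifEq 33 1
    (.const 34 0 ;; .loop 34 1 rankBody ;; .st 2 1 32 ;; .st 0 1 30 ;; .st 1 1 31 ;; .st 3 1 0 ;;
      .inc 1 1)
    (.mov 14 0)

/-- Register `32` counts the smaller exponents met so far and ends up as the rank of `e`. Register
`33` starts with the size of the pool, which is no valid index, and so reveals at the end whether
`e` was met; it is also the index of the new row if `e` has to be added. -/
structure FindInv (s : St) (E : List ℕ) (e n T : ℕ) (s1 : St) : Prop where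
  quiet : Quiet 40 s s1
  start : s1.reg 30 = s.reg 30
  finish : s1.reg 31 = s.reg 31
  le : s1.reg 34 ≤ E.length
  count : s1.reg 32 = (E.take (s1.reg 34)).countP (· < e)
  idx : (s1.reg 33 = E.length ∧ e ∉ E.take (s1.reg 34)) ∨ E[s1.reg 33]? = some e
  time : s1.tm + T * (E.length - s1.reg 34) ≤ s.tm + n

theorem wp_findBody {inp s E L n s1} {e : ℕ} (hP : Pool s.arr (s.reg 2) E) (hc : Consts s)
    (hm : s.reg 1 = E.length) (hL : HeapList s.arr E (s.reg 30) (s.reg 31) L) (hLn : IsNaf L)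
    (he : val L = (e : ℤ)) (hI : FindInv s E e n (20 * (L.length + 3)) s1)
    (hlt : s1.reg 34 < s1.reg 1) :
    wp inp findBody (fun s2 => FindInv s E e n (20 * (L.length + 3)) s2 ∧
      s2.reg 1 - s2.reg 34 < s1.reg 1 - s1.reg 34) s1.tick := by
  obtain ⟨hq, h30, h31, hle, hcnt, hidx, ht⟩ := hI
  have hc1 := hq.consts hc
  have hm1 : s1.reg 1 = E.length := by rw [hq.reg 1 (by omega), hm]
  have hP1 := hq.frame.pool hP
  have hj : s1.reg 34 < E.length := by omega
  obtain ⟨f, hf⟩ : ∃ f, E[s1.reg 34]? = some f := ⟨_, List.getElem?_eq_getElem hj⟩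
  obtain ⟨M, hM, hMn, hMv, hMle⟩ := hP1.row hf
  simp only [findBody, wp_seq, wp_mov, wp_ld]
  refine wp_mono (wp_cmpP (E := E) (L := L) (M := M) ?_ ?_ ?_ ?_ hLn hMn) ?_
  · simpa using hP1
  · exact ⟨by simpa using hc1.zero, by simpa using hc1.one, by simpa using hc1.three⟩
  · simpa [h30, h31, hq.arr] using hL
  · simpa using hM.congr (fun _ _ => ⟨rfl, rfl⟩) (List.take_prefix _ _)
  · rintro s2 ⟨hq2, hres, ht2⟩
    have hq3 : Quiet 30 s1 s2 :=
      Quiet.trans (k := 30) (by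
        repeat' (first | exact Quiet.refl _ _ | refine Quiet.of_tick ?_ |
          refine Quiet.of_set ?_ (by norm_num) (by norm_num))) hq2 le_rfl
    have hq4 : Quiet 40 s s2 := hq.trans (Quiet.trans hq3 (Quiet.refl 40 _) (by norm_num)) le_rfl
    have hc2 := hq3.consts hc1
    have g34 := hq3.reg 34 (by norm_num)
    have g33 := hq3.reg 33 (by norm_num)
    have g32 := hq3.reg 32 (by norm_num)
    have g31 := hq3.reg 31 (by norm_num)
    have g30 := hq3.reg 30 (by norm_num)
    have g1 := hq3.reg 1 (by norm_num)
    simp at ht2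
    have htake : E.take (s1.reg 34 + 1) = E.take (s1.reg 34) ++ [f] := by
      rw [List.take_add_one, hf]; rfl
    have ht3 : s1.tm + 20 * (L.length + 3) * (E.length - (s1.reg 34 + 1)) + 20 * (L.length + 3)
        ≤ s.tm + n := by
      refine le_trans (le_of_eq ?_) ht
      rw [show E.length - s1.reg 34 = E.length - (s1.reg 34 + 1) + 1 by omega]; ring
    simp only [wp_ifEq, wp_mov, wp_inc, hc2.zero]
    have hv : s1.reg 1 - (s1.reg 34 + 1) < s1.reg 1 - s1.reg 34 := by omega
    rw [he, hMv] at hres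
    simp [hc2.one]
    refine ⟨fun h14 => ⟨⟨?_, by simpa [g30], by simpa [g31], by simp; omega, ?_, ?_, ?_⟩, ?_⟩,
      fun h14 => ⟨fun h14' => ⟨⟨?_, by simpa [g30], by simpa [g31], by simp; omega, ?_, ?_, ?_⟩, ?_⟩,
      fun h14' => ⟨⟨?_, by simpa [g30], by simpa [g31], by simp; omega, ?_, ?_, ?_⟩, ?_⟩⟩⟩
    · repeat' (first | exact hq4 | refine Quiet.of_tick ?_ |
          refine Quiet.of_set ?_ (by norm_num) (by norm_num))
    · have : ¬ f < e := by rcases hres with h | h | h <;> omega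
      simp [g34, g32, htake, hcnt, List.countP_append, this]
    · right
      have : e = f := by rcases hres with h | h | h <;> omega
      simp [g34, hf, this]
    · simp [g34]; omega
    · rw [g1, g34]; exact hv
    · repeat' (first | exact hq4 | refine Quiet.of_tick ?_ |
          refine Quiet.of_set ?_ (by norm_num) (by norm_num))
    · have : f < e := by rcases hres with h | h | h <;> omega
      simp [g34, g32, htake, hcnt, List.countP_append, this]
    · simp [g34, g33, htake]
      have : e ≠ f := by rcases hres with h | h | h <;> omega
      tauto
    · simp [g34]; omega
    · rw [g1, g34]; exact hv
    · repeat' (first | exact hq4 | refine Quiet.of_tick ?_ |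
          refine Quiet.of_set ?_ (by norm_num) (by norm_num))
    · have : ¬ f < e := by rcases hres with h | h | h <;> omega
      simp [g34, g32, htake, hcnt, List.countP_append, this]
    · simp [g34, g33, htake]
      have : e ≠ f := by rcases hres with h | h | h <;> omega
      tauto
    · simp [g34]; omega
    · rw [g1, g34]; exact hv

/-- A new exponent raises by one exactly those ranks that are not below its own rank, held in
register `32`; this has been done for the rows before register `34`. -/
structure RankInv (s : St) (m n : ℕ) (s1 : St) : Prop where
  reg : ∀ r, r < 10 ∨ (30 ≤ r ∧ r ≠ 34) → s1.reg r = s.reg r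
  out : s1.out = s.out
  arr : ∀ c, c ≠ 2 → s1.arr c = s.arr c
  le : s1.reg 34 ≤ m
  rank : ∀ i, s1.arr 2 i =
    if i < s1.reg 34 ∧ s.reg 32 ≤ s.arr 2 i then s.arr 2 i + 1 else s.arr 2 i
  time : s1.tm + 10 * (m - s1.reg 34) ≤ s.tm + n

theorem wp_rankBody {inp s m n s1} (hm : s.reg 1 = m) (hI : RankInv s m n s1)
    (hlt : s1.reg 34 < s1.reg 1) : wp inp rankBody (fun s2 => RankInv s m n s2 ∧
      s2.reg 1 - s2.reg 34 < s1.reg 1 - s1.reg 34) s1.tick := by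
  obtain ⟨hreg, hout, harr, hle, hrank, ht⟩ := hI
  have h1 := hreg 1 (by omega)
  have h32 := hreg 32 (by omega)
  have h34 : s1.arr 2 (s1.reg 34) = s.arr 2 (s1.reg 34) := by rw [hrank]; simp
  simp only [rankBody, wp_seq, wp_ld, wp_ifLt, wp_mov, wp_inc, wp_st]
  simp [h32, h34]
  refine ⟨fun h => ⟨⟨fun r hr => ?_, by simpa, fun c hc' => ?_, by simp; omega, fun i => ?_,
    by simp; omega⟩, by omega⟩, fun h => ⟨⟨fun r hr => ?_, by simpa, fun c hc' => ?_,
      by simp; omega, fun i => ?_, by simp; omega⟩, by omega⟩⟩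
  · simp [show r ≠ 34 by omega, show r ≠ 14 by omega, show r ≠ 10 by omega, hreg r hr]
  · simpa using harr c hc'
  · simp [hrank]
    by_cases hi : i = s1.reg 34
    · subst hi; simp [h]
    · simp only [show i ≤ s1.reg 34 ↔ i < s1.reg 34 by omega]
  · simp [show r ≠ 34 by omega, show r ≠ 10 by omega, hreg r hr]
  · funext x; simp [hc', harr c hc']
  · simp [hrank]
    by_cases hi : i = s1.reg 34
    · subst hi; simp [h]
    · simp only [show i ≤ s1.reg 34 ↔ i < s1.reg 34 by omega, hi, if_false]

/-- The effect of a routine that may append exponents to the pool and lists to the heap, and that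
uses the registers from `5` to `k - 1` and, if it uses many registers, also scratch arrays. -/
structure Grow (k : ℕ) (E E' : List ℕ) (s s' : St) : Prop where
  reg : ∀ r, r = 0 ∨ r = 3 ∨ r = 4 ∨ k ≤ r → s'.reg r = s.reg r
  out : s'.out = s.out
  hp : s.reg 2 ≤ s'.reg 2
  heap : ∀ x < s.reg 2, s'.arr 4 x = s.arr 4 x ∧ s'.arr 5 x = s.arr 5 x
  -- The arrays `6` and `7`, which hold the stack, are never touched; the arrays from `9` on are
  -- scratch space for routines that use registers beyond `54`.
  arr : ∀ c, 5 < c → c < 9 ∨ k ≤ 55 → s'.arr c = s.arr c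
  pre : E <+: E'
  pool : Pool s'.arr (s'.reg 2) E'
  size : s'.reg 1 = E'.length
  succ : ∀ i < E.length, s.arr 3 i ≠ 0 → s'.arr 3 i ≠ 0

theorem Grow.trans {k k' E E' E'' s s' s''} (h : Grow k E E' s s') (h' : Grow k' E' E'' s' s'')
    (hk : k ≤ k') : Grow k' E E'' s s'' :=
  ⟨fun r hr => by rw [h'.reg r hr, h.reg r (by omega)], h'.out.trans h.out, h.hp.trans h'.hp,
    fun x hx => by
      have h1 := h.heap x hx
      have h2 := h'.heap x (lt_of_lt_of_le hx h.hp)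
      exact ⟨h2.1.trans h1.1, h2.2.trans h1.2⟩,
    fun c hc hc' => (h'.arr c hc (by omega)).trans (h.arr c hc (by omega)), h.pre.trans h'.pre, h'.pool, h'.size,
    fun i hi hs => h'.succ i (hi.trans_le h.pre.length_le) (h.succ i hi hs)⟩

theorem Frame.grow {k s s' E} (h : Frame k s s') (hP : Pool s.arr (s.reg 2) E)
    (hm : s.reg 1 = E.length) : Grow k E E s s' :=
  ⟨fun r hr => h.reg r (by omega), h.out, h.hp, h.heap,
    fun c hc _ => h.arr c (by omega) (by omega), List.prefix_refl _, h.pool hP,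
    by rw [h.reg 1 (by omega), hm], fun i _ hs => by rwa [h.arr 3 (by omega) (by omega)]⟩

theorem Grow.consts {k s s' E E'} (h : Grow k E E' s s') (hc : Consts s) : Consts s' :=
  ⟨by rw [h.reg 0 (by omega), hc.zero], by rw [h.reg 3 (by omega), hc.one],
    by rw [h.reg 4 (by omega), hc.three]⟩

theorem Grow.heapList {k s s' E E' a b L} (h : Grow k E E' s s') (hL : HeapList s.arr E a b L)
    (hb : b ≤ s.reg 2) : HeapList s'.arr E' a b L :=
  hL.congr (fun x hx => h.heap x (by omega)) h.pre

theorem getElem?_of_prefix {E E' : List ℕ} (h : E <+: E') {i e : ℕ} (hi : E[i]? = some e) :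
    E'[i]? = some e := by
  obtain ⟨F, rfl⟩ := h
  rwa [List.getElem?_append_left (lt_length_of_getElem? hi)]

theorem Grow.hasSucc {k s s' E E' e} (h : Grow k E E' s s') (hs : HasSucc s.arr E e) :
    HasSucc s'.arr E' e := by
  obtain ⟨i, h1, h2⟩ := hs
  exact ⟨i, getElem?_of_prefix h.pre h1, h.succ i (lt_length_of_getElem? h1) h2⟩

/-- A new exponent is added to a pool. -/
theorem Pool.snoc {A A' : ℕ → ℕ → ℕ} {hp hp' E L} {e : ℕ} (hP : Pool A hp E) (hh : hp' = hp) (he : e ∉ E)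
    (hL : HeapList A E (A' 0 E.length) (A' 1 E.length) L) (hLn : IsNaf L) (hv : val L = (e : ℤ))
    (hle : A' 1 E.length ≤ hp) (h0 : ∀ i < E.length, A' 0 i = A 0 i ∧ A' 1 i = A 1 i ∧ A' 3 i = A 3 i)
    (h3 : A' 3 E.length = 0) (hH : A' 4 = A 4 ∧ A' 5 = A 5)
    (hr : ∀ i < E.length, A' 2 i = if E.countP (· < e) ≤ A 2 i then A 2 i + 1 else A 2 i)
    (hr' : A' 2 E.length = E.countP (· < e)) : Pool A' hp' (E ++ [e]) := by
  subst hh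
  refine ⟨getElem?_snoc.2 (Or.inl hP.zero), ?_, fun {i x} hi => ?_, fun {i x} hi => ?_,
    fun {i x} hi h => ?_⟩
  · rw [List.nodup_append]
    refine ⟨hP.nodup, by simp, fun a ha b hb => ?_⟩
    simp at hb; subst hb; rintro rfl; exact he ha
  · rcases getElem?_snoc.1 hi with hi | ⟨rfl, rfl⟩
    · have hx := List.mem_of_getElem? hi
      have hne : x ≠ e := by rintro rfl; exact he hx
      rw [hr i (lt_length_of_getElem? hi), List.countP_append, ← hP.rank hi]
      have h2 : A 2 i < E.countP (· < e) ↔ x < e := by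
        rw [hP.rank hi]; exact countP_lt_iff hx
      simp only [List.countP_cons, List.countP_nil, decide_eq_true_eq]
      split_ifs <;> omega
    · simp [hr', List.countP_append]
  · rcases getElem?_snoc.1 hi with hi | ⟨rfl, rfl⟩
    · have hl := lt_length_of_getElem? hi
      obtain ⟨M, h1, h2, h3, h4⟩ := hP.row hi
      rw [(h0 i hl).1, (h0 i hl).2.1, List.take_append_of_le_length hl.le]
      exact ⟨M, h1.congr (by simp [hH]) (List.prefix_refl _), h2, h3, h4⟩
    · rw [List.take_left]
      exact ⟨L, hL.congr (by simp [hH]) (List.prefix_refl _), hLn, hv, hle⟩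
  · rcases getElem?_snoc.1 hi with hi | ⟨rfl, rfl⟩
    · rw [(h0 i (lt_length_of_getElem? hi)).2.2] at h ⊢
      exact getElem?_snoc.2 (Or.inl (hP.succ hi h))
    · exact absurd h3 h

theorem wp_findP {inp s E L} {e : ℕ} (hP : Pool s.arr (s.reg 2) E) (hc : Consts s)
    (hm : s.reg 1 = E.length) (hL : HeapList s.arr E (s.reg 30) (s.reg 31) L) (hLn : IsNaf L)
    (he : val L = (e : ℤ)) (hle : s.reg 31 ≤ s.reg 2) :
    wp inp findP (fun s' => ∃ E', Grow 40 E E' s s' ∧ E'[s'.reg 33]? = some e ∧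
      (E' = E ∨ E' = E ++ [e]) ∧ (∀ i < E.length, s'.arr 3 i = s.arr 3 i) ∧
      s'.tm ≤ s.tm + 20 * (L.length + 4) * (E.length + 1)) s := by
  simp only [findP, wp_seq, wp_mov, wp_const]
  refine wp_mono (Q := fun s2 => FindInv s E e (20 * (L.length + 3) * E.length + 4)
    (20 * (L.length + 3)) s2 ∧ s2.reg 34 = E.length) ?_ ?_
  · refine wp_loop (FindInv s E e (20 * (L.length + 3) * E.length + 3) (20 * (L.length + 3)))
      (fun s => s.reg 1 - s.reg 34) ?_
      (fun s1 hI hlt => wp_findBody hP hc hm hL hLn he hI hlt) ?_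
    · refine ⟨?_, by simp, by simp, by simp, by simp, Or.inl (by simpa), by simp; omega⟩
      repeat' (first | exact Quiet.refl _ _ | refine Quiet.of_tick ?_ |
          refine Quiet.of_set ?_ (by norm_num) (by norm_num))
    · rintro s1 ⟨hq, h30, h31, hle, hcnt, hidx, ht⟩ hlt
      rw [hq.reg 1 (by norm_num), hm] at hlt
      exact ⟨⟨hq.of_tick, h30, h31, hle, hcnt, hidx, by simp; omega⟩, by simp; omega⟩
  · rintro s2 ⟨⟨hq, h30, h31, -, hcnt, hidx, ht⟩, hlt⟩
    rw [hlt, List.take_length] at hcnt hidx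
    simp only [hlt, Nat.sub_self, mul_zero, add_zero] at ht
    have hm2 : s2.reg 1 = E.length := by rw [hq.reg 1 (by norm_num), hm]
    have htm : 20 * (L.length + 3) * E.length + 20 * E.length + 20 * (L.length + 4) =
      20 * (L.length + 4) * (E.length + 1) := by ring
    simp only [wp_seq, wp_ifEq, wp_mov, wp_const]
    refine ⟨fun h33 => ?_, fun h33 => ?_⟩
    · have hnot : e ∉ E := by
        rcases hidx with h | h
        · exact h.2
        · have := lt_length_of_getElem? h; omega
      refine wp_mono (Q := fun s3 => RankInv s2 E.length (10 * E.length + 4) s3 ∧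
        s3.reg 34 = E.length) ?_ ?_
      · refine wp_loop (RankInv s2 E.length (10 * E.length + 3))
          (fun s => s.reg 1 - s.reg 34) ?_ (fun s1 hI hlt => wp_rankBody hm2 hI hlt) ?_
        · refine ⟨fun r hr => ?_, by simp, by simp, by simp, by simp, by simp; omega⟩
          simp [show r ≠ 34 by omega]
        · rintro s1 ⟨hreg, hout, harr, hle, hrank, ht⟩ hlt
          rw [hreg 1 (by norm_num), hm2] at hlt
          exact ⟨⟨hreg, hout, harr, hle, hrank, by simp; omega⟩, by simp; omega⟩
      · rintro s3 ⟨⟨hreg, hout, harr, -, hrank, ht3⟩, hlt3⟩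
        have k1 : s3.reg 1 = E.length := by rw [hreg 1 (by omega), hm2]
        have k2 : s3.reg 2 = s.reg 2 := by rw [hreg 2 (by omega), hq.reg 2 (by omega)]
        have k30 : s3.reg 30 = s.reg 30 := by rw [hreg 30 (by omega), h30]
        have k31 : s3.reg 31 = s.reg 31 := by rw [hreg 31 (by omega), h31]
        have k32 : s3.reg 32 = E.countP (· < e) := by rw [hreg 32 (by omega), hcnt]
        have k0 : s3.reg 0 = 0 := by
          rw [hreg 0 (by omega), hq.reg 0 (by omega), hc.zero]
        rw [hlt3, ← hreg 32 (by omega), k32, hq.arr] at hrank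
        rw [hq.arr] at harr
        simp only [wp_st, wp_inc]
        simp only [k1, k30, k31, k32, k0, St.put_reg]
        refine ⟨E ++ [e], ⟨fun r hr => ?_, by simpa [hout] using hq.out, by simp [k2], ?_, ?_,
          List.prefix_append _ _, ?_, by simp, ?_⟩, ?_, Or.inr rfl, ?_, ?_⟩
        · simp [show r ≠ 1 by omega]
          rw [hreg r (by omega), hq.reg r (by omega)]
        · intro x hx
          simp [harr 4, harr 5]
        · intro c hc' _
          funext x
          simp [show c ≠ 3 by omega, show c ≠ 1 by omega, show c ≠ 0 by omega,
            show c ≠ 2 by omega, harr c]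
        · refine Pool.snoc (L := L) hP (by simp [k2]) hnot ?_ hLn he ?_ (fun i hi => ?_) ?_ ?_ (fun i hi => ?_) ?_
          · simpa using hL
          · simpa [k2] using hle
          · simp [hi.ne, harr]
          · simp
          · constructor <;> funext x <;> simp [harr]
          · simp [hi.ne, hrank, hi]
          · simp
        · intro i hi h
          simpa [hi.ne, harr] using h
        · simp [hreg 33, h33, hm2]
        · intro i hi
          simp [hi.ne, harr]
        · simp
          simp [hlt3] at ht3
          omega
    · have hE : E[s2.reg 33]? = some e := by
        rcases hidx with h | h
        · rw [hm2] at h33; exact absurd h.1 h33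
        · exact h
      have hq5 : Quiet 40 s (s2.tick.set 14 (s2.tick.reg 0)) :=
        hq.of_tick.of_set (by norm_num) (by norm_num)
      refine ⟨E, hq5.frame.grow hP hm, by simpa, Or.inl rfl, by simp [hq.arr], ?_⟩
      simp; omega

/-! ### Successors of the exponents in the pool -/

/-- The number of exponents in a section of the pool whose successors are not known. -/
def unset (A : ℕ → ℕ → ℕ) (a b : ℕ) : ℕ := ((Finset.Ico a b).filter fun i => A 3 i = 0).card

theorem unset_self (A a) : unset A a a = 0 := by simp [unset]

theorem unset_step {A : ℕ → ℕ → ℕ} {a b : ℕ} (h : a < b) :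
    unset A a b = unset A (a + 1) b + if A 3 a = 0 then 1 else 0 := by
  unfold unset
  rw [← Finset.insert_Ico_add_one_left_eq_Ico h, Finset.filter_insert]
  split_ifs with h1
  · rw [Finset.card_insert_of_notMem (by simp)]
  · simp

theorem unset_le {A : ℕ → ℕ → ℕ} {a b : ℕ} : unset A a b ≤ b - a :=
  (Finset.card_filter_le _ _).trans (by simp)

theorem unset_add {A : ℕ → ℕ → ℕ} {a b c : ℕ} (h : a ≤ b) (h' : b ≤ c) :
    unset A a c = unset A a b + unset A b c := by
  unfold unset
  rw [← Finset.Ico_union_Ico_eq_Ico h h', Finset.filter_union, Finset.card_union_of_disjoint]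
  exact Finset.disjoint_filter_filter (Finset.Ico_disjoint_Ico_consecutive a b c)

theorem unset_congr {A A' : ℕ → ℕ → ℕ} {a b : ℕ} (h : ∀ i < b, A' 3 i = A 3 i) :
    unset A' a b = unset A a b := by
  unfold unset
  congr 1
  exact Finset.filter_congr fun i hi => by rw [h i (Finset.mem_Ico.1 hi).2]

theorem unset_eq_zero {A : ℕ → ℕ → ℕ} {a b : ℕ} (h : ∀ i < b, A 3 i ≠ 0) : unset A a b = 0 := by
  unfold unset
  rw [Finset.card_eq_zero, Finset.filter_eq_empty_iff]
  exact fun i hi => h i (Finset.mem_Ico.1 hi).2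

/-- Determine the successor of the exponent with the index in register `40`. -/
def succP : Prog :=
  .ld 35 3 40 ;;
  .ifEq 35 0
    (.ld 10 0 40 ;; .ld 11 1 40 ;; .const 12 0 ;; .const 13 1 ;; insP ;; .mov 30 14 ;; .mov 31 2 ;;
      findP ;; .st 3 40 33)
    (.mov 35 0)

theorem Pool.put_succ {s : St} {hp E} {e i r : ℕ} (h : Pool s.arr hp E) (hi : E[i]? = some e)
    (hr : E[r]? = some (e + 1)) : Pool (s.put 3 i r).arr hp E := by
  refine ⟨h.zero, h.nodup, fun hj => ?_, fun {j f} hj => ?_, fun {j f} hj h3 => ?_⟩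
  · simpa using h.rank hj
  · obtain ⟨L, h1, h2, h3, h4⟩ := h.row hj
    exact ⟨L, by simpa using h1.congr (by simp) (List.prefix_refl _), h2, h3, by simpa using h4⟩
  · by_cases hij : j = i
    · subst hij
      obtain rfl : e = f := by simpa using hi.symm.trans hj
      simpa using hr
    · simp [hij] at h3 ⊢
      exact h.succ hj h3

/-- The expansion of `e + 1` is obtained by inserting `2^0` into the row of `e`, and then looked up.
A successor that is already recorded costs only constant time, so the cost of a round is governed by
the number of unknown successors. -/
theorem wp_succP {inp s E i} {e w : ℕ} (hP : Pool s.arr (s.reg 2) E) (hc : Consts s)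
    (hm : s.reg 1 = E.length) (h40 : s.reg 40 = i) (he : E[i]? = some e) (hw : Wt e w)
    (hok : ∀ L, IsNaf L → val L = (e : ℤ) → CarryOk (HasSucc s.arr E) 0 L) :
    wp inp succP (fun s' => ∃ E', Grow 40 E E' s s' ∧ (E' = E ∨ E' = E ++ [e + 1]) ∧
      (∀ j < E.length, j ≠ i → s'.arr 3 j = s.arr 3 j) ∧ s'.arr 3 i ≠ 0 ∧
      (s.arr 3 i ≠ 0 → E' = E ∧ s'.tm ≤ s.tm + 3) ∧
      s'.tm ≤ s.tm + 20 * (w + 6) * (E.length + 2)) s := by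
  have hil := lt_length_of_getElem? he
  simp only [succP, wp_seq, wp_ld, wp_ifEq, wp_mov, wp_const]
  simp [hc.zero, h40]
  refine ⟨fun h3 => ?_, fun h3 => ?_⟩
  · obtain ⟨L, hL, hLn, hLv, hLle⟩ := hP.row he
    have hwL := hw.length_le hLn hLv
    refine wp_mono (wp_insP (E := E) (L := L) (b := false) (e := 0) ?_ ?_ ?_ ?_ ?_ ?_ ?_) ?_
    · simpa using hP
    · exact ⟨by simpa using hc.zero, by simpa using hc.one, by simpa using hc.three⟩
    · simpa using hL.congr (fun _ _ => ⟨rfl, rfl⟩) (List.take_prefix _ _)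
    · simpa using hLle
    · simpa using hP.zero
    · simp [code]
    · simpa using hok L hLn hLv
    · rintro s1 ⟨hf1, hL1, h14, ht1⟩
      have hf : Frame 40 s s1 := Frame.trans (k := 40) (by
        repeat' (first | exact Frame.refl _ _ | refine Frame.of_tick ?_ |
          refine Frame.of_set ?_ (by norm_num) (by norm_num)))
          (hf1.trans (Frame.refl 40 _) (by norm_num)) le_rfl
      have hf2 : Frame 40 s ((s1.set 30 (s1.reg 14)).set 31 (s1.reg 2)) := by
        repeat' (first | exact hf | refine Frame.of_tick ?_ |
          refine Frame.of_set ?_ (by norm_num) (by norm_num))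
      have hlen := length_ins 0 false L
      have hg := hf2.grow hP hm
      refine wp_mono (wp_findP (E := E) (L := ins 0 false L) (e := e + 1) hg.pool
        (hg.consts hc) hg.size (by simpa using hL1) (isNaf_ins hLn) (by simp [val_ins, hLv])
        (by simp)) ?_
      rintro s2 ⟨E', hg', h33, hE', hsu, ht2⟩
      have hg2 := hg.trans hg' le_rfl
      have h40' : s2.reg 40 = i := by rw [hg2.reg 40 (by omega), h40]
      have hA3 : ∀ j < E.length, s2.arr 3 j = s.arr 3 j := fun j hj => by
        rw [hsu j hj, hf2.arr 3 (by omega) (by omega)]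
      -- The index found belongs to `e + 1`, so it is not `0`, and the recorded entry counts as
      -- known.
      have hr0 : s2.reg 33 ≠ 0 := by
        intro h0
        rw [h0, hg2.pool.zero] at h33
        simp at h33
      rw [h40']
      refine ⟨E', ⟨fun r hr => ?_, ?_, ?_, fun x hx => ?_, fun c hc' _ => ?_, hg2.pre, ?_, ?_,
        fun j hj hj' => ?_⟩, hE', fun j hj hij => ?_, ?_, fun h => absurd h3 h, ?_⟩
      · simpa using hg2.reg r hr
      · simpa using hg2.out
      · simpa using hg2.hp
      · simpa using hg2.heap x hx
      · funext x; simp [show c ≠ 3 by omega, hg2.arr c hc' (by omega)]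
      · exact Pool.put_succ hg2.pool (getElem?_of_prefix hg2.pre he) h33
      · simpa using hg2.size
      · by_cases hij : j = i
        · simp [hij, hr0]
        · simp [hij, hA3 j hj, hj']
      · simp [hij, hA3 j hj]
      · simp [hr0]
      · simp at ht1 ht2 ⊢
        have h5 : 20 * ((ins 0 false L).length + 4) * (E.length + 1) ≤
          20 * (w + 5) * (E.length + 1) := Nat.mul_le_mul_right _ (by omega)
        have h6 : 20 * (w + 6) * (E.length + 2) =
          20 * (w + 5) * (E.length + 1) + 20 * (w + 6) + 20 * (E.length + 1) := by ring
        omega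
  · refine ⟨E, Frame.grow (k := 40) ?_ hP hm, Or.inl rfl, ?_⟩
    · repeat' (first | exact Frame.refl _ _ | refine Frame.of_tick ?_ |
          refine Frame.of_set ?_ (by norm_num) (by norm_num))
    · have : 20 * (w + 6) * (E.length + 2) ≥ 20 * 6 * 2 :=
        Nat.mul_le_mul (Nat.mul_le_mul_left _ (by omega)) (by omega)
      exact ⟨h3, fun _ => rfl, by omega⟩

/-- The state of the memory between operations: the pool `E` is stored, its exponents have
expansions of length at most `w`, and the successors of the numbers below `K` are known. -/
structure Good (s : St) (E : List ℕ) (w K : ℕ) : Prop where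
  pool : Pool s.arr (s.reg 2) E
  consts : Consts s
  size : s.reg 1 = E.length
  wt : ∀ e ∈ E, Wt (e : ℤ) w
  low : ∀ x < K, HasSucc s.arr E x

/-- Determine the successors of all exponents that are in the pool. -/
def closeP : Prog := .mov 42 1 ;; .const 40 0 ;; .loop 40 42 (succP ;; .inc 40 1)

/-- Only a row with unknown successor can enlarge the pool, and then by one exponent; hence the size
plus the number of unknown successors still ahead never increases. That number may be taken in the
initial state `s`, since rows ahead are unaltered. -/
structure CloseInv (s : St) (E : List ℕ) (C n : ℕ) (s1 : St) : Prop where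
  le : s1.reg 40 ≤ E.length
  lim : s1.reg 42 = E.length
  done : ∀ j < s1.reg 40, s1.arr 3 j ≠ 0
  rest : ∀ j < E.length, s1.reg 40 ≤ j → s1.arr 3 j = s.arr 3 j
  time : s1.tm + C * unset s.arr (s1.reg 40) E.length ≤ s.tm + 12 * s1.reg 40 + n
  grow : ∃ E1, Grow 50 E E1 s s1 ∧ (∀ e ∈ E1, e ∈ E ∨ ∃ f ∈ E, e = f + 1) ∧
    E1.length + unset s.arr (s1.reg 40) E.length ≤ E.length + unset s.arr 0 E.length

theorem Grow.weaken {k k' E E' s s'} (h : Grow k E E' s s') (hk : k ≤ k') : Grow k' E E' s s' :=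
  ⟨fun r hr => h.reg r (by omega), h.out, h.hp, h.heap,
    fun c hc hc' => h.arr c hc (by omega), h.pre, h.pool, h.size, h.succ⟩

theorem Grow.of_set {k E E' s s'} {d v : ℕ} (h : Grow k E E' s s') (hd : 5 ≤ d) (hd' : d < k) :
    Grow k E E' s (s'.set d v) :=
  ⟨fun r hr => by simp [show r ≠ d by omega, h.reg r hr], h.out,
    by simp [show 2 ≠ d by omega, h.hp], h.heap, h.arr, h.pre,
    by simpa [show 2 ≠ d by omega] using h.pool, by simp [show 1 ≠ d by omega, h.size], h.succ⟩

theorem Grow.of_tick {k E E' s s'} (h : Grow k E E' s s') : Grow k E E' s s'.tick :=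
  ⟨h.reg, h.out, h.hp, h.heap, h.arr, h.pre, h.pool, h.size, h.succ⟩

theorem Grow.refl {s E} (k) (hP : Pool s.arr (s.reg 2) E) (hm : s.reg 1 = E.length) :
    Grow k E E s s := (Frame.refl k s).grow hP hm

theorem wp_closeBody {inp s E w K n s1} (hG : Good s E w K) (hK : 2 * w < K)
    (hI : CloseInv s E (20 * (w + 6) * (E.length + unset s.arr 0 E.length + 2)) n s1)
    (hlt : s1.reg 40 < s1.reg 42) :
    wp inp (succP ;; .inc 40 1) (fun s2 =>
      CloseInv s E (20 * (w + 6) * (E.length + unset s.arr 0 E.length + 2)) n s2 ∧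
      s2.reg 42 - s2.reg 40 < s1.reg 42 - s1.reg 40) s1.tick := by
  obtain ⟨hle, hlim, hdone, hrest, ht, E1, hg, hnew, hsz⟩ := hI
  have hi : s1.reg 40 < E.length := by omega
  obtain ⟨e, he⟩ : ∃ e, E[s1.reg 40]? = some e := ⟨_, List.getElem?_eq_getElem hi⟩
  have he1 := getElem?_of_prefix hg.pre he
  have heE := List.mem_of_getElem? he
  have hlen := hg.pre.length_le
  simp only [wp_seq, wp_inc]
  refine wp_mono (wp_succP (E := E1) (i := s1.reg 40) (e := e) (w := w) hg.of_tick.pool (hg.of_tick.consts hG.consts)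
    hg.of_tick.size rfl he1 (hG.wt e heE) fun L hL hv => ?_) ?_
  -- The carries in the computation of `e + 1` do not pass `2 * w`, which is below `K`.
  · refine carryOk_of_low hL (fun x _ => Nat.zero_le _) fun k hk _ => ?_
    have := (hG.wt e heE).length_le hL hv
    exact hg.hasSucc (hG.low k (by omega))
  · rintro s2 ⟨E2, hg2, hE2, hsu, hsi, hskip, ht2⟩
    have h40 : s2.reg 40 = s1.reg 40 := by rw [hg2.reg 40 (by omega)]; rfl
    have h42 : s2.reg 42 = s1.reg 42 := by rw [hg2.reg 42 (by omega)]; rfl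
    have hstep := unset_step (A := s.arr) hi
    have hsr : s1.arr 3 (s1.reg 40) = s.arr 3 (s1.reg 40) := hrest _ hi le_rfl
    have hsz2 : E2.length ≤ E1.length + if s.arr 3 (s1.reg 40) = 0 then 1 else 0 := by
      split_ifs with h0
      · rcases hE2 with rfl | rfl <;> simp
      · rw [(hskip (by simpa [hsr] using h0)).1]; simp
    refine ⟨⟨?_, ?_, fun j hj => ?_, fun j hj hj' => ?_, ?_, E2, ?_, fun x hx => ?_, ?_⟩, ?_⟩
    · simp [h40]; omega
    · simp [h42, hlim]
    · simp [h40] at hj ⊢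
      rcases Nat.lt_or_ge j (s1.reg 40) with h | h
      · rw [hsu j (by omega) (by omega)]; exact hdone j h
      · rwa [show j = s1.reg 40 by omega]
    · simp [h40] at hj' ⊢
      rw [hsu j (by omega) (by omega)]
      exact hrest j hj (by omega)
    · simp [h40]
      rw [hstep] at ht
      split_ifs at ht with h0
      · have h3 : 20 * (w + 6) * (E1.length + 2) ≤
            20 * (w + 6) * (E.length + unset s.arr 0 E.length + 2) :=
          Nat.mul_le_mul_left _ (by omega)
        simp at ht2
        rw [mul_add] at ht
        omega
      · have := (hskip (by simpa [hsr] using h0)).2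
        simp at this ht
        omega
    · exact (hg.of_tick.trans (hg2.weaken (k' := 50) (by norm_num)) le_rfl).of_set (by norm_num)
        (by norm_num)
    · rcases hE2 with rfl | rfl
      · exact hnew x hx
      · rcases List.mem_append.1 hx with hx | hx
        · exact hnew x hx
        · exact Or.inr ⟨e, heE, by simpa using hx⟩
    · simp [h40]
      omega
    · simp [h40, h42]
      omega

/-- Afterwards unknown successors occur only among the new exponents, and there are at most as many
of these as there were unknown successors before. So this number does not grow from round to round,
while the pool grows by at most this number and expansions by at most one entry. -/
theorem wp_closeP {inp s E w K} (hG : Good s E w K) (hK : 2 * w < K) :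
    wp inp closeP (fun s' => ∃ E', Grow 50 E E' s s' ∧ Good s' E' (w + 1) K ∧
      (∀ e ∈ E, HasSucc s'.arr E' e) ∧
      E'.length ≤ E.length + unset s.arr 0 E.length ∧
      unset s'.arr 0 E'.length ≤ unset s.arr 0 E.length ∧
      s'.tm ≤ s.tm + 12 * E.length + 20 * (w + 6) *
        (E.length + unset s.arr 0 E.length + 2) * unset s.arr 0 E.length + 4) s := by
  simp only [closeP, wp_seq, wp_mov, wp_const]
  refine wp_loop (CloseInv s E (20 * (w + 6) * (E.length + unset s.arr 0 E.length + 2))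
    (20 * (w + 6) * (E.length + unset s.arr 0 E.length + 2) * unset s.arr 0 E.length + 3))
    (fun s => s.reg 42 - s.reg 40) ?_ (fun s1 hI hlt => wp_closeBody hG hK hI hlt) ?_
  · refine ⟨by simp, by simp [hG.size], by simp, by simp, by simp; omega, E, ?_, fun e he => Or.inl he,
      by simp⟩
    repeat' (first | exact Grow.refl _ hG.pool hG.size | refine Grow.of_tick ?_ |
          refine Grow.of_set ?_ (by norm_num) (by norm_num))
  · rintro s1 ⟨hle, hlim, hdone, hrest, ht, E1, hg, hnew, hsz⟩ hlt
    have h40 : s1.reg 40 = E.length := by omega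
    rw [h40] at hdone ht hsz
    rw [unset_self] at ht hsz
    refine ⟨E1, hg.of_tick, ⟨hg.of_tick.pool, hg.of_tick.consts hG.consts, hg.of_tick.size,
      fun e he => ?_, fun x hx => hg.of_tick.hasSucc (hG.low x hx)⟩, fun e he => ?_, by omega,
      ?_, by simp; omega⟩
    · rcases hnew e he with h | ⟨f, h, rfl⟩
      · exact (hG.wt e h).mono (by omega)
      · push_cast; exact (hG.wt f h).add_one
    · obtain ⟨i, hi⟩ := List.mem_iff_getElem?.1 he
      exact ⟨i, getElem?_of_prefix hg.pre hi, hdone i (lt_length_of_getElem? hi)⟩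
    · simp only [St.tick_arr]
      rw [unset_add (Nat.zero_le _) hg.pre.length_le, unset_eq_zero hdone]
      have := unset_le (A := s1.arr) (a := E.length) (b := E1.length)
      omega

/-- Determine the successors of all exponents in the pool, and their successors, and the
successors of these. -/
def closeThreeP : Prog := closeP ;; closeP ;; closeP

theorem HasSucc.succ_mem {A hp E e} (hP : Pool A hp E) (h : HasSucc A E e) : e + 1 ∈ E := by
  obtain ⟨i, h1, h2⟩ := h
  exact List.mem_of_getElem? (hP.succ h1 h2)

/-- Three rounds are what addition demands: an exponent of a partial sum is at most one above an
exponent `e` of a summand, and `carryOk_of_succ` requires the successors of it and of the next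
number, that is, of `e`, `e + 1` and `e + 2`. -/
theorem wp_closeThreeP {inp s E w K M U} (hG : Good s E w K) (hK : 2 * w + 4 < K)
    (hM : E.length ≤ M) (hU : unset s.arr 0 E.length ≤ U) :
    wp inp closeThreeP (fun s' => ∃ E', Grow 50 E E' s s' ∧ Good s' E' (w + 3) K ∧
      (∀ e ∈ E, HasSucc s'.arr E' e ∧ HasSucc s'.arr E' (e + 1) ∧ HasSucc s'.arr E' (e + 2)) ∧
      E'.length ≤ M + 3 * U ∧ unset s'.arr 0 E'.length ≤ U ∧
      s'.tm ≤ s.tm + 3 * (20 * (w + 8) * (M + 3 * U + 2) * (U + 1))) s := by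
  have hT : ∀ (w' m u : ℕ), w' ≤ w + 2 → m ≤ M + 2 * U → u ≤ U → 12 * m + 20 * (w' + 6) *
      (m + u + 2) * u + 4 ≤ 20 * (w + 8) * (M + 3 * U + 2) * (U + 1) := by
    intro w' m u h1 h2 h3
    have h4 : 20 * (w' + 6) * (m + u + 2) * u ≤ 20 * (w + 8) * (M + 3 * U + 2) * U :=
      Nat.mul_le_mul (Nat.mul_le_mul (by omega) (by omega)) h3
    have h5 : 20 * 8 * (M + 3 * U + 2) ≤ 20 * (w + 8) * (M + 3 * U + 2) :=
      Nat.mul_le_mul_right _ (by omega)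
    rw [mul_add _ U 1]
    omega
  simp only [closeThreeP, wp_seq]
  refine wp_mono (wp_closeP hG (by omega)) ?_
  rintro s1 ⟨E1, g1, G1, hs1, hl1, hu1, ht1⟩
  refine wp_mono (wp_closeP G1 (by omega)) ?_
  rintro s2 ⟨E2, g2, G2, hs2, hl2, hu2, ht2⟩
  refine wp_mono (wp_closeP G2 (by omega)) ?_
  rintro s3 ⟨E3, g3, G3, hs3, hl3, hu3, ht3⟩
  refine ⟨E3, (g1.trans g2 le_rfl).trans g3 le_rfl, G3, fun e he => ?_, by omega, by omega, ?_⟩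
  · have h1 := hs1 e he
    have h2 := hs2 _ (h1.succ_mem G1.pool)
    have h3 := hs3 _ (h2.succ_mem G2.pool)
    exact ⟨g3.hasSucc (g2.hasSucc h1), g3.hasSucc h2, h3⟩
  · have k1 := hT w E.length (unset s.arr 0 E.length) (by omega) (by omega) hU
    have k2 := hT (w + 1) E1.length (unset s1.arr 0 E1.length) (by omega) (by omega) (hu1.trans hU)
    have k3 := hT (w + 1 + 1) E2.length (unset s2.arr 0 E2.length) (by omega) (by omega) (hu2.trans (hu1.trans hU))
    have : E.length ≤ M + 2 * U := by omega
    omega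

/-! ### Addition and subtraction of expansions -/

/-- Add the list from `52` to `53` to the list from `50` to `51`, or subtract it, if register `54`
is not zero. -/
def addP : Prog :=
  .loop 52 53 (.ld 12 4 52 ;; .ld 13 5 52 ;; .ifEq 54 0 (.mov 14 0) (.sub 13 4 13) ;;
    .mov 10 50 ;; .mov 11 51 ;; insP ;; .mov 50 14 ;; .mov 51 2 ;; .inc 52 1)

/-- The entries `M1` have been inserted and `M2` remains. Partial sums are never longer than `L` and
`M` together, which bounds the price of every insertion. -/
structure AddInv (s : St) (E : List ℕ) (flip : Bool) (L M : List (ℕ × Bool)) (n : ℕ) (s1 : St) :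
    Prop where
  frame : Frame 54 s s1
  finish : s1.reg 53 = s.reg 53
  le : s1.reg 51 ≤ s1.reg 2
  lists : ∃ M1 M2, M = M1 ++ M2 ∧ HeapList s1.arr E (s1.reg 52) (s1.reg 53) M2 ∧
    HeapList s1.arr E (s1.reg 50) (s1.reg 51) (addList flip L M1) ∧
    s1.tm + 20 * (L.length + M.length + 2) * M2.length ≤ s.tm + n

theorem wp_addP {inp s E flip L M} (hP : Pool s.arr (s.reg 2) E) (hc : Consts s)
    (hL : HeapList s.arr E (s.reg 50) (s.reg 51) L) (hM : HeapList s.arr E (s.reg 52) (s.reg 53) M)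
    (hl : s.reg 51 ≤ s.reg 2) (hl' : s.reg 53 ≤ s.reg 2) (hLn : IsNaf L) (hMn : IsNaf M)
    (hflip : s.reg 54 = if flip then 1 else 0)
    (hs : ∀ x, x ∈ L ∨ x ∈ M → HasSucc s.arr E x.1 ∧ HasSucc s.arr E (x.1 + 1) ∧
      HasSucc s.arr E (x.1 + 2)) :
    wp inp addP (fun s' => Frame 54 s s' ∧
      HeapList s'.arr E (s'.reg 50) (s'.reg 51) (addList flip L M) ∧ s'.reg 51 ≤ s'.reg 2 ∧
      s'.tm ≤ s.tm + 20 * (L.length + M.length + 2) * (M.length + 1)) s := by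
  refine wp_loop (AddInv s E flip L M (20 * (L.length + M.length + 2) * M.length))
    (fun s => s.reg 53 - s.reg 52) ?_ ?_ ?_
  · exact ⟨Frame.refl _ _, rfl, hl, [], M, rfl, hM, hL, le_rfl⟩
  · rintro s1 ⟨hf, hfin, hle, M1, M2, rfl, hM2, hL1, ht⟩ hlt
    obtain ⟨e, b, M3, rfl, he, hb, hM3⟩ := hM2.cons_inv hlt
    have hP1 := hf.pool hP
    have hc1 := hf.consts hc
    have h54 : s1.reg 54 = if flip then 1 else 0 := by rw [hf.reg 54 (by omega), hflip]
    have hhp := hf.hp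
    simp only [wp_seq, wp_ld, wp_ifEq, wp_mov, wp_sub]
    have key : ∀ s2, Quiet 50 s1 s2 → s2.reg 10 = s1.reg 50 → s2.reg 11 = s1.reg 51 →
        s2.reg 12 = s1.arr 4 (s1.reg 52) → s2.reg 13 = code (xor flip b) → s2.tm ≤ s1.tm + 7 →
        wp inp insP (fun s' => wp inp (Prog.inc 52 1)
          (fun s' => AddInv s E flip L (M1 ++ (e, b) :: M3)
            (20 * (L.length + (M1 ++ (e, b) :: M3).length + 2) * (M1 ++ (e, b) :: M3).length) s' ∧
            s'.reg 53 - s'.reg 52 < s1.reg 53 - s1.reg 52)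
          ((s'.set 50 (s'.reg 14)).set 51 ((s'.set 50 (s'.reg 14)).reg 2))) s2 := by
      intro s2 hq h10 h11 h12 h13 ht2
      have hM1n : IsNaf M1 := isNaf_prefix hMn
      have hlen := length_addList flip L M1
      refine wp_mono (wp_insP (E := E) (L := addList flip L M1) (b := xor flip b) (e := e)
        (hq.frame.pool hP1) (hq.consts hc1) (by rw [h10, h11, hq.arr]; exact hL1)
        (by rw [h11, hq.reg 2 (by omega)]; exact hle) (by rw [h12]; exact he) h13 ?_) ?_
      · have hs' : ∀ k, HasSucc s.arr E k → HasSucc s2.arr E k := fun k hk => by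
          rw [hq.arr]; exact hf.hasSucc hk
        have h1 := hs (e, b) (by simp)
        refine carryOk_of_succ (isNaf_addList hLn) (hs' _ h1.1) (Or.inl (hs' _ h1.2.1))
          fun x hx => ?_
        -- An exponent of the partial sum is `y.1` or `y.1 + 1` for an entry `y` of a summand, so
        -- that `hs` knows its successor and the one after it.
        obtain ⟨y, hy, hxy⟩ := mem_addList hLn hM1n hx
        have h2 := hs y (by simp; tauto)
        rcases hxy with h | h
        · rw [h]; exact ⟨hs' _ h2.1, hs' _ h2.2.1⟩
        · rw [h]; exact ⟨hs' _ h2.2.1, hs' _ h2.2.2⟩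
      · rintro s3 ⟨hf3, hL3, h14, ht3⟩
        have g52 : s3.reg 52 = s1.reg 52 := by
          rw [hf3.reg 52 (by omega), hq.reg 52 (by omega)]
        have g53 : s3.reg 53 = s1.reg 53 := by
          rw [hf3.reg 53 (by omega), hq.reg 53 (by omega)]
        have hf4 : Frame 54 s1 s3 := (hq.frame.trans (Frame.refl 54 _) (by norm_num)).trans
          (hf3.trans (Frame.refl 54 _) (by norm_num)) le_rfl
        simp only [wp_inc]
        refine ⟨⟨?_, by simp [g53, hfin], by simp, M1 ++ [(e, b)], M3, by simp, ?_, ?_, ?_⟩, ?_⟩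
        · repeat' (first | exact hf.trans hf4 le_rfl | refine Frame.of_tick ?_ |
            refine Frame.of_set ?_ (by norm_num) (by norm_num))
        · simpa [g52, g53] using hf4.heapList hM3 (by omega)
        · simpa [addList_append_singleton] using hL3
        · simp only [List.length_append, List.length_cons, St.set_tm] at ht ⊢
          have h5 : 20 * (L.length + (M1.length + (M3.length + 1)) + 2) * (M3.length + 1) =
            20 * (L.length + (M1.length + (M3.length + 1)) + 2) * M3.length +
            20 * (L.length + (M1.length + (M3.length + 1)) + 2) := by ring
          rw [h5] at ht
          omega
        · simp [g52, g53]; omega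
    have hz := hc1.zero
    have h3 := hc1.three
    refine ⟨fun h => ?_, fun h => ?_⟩
    · have hfl : flip = false := by
        simp [hz, h54] at h; exact h
      refine key _ ?_ (by simp) (by simp) (by simp) (by simp [hb, hfl]) (by simp)
      repeat' (first | exact Quiet.refl _ _ | refine Quiet.of_tick ?_ |
            refine Quiet.of_set ?_ (by norm_num) (by norm_num))
    · have hfl : flip = true := by
        simp [hz, h54] at h; exact h
      refine key _ ?_ (by simp) (by simp) (by simp) (by simp [hb, hfl, h3, three_sub_code]) (by simp)
      repeat' (first | exact Quiet.refl _ _ | refine Quiet.of_tick ?_ |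
            refine Quiet.of_set ?_ (by norm_num) (by norm_num))
  · rintro s1 ⟨hf, hfin, hle, M1, M2, rfl, hM2, hL1, ht⟩ hlt
    obtain rfl := hM2.nil_inv hlt
    refine ⟨hf.of_tick, by simpa using hL1, hle, ?_⟩
    simp only [List.append_nil, List.length_nil, mul_zero, add_zero] at ht ⊢
    rw [mul_add _ _ 1]
    simp; omega

/-! ### Multiplication by powers of two -/

/-- The expansion of `2 ^ y` times a number. -/
def shiftList (y : ℤ) (L : List (ℕ × Bool)) : List (ℕ × Bool) :=
  L.map fun x => ((x.1 + y).toNat, x.2)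

theorem isNaf_shiftList {y : ℤ} {L} (h : IsNaf L) (hy : ∀ x ∈ L, 0 ≤ (x.1 : ℤ) + y) :
    IsNaf (shiftList y L) := by
  unfold IsNaf shiftList
  rw [List.pairwise_map]
  refine (List.Pairwise.and_mem.1 h).imp fun {a b} hab => ?_
  have h1 := hy a hab.1
  have h2 := hy b hab.2.1
  have h3 := hab.2.2
  simp only
  omega

theorem val_shiftList_natCast (k : ℕ) (L) : val (shiftList k L) = val L * 2 ^ k := by
  induction L with
  | nil => simp [shiftList]
  | cons x L ih =>
    simp only [shiftList, List.map_cons, val_cons] at ih ⊢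
    rw [ih, show ((x.1 : ℤ) + k).toNat = x.1 + k by omega, pow_add]
    ring

theorem val_shiftList_neg (k : ℕ) {L} (h : ∀ x ∈ L, k ≤ x.1) :
    val (shiftList (-k) L) * 2 ^ k = val L := by
  induction L with
  | nil => simp [shiftList]
  | cons x L ih =>
    simp only [shiftList, List.map_cons, val_cons] at ih ⊢
    have hx := h x (by simp)
    rw [add_mul, ih fun y hy => h y (by simp [hy]), mul_assoc, ← pow_add,
      show ((x.1 : ℤ) + -k).toNat + k = x.1 by omega]

theorem two_pow_dvd_val {k : ℕ} {L} (h : ∀ x ∈ L, k ≤ x.1) : (2 : ℤ) ^ k ∣ val L :=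
  ⟨_, ((val_shiftList_neg k h).symm.trans (mul_comm _ _))⟩

/-- All entries but the lowest are divisible by a higher power of two than the lowest one, so the
lowest exponent is the exact valuation. Thus a shift is undefined as soon as one shifted exponent is
negative. -/
theorem two_pow_dvd_val_iff {k : ℕ} {L} (hL : IsNaf L) :
    (2 : ℤ) ^ k ∣ val L ↔ ∀ x ∈ L, k ≤ x.1 := by
  refine ⟨fun h => ?_, two_pow_dvd_val⟩
  cases L with
  | nil => simp
  | cons x L =>
    rw [isNaf_cons] at hL
    have hx : k ≤ x.1 := by
      by_contra hc
      have h1 : (2 : ℤ) ^ (x.1 + 1) ∣ val L := two_pow_dvd_val fun y hy => by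
        have := hL.1 y hy; omega
      have h2 : (2 : ℤ) ^ (x.1 + 1) ∣ val (x :: L) := (pow_dvd_pow 2 (by omega)).trans h
      rw [val_cons, dvd_add_left h1, pow_succ, mul_comm] at h2
      have h3 : (2 : ℤ) ∣ sgn x.2 := by
        exact (mul_dvd_mul_iff_right (by positivity : (2 : ℤ) ^ x.1 ≠ 0)).1 h2
      cases hb : x.2 <;> simp [hb] at h3
    intro y hy
    rcases List.mem_cons.1 hy with rfl | hy
    · exact hx
    · have := hL.1 y hy; omega

theorem shift_val {L} (y : ℤ) (h : ∀ x ∈ L, 0 ≤ (x.1 : ℤ) + y) :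
    shift (val L) y = some (val (shiftList y L)) := by
  unfold shift
  split_ifs with h0 h1
  · obtain ⟨k, rfl⟩ := Int.eq_ofNat_of_zero_le h0
    simp [val_shiftList_natCast]
  · obtain ⟨k, hk⟩ := Int.eq_ofNat_of_zero_le (show 0 ≤ -y by omega)
    obtain rfl : y = -(k : ℤ) := by omega
    rw [← val_shiftList_neg k (L := L) fun x hx => by have := h x hx; omega]
    simp
  · obtain ⟨k, hk⟩ := Int.eq_ofNat_of_zero_le (show 0 ≤ -y by omega)
    obtain rfl : y = -(k : ℤ) := by omega
    refine absurd (two_pow_dvd_val fun x hx => ?_) h1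
    have := h x hx
    simp; omega

theorem shift_val_eq_none {L} (hL : IsNaf L) {y : ℤ} {x : ℕ × Bool} (hx : x ∈ L)
    (h : (x.1 : ℤ) + y < 0) : shift (val L) y = none := by
  unfold shift
  rw [if_neg (by omega), if_neg fun h1 => ?_]
  have := (two_pow_dvd_val_iff hL).1 h1 x hx
  omega


/-- Test if the list from `50` to `51` represents a negative number. -/
def negP : Prog := .ifLt 50 51 (.sub 40 51 3 ;; .ld 41 5 40) (.const 41 0) ;; .sub 42 41 3

/-- The leading sign decides. The code of `-1` is `2`, so subtracting one gives `1`; the code of `1`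
and the empty list both give `0`. -/
theorem wp_negP {inp s E L} (hc : Consts s) (hL : HeapList s.arr E (s.reg 50) (s.reg 51) L)
    (hLn : IsNaf L) : wp inp negP (fun s' => Quiet 50 s s' ∧ (s'.reg 42 = 1 ↔ val L < 0) ∧
      s'.tm ≤ s.tm + 4) s := by
  have h1 := hc.one
  simp only [negP, wp_seq, wp_ifLt, wp_sub, wp_ld, wp_const]
  refine ⟨fun h => ⟨?_, ?_, by simp⟩, fun h => ⟨?_, ?_, by simp⟩⟩
  · repeat' (first | exact Quiet.refl _ _ | refine Quiet.of_tick ?_ |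
          refine Quiet.of_set ?_ (by norm_num) (by norm_num))
  · obtain ⟨e, b, M, rfl, -, h5, -⟩ := hL.snoc_inv h
    simp [h1, h5]
    cases b
    · simpa [code] using (top_pos hLn).le
    · simpa [code] using top_neg hLn
  · repeat' (first | exact Quiet.refl _ _ | refine Quiet.of_tick ?_ |
          refine Quiet.of_set ?_ (by norm_num) (by norm_num))
  · obtain rfl := hL.nil_inv h
    simp

/-- Multiply the list from `60` to `61` by the power of two whose exponent is plus (or minus, if
register `54` is `1`) the list from `62` to `63`. The result is put at the positions from `64` to
`65`; register `66` is `1` if the result is undefined. -/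
def shiftBody : Prog :=
  .ld 40 4 67 ;; .ld 50 0 40 ;; .ld 51 1 40 ;; .mov 52 62 ;; .mov 53 63 ;; addP ;;
  negP ;;
  .ifEq 42 3 (.const 66 1 ;; .mov 67 61)
    (.mov 30 50 ;; .mov 31 51 ;; findP ;; .st 9 67 33 ;; .inc 67 1)

/-- A second pass is needed because the first one puts auxiliary lists on the heap, whereas the
result must be contiguous. The new indices are therefore kept in array `9` in the meantime. -/
def shiftCopyBody : Prog :=
  .ld 68 9 67 ;; .ld 69 5 67 ;; pushP 68 69 ;; .inc 67 1

def shiftP : Prog :=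
  .mov 67 60 ;; .const 66 0 ;; .loop 67 61 shiftBody ;;
  .mov 64 2 ;; .mov 67 60 ;; .loop 67 61 shiftCopyBody ;; .mov 65 2

/-- `E0` is the pool before its successors were completed. Only for its members are three
consecutive successors known; both lists and the rows of the exponents of `X` stay inside it. -/
structure ShiftHyp (s : St) (E0 E : List ℕ) (y : ℤ) (X Y : List (ℕ × Bool)) (flip : Bool)
    (W : ℕ) : Prop where
  pool : Pool s.arr (s.reg 2) E
  consts : Consts s
  size : s.reg 1 = E.length
  pre : E0 <+: E
  succ : ∀ e ∈ E0, HasSucc s.arr E e ∧ HasSucc s.arr E (e + 1) ∧ HasSucc s.arr E (e + 2)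
  listX : HeapList s.arr E0 (s.reg 60) (s.reg 61) X
  listY : HeapList s.arr E0 (s.reg 62) (s.reg 63) Y
  leX : s.reg 61 ≤ s.reg 2
  leY : s.reg 63 ≤ s.reg 2
  nafX : IsNaf X
  nafY : IsNaf Y
  flag : s.reg 54 = if flip then 1 else 0
  exp : sgn flip * val Y = y
  wt : ∀ x ∈ X, Wt (x.1 : ℤ) W

/-- A negative exponent sets the flag `66` and sends the position to the end. Otherwise the entries
before register `67` are translated, their indices lying in array `9` at the addresses of the old
entries. No recorded successor changes, so unknown successors increase only through new exponents.
-/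
structure ShiftInv (s : St) (E : List ℕ) (y : ℤ) (X : List (ℕ × Bool)) (n T : ℕ) (s1 : St) :
    Prop where
  le : s1.reg 67 ≤ s.reg 61
  ge : s.reg 60 ≤ s1.reg 67
  main : (s1.reg 66 = 1 ∧ s1.reg 67 = s.reg 61 ∧ ∃ x ∈ X, (x.1 : ℤ) + y < 0) ∨
    (s1.reg 66 = 0 ∧ ∀ q < s1.reg 67 - s.reg 60, ∀ x, X[q]? = some x → 0 ≤ (x.1 : ℤ) + y)
  grow : ∃ E1, Grow 70 E E1 s s1 ∧ E1.length ≤ E.length + (s1.reg 67 - s.reg 60) ∧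
    (∀ e ∈ E1, e ∈ E ∨ ∃ x ∈ X, (e : ℤ) = x.1 + y) ∧
    (s1.reg 66 = 0 → ∀ q < s1.reg 67 - s.reg 60, ∀ x, X[q]? = some x →
      E1[s1.arr 9 (s.reg 60 + q)]? = some ((x.1 : ℤ) + y).toNat)
  reg : ∀ r, (60 ≤ r ∧ r ≤ 63) ∨ r = 54 → s1.reg r = s.reg r
  succ : ∀ i < E.length, s1.arr 3 i = s.arr 3 i
  time : s1.tm + T * (s.reg 61 - s1.reg 67) ≤ s.tm + n

theorem mem_of_heapList {A E a b L} {x : ℕ × Bool} (h : HeapList A E a b L) (hx : x ∈ L) :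
    x.1 ∈ E := by
  obtain ⟨q, hq, rfl⟩ := List.mem_iff_getElem.1 hx
  exact List.mem_of_getElem? (h.get q hq).1

theorem wp_shiftBody {inp s E0 E y X Y flip W n s1} (H : ShiftHyp s E0 E y X Y flip W)
    (hI : ShiftInv s E y X n (20 * (W + Y.length + 6) * (E.length + X.length + Y.length + 3)) s1)
    (hlt : s1.reg 67 < s1.reg 61) :
    wp inp shiftBody (fun s2 =>
      ShiftInv s E y X n (20 * (W + Y.length + 6) * (E.length + X.length + Y.length + 3)) s2 ∧
      s2.reg 61 - s2.reg 67 < s1.reg 61 - s1.reg 67) s1.tick := by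
  obtain ⟨hle, hge, hmain, ⟨E1, hg, hlen, hnew, hidx⟩, hreg, hsu, ht⟩ := hI
  have h61 := hreg 61 (by norm_num)
  rw [h61] at hlt
  have hbad : s1.reg 66 = 0 ∧ ∀ q < s1.reg 67 - s.reg 60, ∀ x, X[q]? = some x →
      0 ≤ (x.1 : ℤ) + y := hmain.resolve_left fun h => by omega
  have hXl := H.listX.len
  have hq : s1.reg 67 - s.reg 60 < X.length := by omega
  obtain ⟨x, hx⟩ : ∃ x, X[s1.reg 67 - s.reg 60]? = some x := ⟨_, List.getElem?_eq_getElem hq⟩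
  have hxX := List.mem_of_getElem? hx
  have hc1 := hg.consts H.consts
  have hpre := H.pre.trans hg.pre
  have hi : E0[s1.arr 4 (s1.reg 67)]? = some x.1 := by
    have := (H.listX.get _ hq).1
    rw [(hg.heap (s1.reg 67) (by have := H.leX; omega)).1,
      show s1.reg 67 = s.reg 60 + (s1.reg 67 - s.reg 60) by omega, this]
    rw [List.getElem?_eq_getElem hq] at hx
    simp at hx ⊢
    rw [hx]
  obtain ⟨R, hR, hRn, hRv, hRle⟩ := hg.pool.row (getElem?_of_prefix hpre hi)
  -- The row of a member of `E0` refers to smaller indices, hence to members of the prefix `E0`.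
  have hRE : ∀ z ∈ R, z.1 ∈ E0 := by
    intro z hz
    have h1 := mem_of_heapList hR hz
    obtain ⟨F, rfl⟩ := hpre
    rw [List.take_append_of_le_length (lt_length_of_getElem? hi).le] at h1
    exact List.mem_of_mem_take h1
  have hRw := (H.wt x hxX).length_le hRn hRv
  have hsucc : ∀ e ∈ E0, HasSucc s1.arr E1 e ∧ HasSucc s1.arr E1 (e + 1) ∧
      HasSucc s1.arr E1 (e + 2) := fun e he =>
    ⟨hg.hasSucc (H.succ e he).1, hg.hasSucc (H.succ e he).2.1, hg.hasSucc (H.succ e he).2.2⟩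
  have hY1 : HeapList s1.arr E1 (s.reg 62) (s.reg 63) Y :=
    hg.heapList (H.listY.congr (fun _ _ => ⟨rfl, rfl⟩) H.pre) H.leY
  have hhp := hg.hp
  simp only [shiftBody, wp_seq, wp_ld, wp_mov]
  refine wp_mono (wp_addP (E := E1) (flip := flip) (L := R) (M := Y) ?_ ?_ ?_ ?_ ?_ ?_ hRn H.nafY
    ?_ ?_) ?_
  · simpa using hg.pool
  · exact ⟨by simpa using hc1.zero, by simpa using hc1.one, by simpa using hc1.three⟩
  · simpa using hR.congr (fun _ _ => ⟨rfl, rfl⟩) (List.take_prefix _ _)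
  · simpa [hreg] using hY1
  · simpa using hRle
  · simp [hreg]; exact H.leY.trans hhp
  · simp [hreg, H.flag]
  · rintro z (hz | hz)
    · simpa using hsucc _ (hRE z hz)
    · simpa using hsucc _ (mem_of_heapList H.listY hz)
  · rintro s2 ⟨hf2, hL2, hle2, ht2⟩
    have hf : Frame 54 s1 s2 := Frame.trans (k := 54) (by
        repeat' (first | exact Frame.refl _ _ | refine Frame.of_tick ?_ |
          refine Frame.of_set ?_ (by norm_num) (by norm_num))) hf2 le_rfl
    have hZn := isNaf_addList (flip := flip) (M := Y) hRn
    have hZv : val (addList flip R Y) = (x.1 : ℤ) + y := by rw [val_addList, hRv, H.exp]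
    have hZl := length_addList flip R Y
    refine wp_mono (wp_negP (hf.consts hc1) hL2 hZn) ?_
    rintro s3 ⟨hq3, hneg, ht3⟩
    have hf3 : Frame 54 s1 s3 := hf.trans (hq3.frame.trans (Frame.refl 54 _) (by norm_num)) le_rfl
    have k66 := hf3.reg 66 (by norm_num)
    have k67 := hf3.reg 67 (by norm_num)
    have k61 := hf3.reg 61 (by norm_num)
    have k50 := hq3.reg 50 (by norm_num)
    have k51 := hq3.reg 51 (by norm_num)
    have hc3 := hf3.consts hc1
    have hT : 20 * (W + Y.length + 6) * (E.length + X.length + Y.length + 3) *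
        (s.reg 61 - s1.reg 67) = 20 * (W + Y.length + 6) * (E.length + X.length + Y.length + 3) *
        (s.reg 61 - (s1.reg 67 + 1)) +
        20 * (W + Y.length + 6) * (E.length + X.length + Y.length + 3) := by
      rw [show s.reg 61 - s1.reg 67 = s.reg 61 - (s1.reg 67 + 1) + 1 by omega]; ring
    have hT1 : 20 * (R.length + Y.length + 2) * (Y.length + 1) ≤
        20 * (W + Y.length + 6) * (Y.length + 1) := Nat.mul_le_mul_right _ (by omega)
    have hT2 : 20 * (W + Y.length + 6) * (E.length + X.length + Y.length + 3) =
        20 * (W + Y.length + 6) * (Y.length + 1) +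
        20 * (W + Y.length + 6) * (E.length + X.length + 1) +
        20 * (W + Y.length + 6) := by ring
    have hT3 : 20 * ((addList flip R Y).length + 4) * (E1.length + 1) ≤
        20 * (W + Y.length + 6) * (E.length + X.length + 1) :=
      Nat.mul_le_mul (by omega) (by omega)
    rw [hT] at ht
    simp at ht2
    simp only [wp_ifEq, hc3.one, hneg, hZv, wp_seq, wp_const, wp_mov]
    refine ⟨fun h => ?_, fun h => ?_⟩
    · simp [k61, h61]
      refine ⟨⟨by simp, by simp; omega, Or.inl ⟨by simp, by simp, x, hxX, h⟩, ⟨E1, ?_, ?_, hnew, ?_⟩,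
        fun r hr => ?_, fun i hi => ?_, ?_⟩, hlt⟩
      · have := hg.trans ((hf3.trans (Frame.refl 70 _) (by norm_num)).grow hg.pool
          hg.size) le_rfl
        repeat' (first | exact this | refine Grow.of_tick ?_ |
          refine Grow.of_set ?_ (by norm_num) (by norm_num))
      · simp; omega
      · simp
      · simp [show r ≠ 67 by omega, show r ≠ 66 by omega, hf3.reg r (by omega), hreg r hr]
      · simp [hf3.arr 3, hsu i hi]
      · simp; omega
    · replace h : 0 ≤ (x.1 : ℤ) + y := by omega
      have hf4 : Frame 54 s1 ((s3.tick.set 30 (s3.tick.reg 50)).set 31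
          ((s3.tick.set 30 (s3.tick.reg 50)).reg 51)) := by
        repeat' (first | exact hf3 | refine Frame.of_tick ?_ |
          refine Frame.of_set ?_ (by norm_num) (by norm_num))
      have hg4 := hf4.grow hg.pool hg.size
      refine wp_mono (wp_findP (E := E1) (L := addList flip R Y) (e := ((x.1 : ℤ) + y).toNat)
        hg4.pool (hg4.consts hc1) hg4.size ?_ hZn (by rw [hZv]; omega) ?_) ?_
      · simpa [k50, k51, hq3.arr] using hL2
      · simpa [k51, hq3.reg 2] using hle2
      · rintro s5 ⟨E2, hg5, h33, hE2, hsu5, ht5⟩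
        have hg6 : Grow 54 E1 E2 s1 s5 := hg4.trans (hg5.weaken (by norm_num)) le_rfl
        have hg7 : Grow 70 E E2 s s5 := hg.trans (hg6.weaken (by norm_num)) le_rfl
        have l67 := hg6.reg 67 (by norm_num)
        have l66 := hg6.reg 66 (by norm_num)
        have l61 := hg6.reg 61 (by norm_num)
        have l9 := hg6.arr 9 (by norm_num) (by norm_num)
        have hE2l : E2.length ≤ E1.length + 1 := by rcases hE2 with rfl | rfl <;> simp
        simp only [wp_st, wp_inc]
        simp [l67]
        refine ⟨⟨by simp; omega, by simp; omega, Or.inr ⟨by simp [l66, hbad.1], ?_⟩,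
          ⟨E2, ⟨fun r hr => ?_, by simpa using hg7.out, by simpa using hg7.hp,
            by simpa using hg7.heap, fun c hc hc' => ?_, hg7.pre, ?_, by simpa using hg7.size,
            by simpa using hg7.succ⟩, ?_, ?_, ?_⟩,
          fun r hr => ?_, fun i hi => ?_, ?_⟩, by omega⟩
        · intro q hq' z hz
          simp at hq'
          rcases Nat.lt_or_ge q (s1.reg 67 - s.reg 60) with h' | h'
          · exact hbad.2 q h' z hz
          · obtain rfl : q = s1.reg 67 - s.reg 60 := by omega
            obtain rfl : x = z := by simpa using hx.symm.trans hz
            exact h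
        · simp [show r ≠ 67 by omega, hg7.reg r hr]
        · funext i
          simp [show c ≠ 9 by omega, hg7.arr c hc hc']
        · exact hg7.pool.congr (by simp) (fun c hc => by funext i; simp [show c ≠ 9 by omega])
            (by simp)
        · simp; omega
        · intro e he
          rcases hE2 with rfl | rfl
          · exact hnew e he
          · rcases List.mem_append.1 he with he | he
            · exact hnew e he
            · simp at he
              exact Or.inr ⟨x, hxX, by omega⟩
        · intro _ q hq' z hz
          simp at hq'
          simp
          rcases Nat.lt_or_ge q (s1.reg 67 - s.reg 60) with h' | h'
          · rw [if_neg (by omega), l9]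
            exact getElem?_of_prefix hg6.pre (hidx hbad.1 q h' z hz)
          · obtain rfl : q = s1.reg 67 - s.reg 60 := by omega
            obtain rfl : x = z := by simpa using hx.symm.trans hz
            rw [if_pos (by omega)]
            exact h33
        · simp [show r ≠ 67 by omega, hg6.reg r (by omega), hreg r hr]
        · simp [hsu5 i (hi.trans_le hg.pre.length_le), hf3.arr 3, hsu i hi]
        · simp at ht5 ⊢
          omega

theorem Frame.weaken {k k' s s'} (h : Frame k s s') (hk : k ≤ k') : Frame k' s s' :=
  ⟨fun r hr => h.reg r (by omega), h.out, h.hp, h.heap, h.arr⟩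

structure CopyInv (s : St) (E : List ℕ) (y : ℤ) (X : List (ℕ × Bool)) (a b n : ℕ) (s1 : St) :
    Prop where
  frame : Frame 70 s s1
  start : s1.reg 64 = s.reg 2
  finish : s1.reg 61 = b
  flag : s1.reg 66 = s.reg 66
  ge : a ≤ s1.reg 67
  le : s1.reg 67 ≤ b
  list : s.reg 66 = 0 → HeapList s1.arr E (s.reg 2) (s1.reg 2) (shiftList y (X.take (s1.reg 67 - a)))
  time : s1.tm + 10 * (b - s1.reg 67) ≤ s.tm + n

theorem wp_shiftCopyBody {inp s E y X} {a b n s1} (hb : b ≤ s.reg 2)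
    (hX : s.reg 66 = 0 → ∀ q, ∀ x, X[q]? = some x →
      E[s.arr 9 (a + q)]? = some ((x.1 : ℤ) + y).toNat ∧ s.arr 5 (a + q) = code x.2)
    (hl : a + X.length = b) (hI : CopyInv s E y X a b n s1) (hlt : s1.reg 67 < s1.reg 61) :
    wp inp shiftCopyBody (fun s2 => CopyInv s E y X a b n s2 ∧
      s2.reg 61 - s2.reg 67 < s1.reg 61 - s1.reg 67) s1.tick := by
  obtain ⟨hf, h64, h61, h66, hge, hle, hlist, ht⟩ := hI
  have hhp := hf.hp
  simp only [shiftCopyBody, wp_seq, wp_ld, wp_pushP, wp_inc]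
  refine ⟨⟨?_, by simpa, by simpa, by simpa, by simp; omega, by simp; omega, fun h => ?_,
    by simp; omega⟩, by simp; omega⟩
  · repeat' (first | exact hf | refine Frame.of_tick ?_ | refine Frame.of_push ?_ (by norm_num) |
      refine Frame.of_set ?_ (by norm_num) (by norm_num))
  · obtain ⟨x, hx⟩ : ∃ x, X[s1.reg 67 - a]? = some x := ⟨_, List.getElem?_eq_getElem (by omega)⟩
    have h1 := hX h _ x hx
    rw [show a + (s1.reg 67 - a) = s1.reg 67 by omega] at h1
    have htk : X.take (s1.reg 67 + 1 - a) = X.take (s1.reg 67 - a) ++ [x] := by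
      rw [show s1.reg 67 + 1 - a = s1.reg 67 - a + 1 by omega, List.take_add_one, hx]; rfl
    have h5 := (hf.heap (s1.reg 67) (by omega)).2
    simp [htk, shiftList]
    refine HeapList.push (by simpa [shiftList] using hlist h) (by simp) ?_ ?_
    · simpa [hf.arr 9] using h1.1
    · simp [h5, h1.2]

theorem wp_shiftP {inp s E0 E y X Y flip W} (H : ShiftHyp s E0 E y X Y flip W) :
    wp inp shiftP (fun s' => ∃ E', Grow 70 E E' s s' ∧ E'.length ≤ E.length + X.length ∧
      (∀ e ∈ E', e ∈ E ∨ ∃ x ∈ X, (e : ℤ) = x.1 + y) ∧ (∀ i < E.length, s'.arr 3 i = s.arr 3 i) ∧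
      ((s'.reg 66 = 1 ∧ ∃ x ∈ X, (x.1 : ℤ) + y < 0) ∨ (s'.reg 66 = 0 ∧
        (∀ x ∈ X, 0 ≤ (x.1 : ℤ) + y) ∧
        HeapList s'.arr E' (s'.reg 64) (s'.reg 65) (shiftList y X) ∧ s'.reg 65 ≤ s'.reg 2)) ∧
      s'.tm ≤ s.tm + 20 * (W + Y.length + 7) * (E.length + X.length + Y.length + 3) *
        (X.length + 1)) s := by
  have hXl := H.listX.len
  simp only [shiftP, wp_seq, wp_mov, wp_const]
  refine wp_mono (Q := fun s2 => ShiftInv s E y X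
    (20 * (W + Y.length + 6) * (E.length + X.length + Y.length + 3) * X.length + 3)
    (20 * (W + Y.length + 6) * (E.length + X.length + Y.length + 3)) s2 ∧ s2.reg 67 = s.reg 61)
    ?_ ?_
  · refine wp_loop (ShiftInv s E y X
      (20 * (W + Y.length + 6) * (E.length + X.length + Y.length + 3) * X.length + 2)
      (20 * (W + Y.length + 6) * (E.length + X.length + Y.length + 3)))
      (fun s => s.reg 61 - s.reg 67) ?_ (fun s1 hI hlt => wp_shiftBody H hI hlt) ?_
    · refine ⟨by simp; omega, by simp, Or.inr ⟨by simp, by simp⟩, ⟨E, ?_, by simp,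
        fun e he => Or.inl he, by simp⟩, fun r hr => ?_, by simp, ?_⟩
      · repeat' (first | exact Grow.refl _ H.pool H.size | refine Grow.of_tick ?_ |
          refine Grow.of_set ?_ (by norm_num) (by norm_num))
      · simp [show r ≠ 66 by omega, show r ≠ 67 by omega]
      · simp [show s.reg 61 - s.reg 60 = X.length by omega]
        omega
    · rintro s1 ⟨hle, hge, hmain, ⟨E1, hg, hlen⟩, hreg, hsu, ht⟩ hlt
      rw [hreg 61 (by norm_num)] at hlt
      exact ⟨⟨hle, hge, hmain, ⟨E1, hg.of_tick, hlen⟩, hreg, hsu, by simp; omega⟩,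
        by simp; omega⟩
  · rintro s2 ⟨⟨-, -, hmain, ⟨E1, hg, hlen, hnew, hidx⟩, hreg, hsu, ht⟩, h67⟩
    have h60 := hreg 60 (by norm_num)
    have h61 := hreg 61 (by norm_num)
    have hhp := hg.hp
    have hleX := H.leX
    have hq : s2.reg 67 - s.reg 60 = X.length := by omega
    rw [hq] at hmain hlen hidx
    refine wp_mono (Q := fun s3 => CopyInv s2 E1 y X (s.reg 60) (s.reg 61) (10 * X.length + 3) s3 ∧
      s3.reg 67 = s.reg 61) ?_ ?_
    · refine wp_loop (CopyInv s2 E1 y X (s.reg 60) (s.reg 61) (10 * X.length + 2))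
        (fun s => s.reg 61 - s.reg 67) ?_ (fun s1 hI hlt => wp_shiftCopyBody (hleX.trans hhp) ?_
          hXl hI hlt) ?_
      · refine ⟨?_, by simp, by simpa, by simp, by simp [h60], by simp; omega, fun h => ?_,
          by simp; omega⟩
        · repeat' (first | exact Frame.refl _ _ | refine Frame.of_tick ?_ |
            refine Frame.of_set ?_ (by norm_num) (by norm_num))
        · simp [h60, shiftList]
          exact heapList_nil _ _ _
      · intro h q x hx
        have hql := (List.getElem?_eq_some_iff.1 hx)
        obtain ⟨hql, hqx⟩ := hql
        refine ⟨hidx h q hql x hx, ?_⟩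
        rw [(hg.heap _ (by omega)).2, (H.listX.get q hql).2, hqx]
      · rintro s1 ⟨hf, h64, h61', h66, hge, hle, hlist, ht⟩ hlt
        exact ⟨⟨hf.of_tick, h64, h61', h66, hge, hle, hlist, by simp; omega⟩, by simp; omega⟩
    · rintro s3 ⟨⟨hf, h64, h61', h66, -, -, hlist, ht3⟩, h67'⟩
      have hf' : Frame 70 s2 (s3.set 65 (s3.reg 2)) := hf.of_set (by norm_num) (by norm_num)
      refine ⟨E1, hg.trans (hf'.grow hg.pool hg.size) le_rfl, hlen, hnew, fun i hi => ?_, ?_, ?_⟩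
      · rw [hf'.arr 3 (by norm_num) (by norm_num), hsu i hi]
      · rcases hmain with ⟨h, -, h'⟩ | ⟨h, h'⟩
        · exact Or.inl ⟨by simp [h66, h], h'⟩
        · refine Or.inr ⟨by simp [h66, h], fun x hx => ?_, ?_, by simp⟩
          · obtain ⟨q, hq⟩ := List.mem_iff_getElem?.1 hx
            exact h' q (List.getElem?_eq_some_iff.1 hq).1 x hq
          · have := hlist h
            rw [h67', show s.reg 61 - s.reg 60 = X.length by omega, List.take_length] at this
            simpa [h64] using this
      · simp [h67] at ht ⊢
        simp [h67'] at ht3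
        have h1 : 20 * (W + Y.length + 7) * (E.length + X.length + Y.length + 3) *
          (X.length + 1) = 20 * (W + Y.length + 6) * (E.length + X.length + Y.length + 3) *
            X.length + 20 * (W + Y.length + 6) * (E.length + X.length + Y.length + 3) +
            20 * (E.length + X.length + Y.length + 3) * (X.length + 1) := by ring
        have h2 : 20 * 3 * (X.length + 1) ≤ 20 * (E.length + X.length + Y.length + 3) *
            (X.length + 1) := Nat.mul_le_mul_right _ (by omega)
        omega

/-! ### Evaluation of terms -/

namespace ExpTerm

variable {k : ℕ}

/-- The weight of a term under an assignment. -/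
def weight (η : Fin k → ℤ) : ExpTerm k → ℕ
  | zero => 1
  | one => 2
  | var x => Nat.clog 2 ((η x).natAbs + 1) + 2
  | add t u => weight η t + weight η u
  | sub t u => weight η t + weight η u
  | mulPow t u => weight η t + weight η u
  | divPow t u => weight η t + weight η u

theorem weight_eq (η : Fin k → ℤ) (t : ExpTerm k) :
    t.weight η = (∑ x : Fin k, t.numVar x * (Nat.clog 2 ((η x).natAbs + 1) + 2)) +
      2 * t.numOne + t.numZero := by
  induction t with
  | zero => simp [weight, numVar, numOne, numZero]
  | one => simp [weight, numVar, numOne, numZero]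
  | var x => simp [weight, numVar, numOne, numZero]
  | add t u ht hu | sub t u ht hu | mulPow t u ht hu | divPow t u ht hu =>
    simp only [weight, numVar, numOne, numZero, ht, hu, add_mul, Finset.sum_add_distrib]
    ring

theorem numOps_lt_weight (η : Fin k → ℤ) (t : ExpTerm k) : t.numOps < t.weight η := by
  induction t <;> simp only [weight, numOps] <;> omega

theorem length_tokens (t : ExpTerm k) : t.tokens.length = 2 * t.numOps + 1 := by
  induction t <;> simp [tokens, numOps] <;> omega

end ExpTerm

theorem length_bits_le (n : ℕ) : n.bits.length ≤ Nat.clog 2 (n + 1) := by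
  rw [Nat.size_eq_bits_len, Nat.size_le]
  exact Nat.le_pow_clog one_lt_two (n + 1)

theorem lt_two_pow_length_bits (n : ℕ) : n < 2 ^ n.bits.length := by
  rw [Nat.size_eq_bits_len, ← Nat.size_le]

theorem mod_two_pow_add_one (n j : ℕ) :
    n % 2 ^ (j + 1) = n % 2 ^ j + if n.testBit j then 2 ^ j else 0 := by
  rw [Nat.mod_pow_succ, Nat.testBit_eq_decide_div_mod_eq]
  rcases Nat.mod_two_eq_zero_or_one (n / 2 ^ j) with h | h <;> simp [h]

/-- The list `L` represents the value `v` of a term with the weight `a` and `o` operations. -/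
structure ListOk (L : List (ℕ × Bool)) (v : ℤ) (a o : ℕ) : Prop where
  naf : IsNaf L
  val : val L = v
  len : L.length ≤ a
  -- The part `o` accounts for additions, which may raise an exponent by one; the part `a` accounts
  -- for shifts, which add the expansion of the second operand to an exponent.
  wt : ∀ x ∈ L, Wt (x.1 : ℤ) (a + o)

/-- The state after `r` operations; `S` is the total weight, `N` exceeds the total number of
operations, and `stk` is the stack of intermediate results. -/
structure Ready (S N lim : ℕ) (s : St) (E : List ℕ) (r : ℕ) (stk : List (List (ℕ × Bool))) :
    Prop where
  -- Numbers up to `32 * S` have expansions of length at most `S + 4`, and the three rounds before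
  -- each operation lengthen expansions by three. Since `r < N ≤ S` whenever an operation starts,
  -- `32 * S` is beyond the carries of its rounds.
  good : Good s E (S + 4 + 3 * r) (32 * S)
  range : List.range (32 * S + 1) <+: E
  -- Each of the three rounds of an operation adds at most as many exponents as there are unknown
  -- successors, and a shift adds at most `S`.
  size : E.length ≤ 32 * S + 1 + r * (3 * (1 + N * S) + S)
  unset : unset s.arr 0 E.length ≤ 1 + r * S
  lim : s.reg 91 = lim
  sp : s.reg 92 = stk.length
  flag : s.reg 93 = 0
  out : s.out = []
  stack : ∀ {i L}, stk[i]? = some L → HeapList s.arr E (s.arr 6 i) (s.arr 7 i) L ∧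
    s.arr 7 i ≤ s.reg 2

section Ready

variable {S N lim r : ℕ} {s s' : St} {E E' : List ℕ} {stk : List (List (ℕ × Bool))}

theorem Ready.grow {r' : ℕ} (h : Ready S N lim s E r stk) (hg : Grow 91 E E' s s')
    (h1 : Good s' E' (S + 4 + 3 * r') (32 * S))
    (h2 : E'.length ≤ 32 * S + 1 + r' * (3 * (1 + N * S) + S))
    (h3 : PowerCircuits.unset s'.arr 0 E'.length ≤ 1 + r' * S) : Ready S N lim s' E' r' stk := by
  refine ⟨h1, h.range.trans hg.pre, h2, h3, by rw [hg.reg 91 (by omega), h.lim],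
    by rw [hg.reg 92 (by omega), h.sp], by rw [hg.reg 93 (by omega), h.flag],
    by rw [hg.out, h.out], fun {i L} hi => ?_⟩
  obtain ⟨h4, h5⟩ := h.stack hi
  rw [hg.arr 6 (by omega) (by omega), hg.arr 7 (by omega) (by omega)]
  exact ⟨hg.heapList h4 h5, h5.trans hg.hp⟩

theorem Good.frame {k w K} (h : Good s E w K) (hf : Frame k s s') : Good s' E w K :=
  ⟨hf.pool h.pool, hf.consts h.consts, by rw [hf.reg 1 (by omega), h.size], h.wt,
    fun x hx => hf.hasSucc (h.low x hx)⟩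

theorem Ready.frame (h : Ready S N lim s E r stk) (hf : Frame 91 s s') :
    Ready S N lim s' E r stk :=
  h.grow (hf.grow h.good.pool h.good.size) (h.good.frame hf) h.size
    (by rw [unset_congr fun i _ => by rw [hf.arr 3 (by omega) (by omega)]]; exact h.unset)

theorem Ready.index (h : Ready S N lim s E r stk) {i : ℕ} (hi : i ≤ 32 * S) : E[i]? = some i :=
  getElem?_of_prefix h.range (List.getElem?_range (by omega))

end Ready

/-- The computation has found out that the value of the term is undefined. -/
structure Failed (lim : ℕ) (s : St) : Prop where
  flag : s.reg 93 = 1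
  pos : s.reg 90 = lim
  lim : s.reg 91 = lim
  out : s.out = []
  consts : Consts s

/-- Push the list from `64` to `65` on the stack, or end the loop, if register `66` is not `0`. -/
def finishP : Prog :=
  .ifEq 66 0 (.st 6 92 64 ;; .st 7 92 65 ;; .inc 92 1) (.mov 90 91 ;; .const 93 1)

theorem wp_finishP {inp S N lim s E r stk L} (h : Ready S N lim s E r stk) (h66 : s.reg 66 = 0)
    (hL : HeapList s.arr E (s.reg 64) (s.reg 65) L) (hle : s.reg 65 ≤ s.reg 2) :
    wp inp finishP (fun s' => Ready S N lim s' E r (stk ++ [L]) ∧ s'.reg 90 = s.reg 90 ∧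
      s'.tm ≤ s.tm + 4) s := by
  have h0 := h.good.consts.zero
  simp only [finishP, wp_seq, wp_ifEq, wp_st, wp_inc, wp_mov, wp_const]
  refine ⟨fun _ => ⟨⟨⟨?_, ?_, ?_, h.good.wt, fun x hx => ?_⟩, h.range, h.size, ?_, ?_, ?_, ?_,
    by simpa using h.out, fun {i M} hi => ?_⟩, by simp, by simp⟩, fun h' => absurd (h66.trans h0.symm) h'⟩
  · exact h.good.pool.congr (by simp) (fun c hc => by
      funext i; simp [show c ≠ 6 by omega, show c ≠ 7 by omega]) (by simp)
  · exact ⟨by simpa using h0, by simpa using h.good.consts.one, by simpa using h.good.consts.three⟩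
  · simpa using h.good.size
  · obtain ⟨i, h1, h2⟩ := h.good.low x hx
    exact ⟨i, h1, by simpa using h2⟩
  · rw [unset_congr (A := s.arr) fun i _ => by simp]; exact h.unset
  · simpa using h.lim
  · simp [h.sp]
  · simpa using h.flag
  · simp [h.sp]
    rcases lt_trichotomy i stk.length with hi' | hi' | hi'
    · rw [List.getElem?_append_left hi'] at hi
      obtain ⟨h4, h5⟩ := h.stack hi
      simp [hi'.ne]
      exact ⟨h4.congr (by simp) (List.prefix_refl _), h5⟩
    · subst hi'
      obtain rfl : L = M := by simpa using hi
      simp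
      exact ⟨hL.congr (by simp) (List.prefix_refl _), hle⟩
    · rw [List.getElem?_eq_none (by simp; omega)] at hi
      simp at hi

theorem wp_finishP_failed {inp lim} {s : St} (hc : Consts s) (h66 : s.reg 66 = 1)
    (hl : s.reg 91 = lim) (ho : s.out = []) :
    wp inp finishP (fun s' => Failed lim s' ∧ s'.tm ≤ s.tm + 4) s := by
  have h0 := hc.zero
  simp only [finishP, wp_seq, wp_ifEq, wp_st, wp_inc, wp_mov, wp_const]
  refine ⟨fun h => by omega, fun _ => ⟨⟨by simp, by simpa, by simpa, by simpa, ?_⟩, by simp⟩⟩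
  exact ⟨by simpa using h0, by simpa using hc.one, by simpa using hc.three⟩

/-- The input contains the address of the numeral of `n`. -/
def NumeralAt (inp : List ℕ) (p : ℕ) (n : ℤ) : Prop :=
  ∃ a, inp.getD p 0 = a ∧ inp.getD a 0 = (if n < 0 then 1 else 0) ∧
    inp.getD (a + 1) 0 = n.natAbs.bits.length ∧
    ∀ i < n.natAbs.bits.length, inp.getD (a + 1 + 1 + i) 0 = if n.natAbs.testBit i then 1 else 0

def zeroP : Prog := .mov 64 2 ;; .mov 65 2

def oneP : Prog := .mov 64 2 ;; pushP 0 3 ;; .mov 65 2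

def varBody : Prog :=
  .read 80 75 79 ;;
  .ifEq 80 3 (.mov 10 64 ;; .mov 11 65 ;; .mov 12 79 ;; .mov 13 77 ;; insP ;; .mov 64 14 ;;
    .mov 65 2) (.mov 80 0) ;;
  .inc 79 1

def varP : Prog :=
  .sub 75 74 76 ;; .read 75 91 75 ;; .read 77 75 0 ;; .inc 77 1 ;; .inc 75 1 ;; .read 78 75 0 ;;
  .inc 75 1 ;; .const 79 0 ;; .mov 64 2 ;; .mov 65 2 ;; .loop 79 78 varBody

/-- A list at the positions from `64` to `65` has been computed. -/
structure Leaf (s : St) (E : List ℕ) (s' : St) (L : List (ℕ × Bool)) : Prop where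
  frame : Frame 90 s s'
  list : HeapList s'.arr E (s'.reg 64) (s'.reg 65) L
  le : s'.reg 65 ≤ s'.reg 2
  flag : s'.reg 66 = s.reg 66

structure VarInv (s : St) (E : List ℕ) (n : ℤ) (d c T m : ℕ) (s1 : St) : Prop where
  le : s1.reg 79 ≤ d
  lim : s1.reg 78 = d
  base : s1.reg 75 = s.reg 75
  sign : s1.reg 77 = c
  list : ∃ L, Leaf s E s1 L ∧ IsNaf L ∧ L.length ≤ s1.reg 79 ∧
    val L = sgn (decide (n < 0)) * (n.natAbs % 2 ^ s1.reg 79 : ℕ)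
  time : s1.tm + T * (d - s1.reg 79) ≤ s.tm + m

theorem wp_varBody {inp s E n d w K m s1} (hG : Good s E w K) (hE : ∀ i < d, E[i]? = some i)
    (hK : d + 2 ≤ K)
    (hbit : ∀ i < d, inp.getD (s.reg 75 + i) 0 = if n.natAbs.testBit i then 1 else 0)
    (hI : VarInv s E n d (code (decide (n < 0))) (20 * (d + 2)) m s1)
    (hlt : s1.reg 79 < s1.reg 78) :
    wp inp varBody (fun s2 => VarInv s E n d (code (decide (n < 0))) (20 * (d + 2)) m s2 ∧
      s2.reg 78 - s2.reg 79 < s1.reg 78 - s1.reg 79) s1.tick := by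
  obtain ⟨hle, hlim, hbase, hsign, ⟨L, hL, hLn, hLl, hLv⟩, ht⟩ := hI
  rw [hlim] at hlt
  have hc1 := hL.frame.consts hG.consts
  have hstep := mod_two_pow_add_one n.natAbs (s1.reg 79)
  have hT : 20 * (d + 2) * (d - s1.reg 79) = 20 * (d + 2) * (d - (s1.reg 79 + 1)) +
      20 * (d + 2) := by
    rw [show d - s1.reg 79 = d - (s1.reg 79 + 1) + 1 by omega]; ring
  rw [hT] at ht
  simp only [varBody, wp_seq, wp_read, wp_ifEq, wp_mov, wp_inc]
  simp only [St.tick_reg, hbase, hbit _ hlt]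
  refine ⟨fun h => ?_, fun h => ?_⟩
  · have hb : n.natAbs.testBit (s1.reg 79) = true := by
      by_contra hb; simp [hb, hc1.one] at h
    have hf1 : Frame 90 s1 ((((((s1.tick.set 80 (if n.natAbs.testBit (s1.reg 79) then 1 else 0)).tick).set 10
        (s1.reg 64)).set 11 (s1.reg 65)).set 12 (s1.reg 79)).set 13 (s1.reg 77)) := by
      repeat' (first | exact Frame.refl _ _ | refine Frame.of_tick ?_ |
          refine Frame.of_set ?_ (by norm_num) (by norm_num))
    refine wp_mono (wp_insP (E := E) (L := L) (b := decide (n < 0)) (e := s1.reg 79) ?_ ?_ ?_ ?_ ?_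
      ?_ ?_) ?_
    · exact (hL.frame.trans hf1 le_rfl).pool hG.pool
    · exact (hL.frame.trans hf1 le_rfl).consts hG.consts
    · simpa using hL.list
    · simpa using hL.le
    · simpa using hE _ hlt
    · simpa using hsign
    · have hlow : ∀ k < d + 2, HasSucc s1.arr E k := fun k hk =>
        hL.frame.hasSucc (hG.low k (by omega))
      refine carryOk_of_succ hLn (hlow _ (by omega)) (Or.inl (hlow _ (by omega))) fun x hx => ?_
      -- The bits below the current position make a number less than two to this position, so no
      -- exponent of the list exceeds the position, and successors of small numbers suffice.
      have h1 := two_pow_le_of_mem hLn hx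
      have h2 : |val L| = (n.natAbs % 2 ^ s1.reg 79 : ℕ) := by
        rw [hLv, abs_mul, Nat.abs_cast]
        cases decide (n < 0) <;> simp
      have h3 : n.natAbs % 2 ^ s1.reg 79 < 2 ^ s1.reg 79 := Nat.mod_lt _ (by positivity)
      rw [h2] at h1
      have h4 : 2 ^ (x.1 + 1) < 3 * (n.natAbs % 2 ^ s1.reg 79) := by exact_mod_cast h1
      have h5 : 2 ^ (x.1 + 1) < 2 ^ (s1.reg 79 + 2) := by
        have : 2 ^ (s1.reg 79 + 2) = 4 * 2 ^ s1.reg 79 := by ring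
        omega
      have h6 := (Nat.pow_lt_pow_iff_right (by norm_num)).1 h5
      exact ⟨hlow _ (by omega), hlow _ (by omega)⟩
    · rintro s2 ⟨hf2, hL2, h14, ht2⟩
      have hf3 := hf1.trans (hf2.weaken (k' := 90) (by norm_num)) le_rfl
      have k79 : s2.reg 79 = s1.reg 79 := by rw [hf2.reg 79 (by norm_num)]; simp
      have k78 : s2.reg 78 = s1.reg 78 := by rw [hf2.reg 78 (by norm_num)]; simp
      have k77 : s2.reg 77 = s1.reg 77 := by rw [hf2.reg 77 (by norm_num)]; simp
      have k75 : s2.reg 75 = s1.reg 75 := by rw [hf2.reg 75 (by norm_num)]; simp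
      have k66 : s2.reg 66 = s1.reg 66 := by rw [hf2.reg 66 (by norm_num)]; simp
      have hlen := length_ins (s1.reg 79) (decide (n < 0)) L
      refine ⟨⟨by simp [k79]; omega, by simp [k78, hlim], by simp [k75, hbase],
        by simp [k77, hsign], ⟨ins (s1.reg 79) (decide (n < 0)) L, ⟨?_, ?_, by simp, ?_⟩,
        isNaf_ins hLn, by simp [k79]; omega, ?_⟩, ?_⟩, by simp [k79, k78]; omega⟩
      · have hf4 := hL.frame.trans hf3 le_rfl
        repeat' (first | exact hf4 | refine Frame.of_tick ?_ |
          refine Frame.of_set ?_ (by norm_num) (by norm_num))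
      · simpa using hL2
      · simp [k66, hL.flag]
      · rw [val_ins, hLv]
        simp [k79, hstep, hb]
        ring
      · simp [k79] at ht2 ⊢
        omega
  · have hb : n.natAbs.testBit (s1.reg 79) = false := by
      by_contra hb; simp [hb, hc1.one] at h
    refine ⟨⟨by simp; omega, by simp [hlim], by simp [hbase],
        by simp [hsign], ⟨L, ⟨?_, ?_, by simpa using hL.le, ?_⟩,
        hLn, by simp; omega, ?_⟩, by simp; omega⟩, by simp; omega⟩
    · repeat' (first | exact hL.frame | refine Frame.of_tick ?_ |
          refine Frame.of_set ?_ (by norm_num) (by norm_num))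
    · simpa using hL.list
    · simp [hL.flag]
    · simp [hLv, hstep, hb]

theorem wp_varP {inp s E w K p} {n : ℤ} (hG : Good s E w K)
    (hE : ∀ i < n.natAbs.bits.length, E[i]? = some i) (hK : n.natAbs.bits.length + 2 ≤ K)
    (hn : NumeralAt inp (s.reg 91 + p) n) (h74 : s.reg 74 = 6 + p) (h76 : s.reg 76 = 6) :
    wp inp varP (fun s' => ∃ L, Leaf s E s' L ∧
      ListOk L n (Nat.clog 2 (n.natAbs + 1) + 2) 0 ∧
      s'.tm ≤ s.tm + 20 * (n.natAbs.bits.length + 2) * n.natAbs.bits.length + 11) s := by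
  obtain ⟨a, h1, h2, h3, h4⟩ := hn
  have hz := hG.consts.zero
  simp only [varP, wp_seq, wp_sub, wp_read, wp_inc, wp_const, wp_mov]
  simp [-List.getD_eq_getElem?_getD, h74, h76, h1, hz, h2, h3]
  generalize hs0 : ((((((((((s.set 75 p).set 75 a).set 77 (if n < 0 then 1 else 0)).set 77
    ((if n < 0 then 1 else 0) + 1)).set 75 (a + 1)).set 78 n.natAbs.bits.length).set 75
    (a + 1 + 1)).set 79 0).set 64 (s.reg 2)).set 65 (s.reg 2)) = s0
  have hf0 : Frame 90 s s0 := by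
    rw [← hs0]
    repeat' (first | exact Frame.refl _ _ | refine Frame.of_set ?_ (by norm_num) (by norm_num))
  have k66 : s0.reg 66 = s.reg 66 := by simp [← hs0]
  refine wp_mono (Q := fun s2 => VarInv s0 E n n.natAbs.bits.length (code (decide (n < 0)))
    (20 * (n.natAbs.bits.length + 2))
    (20 * (n.natAbs.bits.length + 2) * n.natAbs.bits.length + 1) s2 ∧
    s2.reg 79 = n.natAbs.bits.length) ?_ ?_
  · refine wp_loop (VarInv s0 E n n.natAbs.bits.length (code (decide (n < 0)))
      (20 * (n.natAbs.bits.length + 2))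
      (20 * (n.natAbs.bits.length + 2) * n.natAbs.bits.length)) (fun s => s.reg 78 - s.reg 79) ?_
      (fun s1 hI hlt => wp_varBody (hG.frame hf0) hE hK ?_ hI hlt) ?_
    · refine ⟨by simp [← hs0], by simp [← hs0], rfl, ?_, ⟨[], ⟨Frame.refl _ _, ?_, ?_, rfl⟩,
        isNaf_nil, by simp, ?_⟩, by simp [← hs0]⟩
      · by_cases h : n < 0 <;> simp [← hs0, h, code]
      · simp [← hs0]; exact heapList_nil _ _ _
      · simp [← hs0]
      · simp [← hs0, Nat.mod_one]
    · intro i hi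
      rw [← h4 i hi]
      simp [← hs0]
    · rintro s1 ⟨hle, hlim, hbase, hsign, ⟨L, hL, hLn, hLl, hLv⟩, ht⟩ hlt
      exact ⟨⟨hle, hlim, hbase, hsign, ⟨L, ⟨hL.frame.of_tick, hL.list, hL.le, hL.flag⟩, hLn, hLl, hLv⟩,
        by simp; omega⟩, by simp; omega⟩
  · rintro s2 ⟨⟨hle, hlim, hbase, hsign, ⟨L, hL, hLn, hLl, hLv⟩, ht⟩, h79⟩
    rw [h79] at hLl hLv ht
    have hbl := length_bits_le n.natAbs
    have hv : val L = n := by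
      rw [hLv, Nat.mod_eq_of_lt (lt_two_pow_length_bits _)]
      by_cases h : n < 0
      · simp [h, abs_of_neg h]
      · simp [h, abs_of_nonneg (not_lt.1 h)]
    refine ⟨L, ⟨hf0.trans hL.frame le_rfl, hL.list, hL.le, by rw [hL.flag, k66]⟩,
      ⟨hLn, hv, by omega, fun x hx => ?_⟩, ?_⟩
    · have h5 := two_pow_le_of_mem hLn hx
      have h6 : |val L| = n.natAbs := by rw [hv]; simp
      rw [h6] at h5
      have h7 : 2 ^ (x.1 + 1) < 3 * n.natAbs := by exact_mod_cast h5
      have h8 := lt_two_pow_length_bits n.natAbs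
      have h9 : 2 ^ (x.1 + 1) < 2 ^ (n.natAbs.bits.length + 2) := by
        have : 2 ^ (n.natAbs.bits.length + 2) = 4 * 2 ^ n.natAbs.bits.length := by ring
        omega
      have h10 := (Nat.pow_lt_pow_iff_right (by norm_num)).1 h9
      -- The crude bound `x.1` for the length of the expansion of `x.1` is enough, because `x.1` is
      -- at most the bit length of `n`.
      exact (Wt.natCast x.1).mono (by omega)
    · have : s0.tm = s.tm + 10 := by rw [← hs0]; simp
      simp at ht
      omega

theorem wp_zeroP {inp s E} : wp inp zeroP (fun s' => ∃ L, Leaf s E s' L ∧ ListOk L 0 1 0 ∧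
    s'.tm ≤ s.tm + 2) s := by
  simp only [zeroP, wp_seq, wp_mov]
  refine ⟨[], ⟨?_, ?_, by simp, by simp⟩, ⟨isNaf_nil, rfl, by simp, by simp⟩, by simp⟩
  · repeat' (first | exact Frame.refl _ _ | refine Frame.of_set ?_ (by norm_num) (by norm_num))
  · simp; exact heapList_nil _ _ _

theorem wp_oneP {inp s E w K} (hG : Good s E w K) : wp inp oneP (fun s' => ∃ L, Leaf s E s' L ∧
    ListOk L 1 2 0 ∧ s'.tm ≤ s.tm + 5) s := by
  have h1 := hG.consts.one
  have h0 := hG.consts.zero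
  simp only [oneP, wp_seq, wp_mov, wp_pushP]
  refine ⟨[(0, false)], ⟨?_, ?_, by simp, by simp⟩, ⟨?_, by simp, by simp, ?_⟩, by simp⟩
  · repeat' (first | exact Frame.refl _ _ | refine Frame.of_push ?_ (by norm_num) |
      refine Frame.of_set ?_ (by norm_num) (by norm_num))
  · simp
    exact HeapList.push (O := []) (heapList_nil _ _ _) (by simp) (by simpa [h0] using hG.pool.zero)
      (by simp [h1, code])
  · exact List.pairwise_singleton _ _
  · intro x hx
    simp at hx
    subst hx
    exact (Wt.natCast 0).mono (by omega)

/-! ### Execution of a single operation -/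

/-- The operation with the given code. -/
def opVal (c : ℕ) (x y : ℤ) : Option ℤ :=
  if c = 2 then some (x + y) else if c = 3 then some (x - y) else if c = 4 then shift x y
  else shift x (-y)

def popP : Prog :=
  .sub 92 92 3 ;; .ld 62 6 92 ;; .ld 63 7 92 ;; .sub 92 92 3 ;; .ld 60 6 92 ;; .ld 61 7 92

theorem wp_popP {inp S N lim s E r stk X Y} (h : Ready S N lim s E r (stk ++ [X, Y])) :
    wp inp popP (fun s' => Ready S N lim s' E r stk ∧ HeapList s'.arr E (s'.reg 60) (s'.reg 61) X ∧
      HeapList s'.arr E (s'.reg 62) (s'.reg 63) Y ∧ s'.reg 61 ≤ s'.reg 2 ∧ s'.reg 63 ≤ s'.reg 2 ∧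
      (∀ r, r < 60 ∨ (64 ≤ r ∧ r ≠ 92) → s'.reg r = s.reg r) ∧ s'.tm ≤ s.tm + 6) s := by
  have h1 := h.good.consts.one
  have h92 := h.sp
  obtain ⟨hX, hX'⟩ := h.stack (i := stk.length) (L := X) (by simp)
  obtain ⟨hY, hY'⟩ := h.stack (i := stk.length + 1) (L := Y) (by simp)
  simp at h92
  simp only [popP, wp_seq, wp_sub, wp_ld]
  simp [h1, h92]
  refine ⟨⟨⟨h.good.pool, ?_, h.good.size, h.good.wt, h.good.low⟩, h.range, h.size, h.unset,
    by simpa using h.lim, by simp, by simpa using h.flag, by simpa using h.out, fun {i L} hi => ?_⟩,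
    hX, hY, hX', hY', fun r hr => ?_⟩
  · exact ⟨by simpa using h.good.consts.zero, by simpa using h1, by simpa using h.good.consts.three⟩
  · simpa using h.stack (i := i) (L := L) (by
      rw [List.getElem?_append_left (List.getElem?_eq_some_iff.1 hi).1]; exact hi)
  · simp [show r ≠ 61 by omega, show r ≠ 60 by omega, show r ≠ 92 by omega, show r ≠ 63 by omega,
      show r ≠ 62 by omega]

/-- Apply the operation with the code in register `74` to the lists from `60` to `61` and from `62`
to `63`. -/
def opP : Prog :=
  .ifLt 4 74 (.sub 54 74 4 ;; .sub 54 54 3 ;; shiftP)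
    (.sub 54 74 75 ;; .mov 50 60 ;; .mov 51 61 ;; .mov 52 62 ;; .mov 53 63 ;; addP ;; .mov 64 50 ;;
      .mov 65 51)

def binP : Prog := popP ;; closeThreeP ;; opP

/-- A bound for the time that one operation takes. -/
def opTime (S N : ℕ) : ℕ := 200000 * (N ^ 3 * S ^ 3)

/-- Each of the three rounds costs the product of an expansion length `O(S)`, the pool size `O(N^2 *
S)` and the number `O(N * S)` of unknown successors. The second summand bounds the addition or shift
itself, and `40` covers the bookkeeping. -/
theorem opTime_bound {S N r : ℕ} (hr : r < N) (hN : N ≤ S) :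
    3 * (20 * (S + 4 + 3 * r + 8) * (32 * S + 1 + r * (3 * (1 + N * S) + S) + 3 * (1 + r * S) + 2) *
      (1 + r * S + 1)) + 20 * (3 * S + 7) *
      (32 * S + 1 + (r + 1) * (3 * (1 + N * S) + S) + 2 * S + 3) * (S + 1) + 40 ≤ opTime S N := by
  have hN1 : 1 ≤ N := by omega
  have hS1 : 1 ≤ S := by omega
  have h1 : N ≤ N * N := Nat.le_mul_of_pos_left _ hN1
  have h2 : S ≤ N * N * S := Nat.le_mul_of_pos_left _ (by positivity)
  have h3 : N * S ≤ N * N * S := Nat.mul_le_mul_right _ h1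
  have h4 : r * S ≤ N * S := Nat.mul_le_mul_right _ hr.le
  have h5 : (r + 1) * (3 * (1 + N * S) + S) ≤ N * (3 * (1 + N * S) + S) :=
    Nat.mul_le_mul_right _ hr
  have h5' : r * (3 * (1 + N * S) + S) ≤ N * (3 * (1 + N * S) + S) :=
    Nat.mul_le_mul_right _ hr.le
  have h6 : N * (3 * (1 + N * S) + S) = 3 * N + 3 * (N * N * S) + N * S := by ring
  have h7 : S ≤ N * S := Nat.le_mul_of_pos_left _ hN1
  have a1 : 20 * (S + 4 + 3 * r + 8) * (32 * S + 1 + r * (3 * (1 + N * S) + S) + 3 * (1 + r * S) + 2) *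
      (1 + r * S + 1) ≤ (20 * (16 * S)) * (60 * (N * N * S)) * (3 * (N * S)) :=
    Nat.mul_le_mul (Nat.mul_le_mul (by omega) (by omega)) (by omega)
  have a2 : 20 * (3 * S + 7) * (32 * S + 1 + (r + 1) * (3 * (1 + N * S) + S) + 2 * S + 3) *
      (S + 1) ≤ (20 * (10 * S)) * (60 * (N * N * S)) * (2 * (N * S)) :=
    Nat.mul_le_mul (Nat.mul_le_mul (by omega) (by omega)) (by omega)
  have a3 : 1 ≤ N ^ 3 * S ^ 3 := Nat.one_le_iff_ne_zero.2 (by positivity)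
  have a4 : (20 * (16 * S)) * (60 * (N * N * S)) * (3 * (N * S)) = 57600 * (N ^ 3 * S ^ 3) := by ring
  have a5 : (20 * (10 * S)) * (60 * (N * N * S)) * (2 * (N * S)) = 24000 * (N ^ 3 * S ^ 3) := by ring
  unfold opTime
  omega

theorem wp_binP {inp S N lim s E r stk X Y a o a' o' c} {x y : ℤ}
    (hR : Ready S N lim s E r (stk ++ [X, Y])) (hX : ListOk X x a o) (hY : ListOk Y y a' o')
    (ha : a + a' ≤ S) (ho : o + o' ≤ r) (hr : r < N) (hN : N ≤ S) (h74 : s.reg 74 = c)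
    (hc : 2 ≤ c) (hc' : c < 6) (h75 : s.reg 75 = 2) (h66 : s.reg 66 = 0) :
    wp inp binP (fun s' => ∃ E', Ready S N lim s' E' (r + 1) stk ∧ s'.reg 90 = s.reg 90 ∧
      s'.tm + 20 ≤ s.tm + opTime S N ∧
      ((s'.reg 66 = 0 ∧ ∃ L v, opVal c x y = some v ∧ ListOk L v (a + a') (o + o' + 1) ∧
          HeapList s'.arr E' (s'.reg 64) (s'.reg 65) L ∧ s'.reg 65 ≤ s'.reg 2) ∨
        (s'.reg 66 = 1 ∧ opVal c x y = none))) s := by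
  simp only [binP, wp_seq]
  refine wp_mono (wp_popP hR) ?_
  rintro s1 ⟨hR1, hX1, hY1, hX1', hY1', hreg1, ht1⟩
  -- With `w = S + 4 + 3 * r` and `r < N ≤ S`, the required `2 * w + 4 < 32 * S` holds.
  refine wp_mono (wp_closeThreeP hR1.good (by omega) hR1.size hR1.unset) ?_
  rintro s2 ⟨E2, hg2, hG2, hs2, hl2, hu2, ht2⟩
  have hT := opTime_bound hr hN
  have hU : r * S ≤ N * S := Nat.mul_le_mul_right _ hr.le
  have hr1 : (r + 1) * (3 * (1 + N * S) + S) = r * (3 * (1 + N * S) + S) + (3 * (1 + N * S) + S) := by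
    ring
  have hrS : (r + 1) * S = r * S + S := by ring
  have k66 : s2.reg 66 = 0 := by rw [hg2.reg 66 (by omega), hreg1 66 (by omega), h66]
  have k74 : s2.reg 74 = c := by rw [hg2.reg 74 (by omega), hreg1 74 (by omega), h74]
  have k75 : s2.reg 75 = 2 := by rw [hg2.reg 75 (by omega), hreg1 75 (by omega), h75]
  have k90 : s2.reg 90 = s.reg 90 := by rw [hg2.reg 90 (by omega), hreg1 90 (by omega)]
  have k60 := hg2.reg 60 (by omega)
  have k61 := hg2.reg 61 (by omega)
  have k62 := hg2.reg 62 (by omega)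
  have k63 := hg2.reg 63 (by omega)
  have hhp := hg2.hp
  have hc2 := hG2.consts
  have hXw : X.length ≤ S := hX.len.trans (by omega)
  simp only [opP, wp_seq, wp_ifLt, wp_sub, wp_mov]
  refine ⟨fun h => ?_, fun h => ?_⟩
  · simp [k74, hc2.three] at h
    simp [k74, hc2.three, hc2.one]
    obtain ⟨flip, hflip, hop⟩ : ∃ flip : Bool, c - 3 - 1 = (if flip then 1 else 0) ∧
        opVal c x y = shift x (sgn flip * y) := by
      obtain rfl | rfl : c = 4 ∨ c = 5 := by omega
      · exact ⟨false, by simp, by simp [opVal]⟩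
      · exact ⟨true, by simp, by simp [opVal]⟩
    have hq : Quiet 55 s2 ((s2.tick.set 54 (c - 3)).set 54 (c - 3 - 1)) := by
      repeat' (first | exact Quiet.refl _ _ | refine Quiet.of_tick ?_ |
          refine Quiet.of_set ?_ (by norm_num) (by norm_num))
    have H : ShiftHyp ((s2.tick.set 54 (c - 3)).set 54 (c - 3 - 1)) E E2 (sgn flip * y) X Y flip
        (a + o) := by
      refine ⟨hq.frame.pool hG2.pool, hq.consts hc2, by simpa using hG2.size, hg2.pre, hs2,
        ?_, ?_, ?_, ?_, hX.naf, hY.naf, by simpa using hflip, by rw [hY.val], hX.wt⟩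
      · simpa [k60, k61] using hX1.congr (fun q hq => hg2.heap q (by omega)) (List.prefix_refl _)
      · simpa [k62, k63] using hY1.congr (fun q hq => hg2.heap q (by omega)) (List.prefix_refl _)
      · simp [k61]; omega
      · simp [k63]; omega
    refine wp_mono (wp_shiftP H) ?_
    rintro s3 ⟨E3, hg3, hl3, hnew, hsu, hres, ht3⟩
    have hg : Grow 91 E E3 s1 s3 := (hg2.weaken (k' := 91) (by norm_num)).trans
      (((hq.frame.grow hG2.pool hG2.size).weaken (k' := 91) (by norm_num)).trans
        (hg3.weaken (k' := 91) (by norm_num)) le_rfl) le_rfl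
    -- The expansion of a shifted exponent is at most as long as those of the exponent and of `y`
    -- together.
    have hwt : ∀ z ∈ X, Wt ((z.1 : ℤ) + sgn flip * y) (a + o + a') := fun z hz =>
      (hX.wt z hz).add ⟨Y, hY.naf, hY.val, hY.len⟩ flip
    refine ⟨E3, hR1.grow (r' := r + 1) hg ⟨hg3.pool, hg3.consts H.consts, hg3.size, fun e he => ?_,
      fun e he => hg3.hasSucc (hG2.low e he)⟩ (by omega) ?_, ?_, ?_, ?_⟩
    · rcases hnew e he with h | ⟨z, hz, h⟩
      · exact (hG2.wt e h).mono (by omega)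
      · rw [h]
        exact (hwt z hz).mono (by omega)
    -- The shift changes no successor of the old pool and appends at most `X.length ≤ S` exponents,
    -- so the number of unknown successors rises by at most `S`.
    · rw [unset_add (Nat.zero_le _) hg3.pre.length_le, unset_congr hsu]
      have := unset_le (A := s3.arr) (a := E2.length) (b := E3.length)
      simp only [St.set_arr, St.tick_arr]
      omega
    · rw [hg3.reg 90 (by omega)]; simpa using k90
    · have h1 : 20 * (a + o + Y.length + 7) * (E2.length + X.length + Y.length + 3) *
          (X.length + 1) ≤ 20 * (3 * S + 7) *
          (32 * S + 1 + (r + 1) * (3 * (1 + N * S) + S) + 2 * S + 3) * (S + 1) := by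
        have := hY.len
        exact Nat.mul_le_mul (Nat.mul_le_mul (by omega) (by omega)) (by omega)
      simp at ht3
      omega
    · rcases hres with ⟨h66', z, hz, hzy⟩ | ⟨h66', hnn, hL3, hle3⟩
      · refine Or.inr ⟨h66', ?_⟩
        rw [hop, ← hX.val]
        exact shift_val_eq_none hX.naf hz hzy
      · refine Or.inl ⟨h66', shiftList (sgn flip * y) X, _, ?_, ⟨isNaf_shiftList hX.naf hnn, rfl,
          by simp [shiftList]; have := hX.len; omega, fun z hz => ?_⟩, hL3, hle3⟩
        · rw [hop, ← hX.val]
          exact shift_val _ hnn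
        · obtain ⟨z', hz', rfl⟩ := List.mem_map.1 hz
          simp only
          rw [Int.toNat_of_nonneg (hnn z' hz')]
          exact (hwt z' hz').mono (by omega)
  · simp [k74, hc2.three] at h
    simp [k74, k75]
    obtain ⟨flip, hflip, hop⟩ : ∃ flip : Bool, c - 2 = (if flip then 1 else 0) ∧
        opVal c x y = some (x + sgn flip * y) := by
      obtain rfl | rfl : c = 2 ∨ c = 3 := by omega
      · exact ⟨false, by simp, by simp [opVal]⟩
      · exact ⟨true, by simp, by simp [opVal, sub_eq_add_neg]⟩
    generalize hs' : (((((s2.tick.set 54 (c - 2)).set 50 (s2.reg 60)).set 51 (s2.reg 61)).set 52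
      (s2.reg 62)).set 53 (s2.reg 63)) = s3
    have hq : Quiet 55 s2 s3 := by
      rw [← hs']
      repeat' (first | exact Quiet.refl _ _ | refine Quiet.of_tick ?_ |
          refine Quiet.of_set ?_ (by norm_num) (by norm_num))
    refine wp_mono (wp_addP (E := E2) (flip := flip) (L := X) (M := Y) (hq.frame.pool hG2.pool)
      (hq.consts hc2) ?_ ?_ ?_ ?_ hX.naf hY.naf ?_ ?_) ?_
    · simpa [← hs', k60, k61] using hg2.heapList hX1 hX1'
    · simpa [← hs', k62, k63] using hg2.heapList hY1 hY1'
    · simp [← hs', k61]; omega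
    · simp [← hs', k63]; omega
    · simpa [← hs'] using hflip
    · rw [hq.arr]
      rintro z (hz | hz)
      · exact hs2 _ (mem_of_heapList hX1 hz)
      · exact hs2 _ (mem_of_heapList hY1 hz)
    · rintro s4 ⟨hf4, hL4, hle4, ht4⟩
      have hf : Frame 70 s2 ((s4.set 64 (s4.reg 50)).set 65 (s4.reg 51)) := by
        have := (hq.frame.weaken (k' := 70) (by norm_num)).trans (hf4.weaken (k' := 70)
          (by norm_num)) le_rfl
        repeat' (first | exact this | refine Frame.of_set ?_ (by norm_num) (by norm_num))
      have hg : Grow 91 E E2 s1 _ := (hg2.weaken (k' := 91) (by norm_num)).trans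
        ((hf.weaken (k' := 91) (by norm_num)).grow hG2.pool hG2.size) le_rfl
      have k3 : s3.tm = s2.tm + 6 := by rw [← hs']; simp
      refine ⟨E2, hR1.grow (r' := r + 1) hg ?_ (by omega) ?_, ?_, ?_, Or.inl ⟨?_,
        addList flip X Y, _, hop, ⟨isNaf_addList hX.naf, ?_, ?_, fun z hz => ?_⟩, ?_, ?_⟩⟩
      · exact hG2.frame hf
      · rw [unset_congr (A := s2.arr) fun i _ => by rw [hf.arr 3 (by omega) (by omega)]]
        omega
      · simpa using (hf.reg 90 (by omega)).trans k90
      · have h1 : 20 * (X.length + Y.length + 2) * (Y.length + 1) ≤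
            20 * (3 * S + 7) * 1 * (S + 1) := by
          have := hY.len
          have := hX.len
          exact Nat.mul_le_mul (by omega) (by omega)
        have h2 : 20 * (3 * S + 7) * 1 * (S + 1) ≤ 20 * (3 * S + 7) *
          (32 * S + 1 + (r + 1) * (3 * (1 + N * S) + S) + 2 * S + 3) * (S + 1) :=
          Nat.mul_le_mul_right _ (Nat.mul_le_mul_left _ (by omega))
        simp
        omega
      · rw [hf4.reg 66 (by omega), hq.reg 66 (by omega), k66]
      · rw [val_addList, hX.val, hY.val]
      · have := length_addList flip X Y
        have := hX.len
        have := hY.len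
        omega
      · obtain ⟨u, hu, hzu⟩ := mem_addList hX.naf hY.naf hz
        have hw : Wt (u.1 : ℤ) (a + a' + (o + o')) := by
          rcases hu with hu | hu
          · exact (hX.wt u hu).mono (by omega)
          · exact (hY.wt u hu).mono (by omega)
        rcases hzu with h | h
        · rw [h]; exact hw.mono (by omega)
        · rw [h]; push_cast; exact hw.add_one
      · simpa using hL4
      · simpa using hle4

/-- Process one symbol of a term in postfix notation. -/
def evalBody : Prog :=
  .read 74 90 0 ;; .inc 90 1 ;; .const 66 0 ;; .const 75 2 ;; .const 76 6 ;;
  .ifLt 74 75 (.ifEq 74 0 zeroP oneP) (.ifLt 74 76 binP varP) ;; finishP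

theorem wp_leaf_finish {inp S N lim s E r stk p v a m} (hR : Ready S N lim s E r stk)
    (h66 : s.reg 66 = 0) (hp : wp inp p (fun s' => ∃ L, Leaf s E s' L ∧ ListOk L v a 0 ∧
      s'.tm ≤ s.tm + m) s) :
    wp inp p (fun s' => wp inp finishP (fun s' => ∃ L, Ready S N lim s' E r (stk ++ [L]) ∧
      ListOk L v a 0 ∧ s'.reg 90 = s.reg 90 ∧ s'.tm ≤ s.tm + m + 4) s') s := by
  refine wp_mono hp ?_
  rintro s1 ⟨L, hL, hv, ht⟩
  refine wp_mono (wp_finishP (hR.frame (hL.frame.weaken (by norm_num))) (by rw [hL.flag, h66])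
    hL.list hL.le) ?_
  rintro s2 ⟨hR2, h90, ht2⟩
  exact ⟨L, hR2, hv, by rw [h90, hL.frame.reg 90 (by norm_num)], by omega⟩

theorem getD_append_cons (A B : List ℕ) (c : ℕ) : (A ++ c :: B).getD A.length 0 = c := by
  simp [List.getD_eq_getElem?_getD]

/-- The value of the term `t` is computed by the loop that processes the input. -/
def EvalSpec {k : ℕ} (η : Fin k → ℤ) (inp : List ℕ) (S N lim : ℕ) (t : ExpTerm k) : Prop :=
  ∀ (s : St) (E : List ℕ) (r : ℕ) (stk : List (List (ℕ × Bool))) (pre post : List ℕ)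
    (Q : St → Prop), Ready S N lim s E r stk → inp = pre ++ t.tokens ++ post →
    s.reg 90 = pre.length → pre.length + t.tokens.length ≤ lim → t.weight η ≤ S →
    r + t.numOps < N →
    (∀ s' E' L v, t.eval η = some v → Ready S N lim s' E' (r + t.numOps) (stk ++ [L]) →
      ListOk L v (t.weight η) t.numOps → s'.reg 90 = pre.length + t.tokens.length →
      s'.tm ≤ s.tm + t.numOps * opTime S N + t.weight η * (20 * S + 30) →
      wp inp (.loop 90 91 evalBody) Q s') →
    (∀ s', t.eval η = none → Failed lim s' →
      s'.tm ≤ s.tm + t.numOps * opTime S N + t.weight η * (20 * S + 30) →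
      wp inp (.loop 90 91 evalBody) Q s') →
    wp inp (.loop 90 91 evalBody) Q s

section EvalSpec

variable {k : ℕ} {η : Fin k → ℤ} {inp : List ℕ} {S N lim : ℕ}

theorem wp_evalBody {s E r stk c Q} (hR : Ready S N lim s E r stk)
    (hc : inp.getD (s.reg 90) 0 = c)
    (h : ∀ s1, Ready S N lim s1 E r stk → s1.reg 74 = c → s1.reg 75 = 2 → s1.reg 76 = 6 →
      s1.reg 66 = 0 → s1.reg 90 = s.reg 90 + 1 → s1.tm ≤ s.tm + 8 →
      (c = 0 → wp inp zeroP (fun s' => wp inp finishP Q s') s1) ∧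
      (c = 1 → wp inp oneP (fun s' => wp inp finishP Q s') s1) ∧
      (2 ≤ c → c < 6 → wp inp binP (fun s' => wp inp finishP Q s') s1) ∧
      (6 ≤ c → wp inp varP (fun s' => wp inp finishP Q s') s1)) :
    wp inp evalBody Q s.tick := by
  have hz := hR.good.consts.zero
  simp only [evalBody, wp_seq, wp_read, wp_inc, wp_const]
  generalize hs1 : ((((s.tick.set 74 (inp.getD (s.tick.reg 90 + s.tick.reg 0) 0)).set 90
    ((s.tick.set 74 (inp.getD (s.tick.reg 90 + s.tick.reg 0) 0)).reg 90 + 1)).set 66 0).set 75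
    2).set 76 6 = s1
  have hf : Frame 91 s s1 := by
    rw [← hs1]
    repeat' (first | exact Frame.refl _ _ | refine Frame.of_tick ?_ |
      refine Frame.of_set ?_ (by norm_num) (by norm_num))
  have h74 : s1.reg 74 = c := by
    simp [-List.getD_eq_getElem?_getD, ← hs1, hz, hc]
  have h75 : s1.reg 75 = 2 := by simp [← hs1]
  have h76 : s1.reg 76 = 6 := by simp [← hs1]
  have h66 : s1.reg 66 = 0 := by simp [← hs1]
  have h90 : s1.reg 90 = s.reg 90 + 1 := by simp [← hs1]
  have h0 : s1.reg 0 = 0 := by rw [hf.reg 0 (by omega), hz]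
  have htm : s1.tm = s.tm + 6 := by simp [← hs1]
  have hf2 : Frame 91 s s1.tick.tick := hf.of_tick.of_tick
  have key := h s1.tick.tick (hR.frame hf2) h74 h75 h76 h66 h90 (by simp; omega)
  simp only [wp_ifLt, wp_ifEq, St.tick_reg, h74, h75, h76, h0]
  refine ⟨fun hlt => ⟨fun h' => key.1 h', fun h' => key.2.1 (by omega)⟩,
    fun hlt => ⟨fun h' => key.2.2.1 (by omega) h', fun h' => key.2.2.2 (by omega)⟩⟩

/-- `EvalSpec` is in continuation style: `Q` is an arbitrary postcondition of the whole loop, and it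
suffices to establish it for the loop restarted behind the symbols of `t`. In this way one loop
serves all subterms, and a leaf accounts for a single pass. -/
theorem EvalSpec.leaf {t : ExpTerm k} {c : ℕ} {v : ℤ} (ht : t.tokens = [c]) (he : t.eval η = some v)
    (h0 : t.numOps = 0) (hp : ∀ s E r stk, Ready S N lim s E r stk →
      inp.getD (s.reg 90) 0 = c → t.weight η ≤ S → wp inp evalBody (fun s' => ∃ L,
        Ready S N lim s' E r (stk ++ [L]) ∧ ListOk L v (t.weight η) 0 ∧
        s'.reg 90 = s.reg 90 + 1 ∧ s'.tm ≤ s.tm + t.weight η * (20 * S + 30)) s.tick) :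
    EvalSpec η inp S N lim t := by
  intro s E r stk pre post Q hR hinp hpos hlim hS hr hok _
  rw [ht] at hinp hlim
  simp at hlim
  rw [wp_loop_unfold]
  refine ⟨fun _ => ?_, fun h => absurd ?_ h⟩
  · refine wp_mono (hp s E r stk hR ?_ hS) ?_
    · rw [hinp, hpos]; simp
    · rintro s' ⟨L, h1, h2, h3, h4⟩
      refine hok s' E L v he (by rw [h0]; exact h1) (by rw [h0]; exact h2) ?_ (by rw [h0]; omega)
      rw [h3, hpos, ht]; simp
  · rw [hR.lim, hpos]; omega

theorem evalSpec_zero : EvalSpec η inp S N lim .zero := by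
  refine EvalSpec.leaf (c := 0) (v := 0) rfl rfl rfl fun s E r stk hR hc hS => ?_
  refine wp_evalBody hR hc fun s1 hR1 _ _ _ h66 h90 htm => ⟨fun _ => ?_, by omega, by omega, by omega⟩
  refine wp_mono (wp_leaf_finish hR1 h66 wp_zeroP) fun s' h => wp_mono h ?_
  rintro s2 ⟨L, h1, h2, h3, h4⟩
  exact ⟨L, h1, h2, by rw [h3, h90], by simp only [ExpTerm.weight]; omega⟩

theorem evalSpec_one : EvalSpec η inp S N lim .one := by
  refine EvalSpec.leaf (c := 1) (v := 1) rfl rfl rfl fun s E r stk hR hc hS => ?_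
  refine wp_evalBody hR hc fun s1 hR1 _ _ _ h66 h90 htm => ⟨by omega, fun _ => ?_, by omega, by omega⟩
  refine wp_mono (wp_leaf_finish hR1 h66 (wp_oneP hR1.good)) fun s' h => wp_mono h ?_
  rintro s2 ⟨L, h1, h2, h3, h4⟩
  exact ⟨L, h1, h2, by rw [h3, h90], by simp only [ExpTerm.weight]; omega⟩

theorem evalSpec_var (x : Fin k) (hx : NumeralAt inp (lim + x) (η x)) :
    EvalSpec η inp S N lim (.var x) := by
  refine EvalSpec.leaf (c := 6 + x) (v := η x) rfl rfl rfl fun s E r stk hR hc hS => ?_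
  refine wp_evalBody hR hc fun s1 hR1 h74 h75 h76 h66 h90 htm =>
    ⟨by omega, by omega, by omega, fun _ => ?_⟩
  have hb := length_bits_le (η x).natAbs
  simp only [ExpTerm.weight] at hS ⊢
  refine wp_mono (wp_leaf_finish hR1 h66 (by
    simpa only [add_assoc] using wp_varP (p := x) (n := η x) hR1.good (fun i hi => hR1.index (by omega))
      (by omega) (by rwa [hR1.lim]) h74 h76)) fun s' h => wp_mono h ?_
  rintro s2 ⟨L, h1, h2, h3, h4⟩
  refine ⟨L, h1, h2, by rw [h3, h90], ?_⟩
  have h5 : 20 * ((η x).natAbs.bits.length + 2) * (η x).natAbs.bits.length ≤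
      20 * S * (Nat.clog 2 ((η x).natAbs + 1) + 2) := Nat.mul_le_mul (by omega) (by omega)
  have h6 : (Nat.clog 2 ((η x).natAbs + 1) + 2) * (20 * S + 30) =
      20 * S * (Nat.clog 2 ((η x).natAbs + 1) + 2) +
      30 * (Nat.clog 2 ((η x).natAbs + 1) + 2) := by ring
  omega

/-- In postfix order the two subterms leave their lists on top of the stack, and one more pass
combines them. A failure in a subterm or in the operation moves the position to the end of the loop,
in agreement with the propagation of `none` by `bind`. -/
theorem EvalSpec.bin {t u w : ExpTerm k} {c : ℕ} (ht : EvalSpec η inp S N lim t)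
    (hu : EvalSpec η inp S N lim u) (hN : N ≤ S) (hc : 2 ≤ c) (hc' : c < 6)
    (htok : w.tokens = t.tokens ++ u.tokens ++ [c])
    (he : w.eval η = (t.eval η).bind fun a => (u.eval η).bind fun b => opVal c a b)
    (hw : w.weight η = t.weight η + u.weight η) (ho : w.numOps = t.numOps + u.numOps + 1) :
    EvalSpec η inp S N lim w := by
  intro s E r stk pre post Q hR hinp hpos hlim hS hr hok hbad
  rw [htok] at hinp hlim
  simp at hlim
  have hT : w.numOps * opTime S N + w.weight η * (20 * S + 30) =
      t.numOps * opTime S N + t.weight η * (20 * S + 30) +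
      (u.numOps * opTime S N + u.weight η * (20 * S + 30)) + opTime S N := by
    rw [ho, hw]; ring
  refine ht s E r stk pre (u.tokens ++ [c] ++ post) Q hR (by rw [hinp]; simp) hpos (by omega)
    (by omega) (by omega) ?_ ?_
  · intro s1 E1 L x hx hR1 hL h90 ht1
    refine hu s1 E1 _ _ (pre ++ t.tokens) ([c] ++ post) Q hR1 (by rw [hinp]; simp) (by simpa using h90)
      (by simp; omega) (by omega) (by omega) ?_ ?_
    · intro s2 E2 M y hy hR2 hM h90' ht2
      simp at h90'
      rw [wp_loop_unfold]
      refine ⟨fun _ => ?_, fun h => absurd ?_ h⟩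
      · refine wp_evalBody (c := c) hR2 ?_ fun s3 hR3 h74 h75 _ h66 h90'' htm =>
          ⟨by omega, by omega, fun _ _ => ?_, by omega⟩
        · rw [hinp, h90']
          rw [show pre ++ (t.tokens ++ u.tokens ++ [c]) ++ post =
            (pre ++ t.tokens ++ u.tokens) ++ c :: post by simp,
            show pre.length + t.tokens.length + u.tokens.length =
              (pre ++ t.tokens ++ u.tokens).length by simp; ring]
          exact getD_append_cons _ _ _
        · rw [List.append_assoc] at hR3
          refine wp_mono (wp_binP (o := t.numOps) (o' := u.numOps) hR3 hL hM (by omega) (by omega)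
            (by omega) hN h74 hc hc' h75 h66) ?_
          rintro s4 ⟨E4, hR4, h90₄, ht4, (⟨h66', Z, v, hv, hZ, hZl, hle⟩ | ⟨h66', hv⟩)⟩
          · refine wp_mono (wp_finishP hR4 h66' hZl hle) ?_
            rintro s5 ⟨hR5, h90₅, ht5⟩
            refine hok s5 E4 Z v ?_ ?_ (by rw [hw, ho]; exact hZ) ?_ ?_
            · rw [he, hx, hy]; exact hv
            · rw [ho, show r + (t.numOps + u.numOps + 1) = r + t.numOps + u.numOps + 1 by ring]
              exact hR5
            · rw [h90₅, h90₄, h90'', h90', htok]; simp; ring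
            · omega
          · refine wp_mono (wp_finishP_failed hR4.good.consts h66' hR4.lim hR4.out) ?_
            rintro s5 ⟨hF, ht5⟩
            refine hbad s5 ?_ hF ?_
            · rw [he, hx, hy]; exact hv
            · omega
      · rw [hR2.lim, h90']; omega
    · intro s2 hy hF ht2
      refine hbad s2 ?_ hF (by omega)
      rw [he, hx, hy]; rfl
  · intro s1 hx hF ht1
    refine hbad s1 ?_ hF (by omega)
    rw [he, hx]; rfl

theorem evalSpec (hN : N ≤ S) (hη : ∀ x : Fin k, NumeralAt inp (lim + x) (η x)) (t : ExpTerm k) :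
    EvalSpec η inp S N lim t := by
  induction t with
  | zero => exact evalSpec_zero
  | one => exact evalSpec_one
  | var x => exact evalSpec_var x (hη x)
  | add t u ht hu => exact ht.bin hu hN (c := 2) (by norm_num) (by norm_num) rfl rfl rfl rfl
  | sub t u ht hu => exact ht.bin hu hN (c := 3) (by norm_num) (by norm_num) rfl rfl rfl rfl
  | mulPow t u ht hu => exact ht.bin hu hN (c := 4) (by norm_num) (by norm_num) rfl rfl rfl rfl
  | divPow t u ht hu => exact ht.bin hu hN (c := 5) (by norm_num) (by norm_num) rfl rfl rfl rfl

end EvalSpec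

/-! ### The weight of the input and the initial pool -/

theorem length_bits_eq (n : ℕ) : n.bits.length = Nat.clog 2 (n + 1) :=
  le_antisymm (length_bits_le n) (Nat.clog_le_of_le_pow (lt_two_pow_length_bits n))

/-- The weight of a symbol, computed from the input. -/
def symbolWeight (inp : List ℕ) (lim c : ℕ) : ℕ :=
  if c < 2 then c + 1 else if c < 6 then 0 else inp.getD (inp.getD (lim + (c - 6)) 0 + 1) 0 + 2

theorem sum_symbolWeight {k : ℕ} {η : Fin k → ℤ} {inp : List ℕ} {lim : ℕ}
    (hη : ∀ x : Fin k, NumeralAt inp (lim + x) (η x)) (t : ExpTerm k) :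
    (t.tokens.map (symbolWeight inp lim)).sum = t.weight η := by
  induction t with
  | zero => rfl
  | one => rfl
  | var x =>
    obtain ⟨a, h1, -, h3, -⟩ := hη x
    simp only [ExpTerm.tokens, ExpTerm.weight, List.map_cons, List.map_nil, List.sum_cons,
      List.sum_nil, symbolWeight]
    rw [if_neg (by omega), if_neg (by omega), show 6 + (x : ℕ) - 6 = x by omega, h1, h3,
      length_bits_eq]
    omega
  | add t u ht hu | sub t u ht hu | mulPow t u ht hu | divPow t u ht hu =>
    simp [ExpTerm.tokens, ExpTerm.weight, ht, hu, symbolWeight]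

def lenBody : Prog := .inc 79 1 ;; .inc 85 32

/-- Register `85` accumulates `32` times the weight by increments of `32` and `64`, as neither
multiplication nor large constants are at hand: one unit for `0`, two for `1`, and two plus the bit
length for a variable. -/
def scanBody : Prog :=
  .read 74 90 0 ;; .inc 90 1 ;;
  .ifLt 74 75 (.inc 85 32 ;; .ifEq 74 0 (.mov 86 0) (.inc 85 32))
    (.ifLt 74 76 (.mov 86 0)
      (.inc 85 64 ;; .sub 77 74 76 ;; .read 77 91 77 ;; .read 78 77 3 ;; .const 79 0 ;;
        .loop 79 78 lenBody))

def startP : Prog :=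
  .const 3 1 ;; .const 4 3 ;; .const 1 1 ;; .read 91 0 0 ;; .inc 91 1 ;; .const 90 1 ;;
  .const 75 2 ;; .const 76 6 ;; .loop 90 91 scanBody ;; .const 40 0

def buildBody : Prog := succP ;; .inc 40 1

/-- Initialize the pool. -/
def initP : Prog := startP ;; .loop 40 85 buildBody ;; .const 90 1

def St.zero : St := ⟨fun _ => 0, fun _ _ => 0, [], 0⟩

structure ScanInv (inp l : List ℕ) (lim : ℕ) (n : ℕ) (s : St) : Prop where
  arr : s.arr = fun _ _ => 0
  out : s.out = []
  reg : s.reg 0 = 0 ∧ s.reg 1 = 1 ∧ s.reg 2 = 0 ∧ s.reg 3 = 1 ∧ s.reg 4 = 3 ∧ s.reg 75 = 2 ∧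
    s.reg 76 = 6 ∧ s.reg 91 = lim ∧ s.reg 92 = 0 ∧ s.reg 93 = 0
  pos : 1 ≤ s.reg 90
  le : s.reg 90 ≤ 1 + l.length
  weight : s.reg 85 = 32 * ((l.take (s.reg 90 - 1)).map (symbolWeight inp lim)).sum
  time : s.tm + 20 * ((l.drop (s.reg 90 - 1)).map fun c => symbolWeight inp lim c + 1).sum ≤ n

theorem wp_len {inp : List ℕ} {s : St} {Q : St → Prop} (h79 : s.reg 79 = 0)
    (h : ∀ s1, s1.arr = s.arr → s1.out = s.out → (∀ r, r ≠ 79 → r ≠ 85 → s1.reg r = s.reg r) →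
      s1.reg 85 = s.reg 85 + 32 * s.reg 78 → s1.tm ≤ s.tm + 3 * s.reg 78 + 1 → Q s1) :
    wp inp (.loop 79 78 lenBody) Q s := by
  refine wp_loop (fun s1 => s1.arr = s.arr ∧ s1.out = s.out ∧
    (∀ r, r ≠ 79 → r ≠ 85 → s1.reg r = s.reg r) ∧ s1.reg 79 ≤ s.reg 78 ∧
    s1.reg 85 = s.reg 85 + 32 * s1.reg 79 ∧ s1.tm ≤ s.tm + 3 * s1.reg 79)
    (fun s1 => s1.reg 78 - s1.reg 79) ?_ ?_ ?_
  · simp [h79]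
  · rintro s1 ⟨h1, h2, h3, h4, h5, h6⟩ hlt
    have h78 := h3 78 (by norm_num) (by norm_num)
    simp only [lenBody, wp_seq, wp_inc]
    refine ⟨⟨by simpa, by simpa, fun r hr hr' => by simp [hr, hr', h3 r hr hr'], by simp; omega,
      by simp; omega, by simp; omega⟩, by simp; omega⟩
  · rintro s1 ⟨h1, h2, h3, h4, h5, h6⟩ hlt
    have h78 := h3 78 (by norm_num) (by norm_num)
    have h79' : s1.reg 79 = s.reg 78 := by omega
    rw [h79'] at h5 h6
    exact h _ h1 h2 h3 h5 (by simp; omega)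

theorem wp_scanBody {inp l : List ℕ} {lim n : ℕ} {s : St} (hl : ∃ post, inp = (lim - 1) :: l ++ post)
    (hlim : lim = 1 + l.length)
    (hI : ScanInv inp l lim n s) (hlt : s.reg 90 < s.reg 91) :
    wp inp scanBody (fun s2 => ScanInv inp l lim n s2 ∧
      s2.reg 91 - s2.reg 90 < s.reg 91 - s.reg 90) s.tick := by
  obtain ⟨harr, hout, ⟨h0, h1, h2, h3, h4, h75, h76, h91, h92, h93⟩, hpos, hle, hw, ht⟩ := hI
  obtain ⟨post, hinp⟩ := hl
  obtain ⟨q, hq⟩ : ∃ q, s.reg 90 = 1 + q := ⟨s.reg 90 - 1, by omega⟩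
  have hql : q < l.length := by omega
  obtain ⟨c, hc⟩ : ∃ c, l[q]? = some c := ⟨_, List.getElem?_eq_getElem hql⟩
  have hread : inp.getD (s.reg 90) 0 = c := by
    rw [hinp, hq, add_comm]
    simp [List.getElem?_append_left hql, hc]
  have htake : l.take (q + 1) = l.take q ++ [c] := by rw [List.take_add_one, hc]; rfl
  have hdrop : l.drop q = c :: l.drop (q + 1) := by
    rw [List.drop_eq_getElem_cons hql]
    simp [List.getElem?_eq_getElem hql] at hc
    rw [hc]
  rw [hq] at hw ht
  simp only [Nat.add_sub_cancel_left, hdrop, List.map_cons, List.sum_cons] at hw ht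
  have fin : ∀ s2 : St, s2.arr = s.arr → s2.out = s.out →
      (∀ r, (r ≤ 4 ∨ r = 75 ∨ r = 76 ∨ 91 ≤ r) → s2.reg r = s.reg r) → s2.reg 90 = s.reg 90 + 1 →
      s2.reg 85 = s.reg 85 + 32 * symbolWeight inp lim c →
      s2.tm ≤ s.tm + 20 * (symbolWeight inp lim c + 1) → ScanInv inp l lim n s2 := by
    intro s2 g1 g2 g3 g4 g5 g6
    refine ⟨g1.trans harr, g2.trans hout, ?_, by omega, by omega, ?_, ?_⟩
    · simp [g3, h0, h1, h2, h3, h4, h75, h76, h91, h92, h93]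
    · rw [g4, hq, g5, hw, show 1 + q + 1 - 1 = q + 1 by omega, htake]
      simp
      ring
    · rw [g4, hq, show 1 + q + 1 - 1 = q + 1 by omega]
      omega
  simp only [scanBody, wp_seq, wp_read, wp_inc, wp_ifLt, wp_ifEq, wp_mov, wp_const, wp_sub]
  simp [-List.getD_eq_getElem?_getD, h0, hread, h75, h76, h91, h3]
  refine ⟨fun hc2 => ⟨fun hc0 => ?_, fun hc0 => ?_⟩, fun hc2 => ⟨fun hc6 => ?_, fun hc6 => ?_⟩⟩
  · refine ⟨fin _ rfl rfl (fun r hr => ?_) ?_ ?_ ?_, by omega⟩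
    · simp [show r ≠ 86 by omega, show r ≠ 85 by omega, show r ≠ 90 by omega, show r ≠ 74 by omega]
    · simp
    · simp [symbolWeight, hc0]
    · simp; omega
  · obtain rfl : c = 1 := by omega
    refine ⟨fin _ rfl rfl (fun r hr => ?_) ?_ ?_ ?_, by omega⟩
    · simp [show r ≠ 85 by omega, show r ≠ 90 by omega, show r ≠ 74 by omega]
    · simp
    · simp [symbolWeight]
    · simp; omega
  · refine ⟨fin _ rfl rfl (fun r hr => ?_) ?_ ?_ ?_, by omega⟩
    · simp [show r ≠ 86 by omega, show r ≠ 90 by omega, show r ≠ 74 by omega]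
    · simp
    · simp [symbolWeight, show ¬ c < 2 by omega, hc6]
    · simp; omega
  · have hsw : symbolWeight inp lim c = inp.getD (inp.getD (lim + (c - 6)) 0 + 1) 0 + 2 := by
      rw [symbolWeight, if_neg (by omega), if_neg (by omega)]
    refine wp_len (by simp) fun s1 g1 g2 g3 g4 g5 =>
      ⟨fin s1 g1 g2 (fun r hr => ?_) ?_ ?_ ?_, ?_⟩
    · rw [g3 r (by omega) (by omega)]
      simp [show r ≠ 79 by omega, show r ≠ 78 by omega, show r ≠ 77 by omega, show r ≠ 85 by omega, show r ≠ 90 by omega, show r ≠ 74 by omega]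
    · rw [g3 90 (by omega) (by omega)]; simp
    · rw [g4, hsw]; simp [-List.getD_eq_getElem?_getD]; ring
    · rw [hsw]; simp [-List.getD_eq_getElem?_getD] at g5; omega
    · rw [g3 91 (by omega) (by omega), g3 90 (by omega) (by omega)]; simp [h91]; omega

/-- At this stage the index of an exponent is the exponent itself, and all but the last exponent
have their successors recorded. -/
structure BuildInv (K n T : ℕ) (s0 s : St) : Prop where
  grow : Grow 41 [0] (List.range (s.reg 40 + 1)) s0 s
  le : s.reg 40 ≤ K
  succ : ∀ i < s.reg 40, s.arr 3 i ≠ 0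
  time : s.tm + T * (K - s.reg 40) ≤ n

theorem wp_buildBody {inp : List ℕ} {S n : ℕ} {s0 s : St} (hc : Consts s0) (hK : s0.reg 85 = 32 * S)
    (hI : BuildInv (32 * S) n (20 * (S + 10) * (32 * S + 3)) s0 s) (hlt : s.reg 40 < s.reg 85) :
    wp inp buildBody (fun s2 => BuildInv (32 * S) n (20 * (S + 10) * (32 * S + 3)) s0 s2 ∧
      s2.reg 85 - s2.reg 40 < s.reg 85 - s.reg 40) s.tick := by
  obtain ⟨hg, hle, hsu, ht⟩ := hI
  have h85 : s.reg 85 = 32 * S := by rw [hg.reg 85 (by omega), hK]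
  have hgi : ∀ i ≤ s.reg 40, (List.range (s.reg 40 + 1))[i]? = some i := fun i hi =>
    List.getElem?_range (by omega)
  simp only [buildBody, wp_seq, wp_inc]
  refine wp_mono (wp_succP (i := s.reg 40) (e := s.reg 40) (w := S + 4) hg.of_tick.pool
    (hg.of_tick.consts hc) hg.of_tick.size rfl (hgi _ le_rfl) (Wt.natCast_of_le hle) ?_) ?_
  · intro L hL hv
    refine carryOk_of_low hL (fun x _ => Nat.zero_le _) fun k _ hk => ?_
    obtain ⟨x, hx, hkx⟩ := hk
    -- The expansion of a number involves only smaller exponents, so the carry asks only for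
    -- successors of smaller numbers, which are recorded already.
    have := lt_of_mem_naf hL hv hx
    exact ⟨k, hgi k (by omega), hsu k (by omega)⟩
  · rintro s2 ⟨E', hg2, hE', hother, hi, -, ht2⟩
    have h40 : s2.reg 40 = s.reg 40 := by rw [hg2.reg 40 (by omega)]; rfl
    have h85' : s2.reg 85 = s.reg 85 := by rw [hg2.reg 85 (by omega)]; rfl
    have hE2 : E' = List.range (s.reg 40 + 1 + 1) := by
      rw [List.range_succ (n := s.reg 40 + 1)]
      -- The successor of the largest member cannot be in the pool, so it was appended.
      refine hE'.resolve_left ?_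
      rintro rfl
      have := List.mem_of_getElem? (hg2.pool.succ (hgi _ le_rfl) hi)
      simp at this
    subst hE2
    have h5 : 20 * (S + 10) * (32 * S + 3) * (32 * S - s.reg 40) =
        20 * (S + 10) * (32 * S + 3) * (32 * S - (s.reg 40 + 1)) + 20 * (S + 10) * (32 * S + 3) := by
      rw [show 32 * S - s.reg 40 = 32 * S - (s.reg 40 + 1) + 1 by omega]; ring
    have h6 : 20 * (S + 4 + 6) * (s.reg 40 + 3) + 2 ≤ 20 * (S + 10) * (32 * S + 3) := by
      have : 20 * (S + 10) * (s.reg 40 + 3) + 20 * (S + 10) * 1 ≤ 20 * (S + 10) * (32 * S + 3) := by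
        rw [← mul_add]
        exact Nat.mul_le_mul_left _ (by omega)
      rw [show S + 4 + 6 = S + 10 by ring]
      omega
    refine ⟨⟨?_, by simp; omega, fun i hi' => ?_, ?_⟩, by simp; omega⟩
    · have := (hg.of_tick.trans (hg2.weaken (k' := 41) (by norm_num)) le_rfl).of_set (d := 40)
        (v := s2.reg 40 + 1) (by norm_num) (by norm_num)
      simpa [h40] using this
    · simp [h40] at hi' ⊢
      rcases Nat.lt_or_ge i (s.reg 40) with h | h
      · rw [hother i (by simp; omega) (by omega)]
        exact hsu i h
      · obtain rfl : i = s.reg 40 := by omega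
        exact hi
    · simp [h40] at ht2 ⊢
      rw [show s.reg 40 + 1 + 2 = s.reg 40 + 3 from rfl] at ht2
      omega

theorem wp_initP {k : ℕ} {η : Fin k → ℤ} {inp : List ℕ} {lim N : ℕ} (t : ExpTerm k)
    (hη : ∀ x : Fin k, NumeralAt inp (lim + x) (η x)) (hlim : lim = 1 + t.tokens.length)
    (hinp : ∃ post, inp = t.tokens.length :: t.tokens ++ post) :
    wp inp initP (fun s => Ready (t.weight η) N lim s (List.range (32 * t.weight η + 1)) 0 [] ∧
      s.reg 90 = 1 ∧ s.tm ≤ 300000 * t.weight η ^ 3) St.zero := by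
  obtain ⟨post, hinp⟩ := hinp
  have hsum := sum_symbolWeight hη t
  have hT := t.length_tokens
  have hN := t.numOps_lt_weight η
  generalize hS : t.weight η = S at *
  simp only [initP, startP, wp_seq, wp_const, wp_read, wp_inc]
  generalize hs0 : (((((((((St.zero.set 3 1).set 4 3).set 1 1).set 91 _).set 91 _).set 90 1).set 75
    2).set 76 6)) = s0
  refine wp_mono (Q := fun s2 => ScanInv inp t.tokens lim (20 * (S + t.tokens.length) + 9) s2 ∧
    s2.reg 90 = lim) ?_ ?_
  · refine wp_loop (ScanInv inp t.tokens lim (20 * (S + t.tokens.length) + 8))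
      (fun s => s.reg 91 - s.reg 90) ?_ (fun s1 hI hlt => wp_scanBody ⟨post, ?_⟩ hlim hI hlt) ?_
    · refine ⟨by simp [← hs0]; rfl, by simp [← hs0]; rfl, ?_, by simp [← hs0], by simp [← hs0],
        by simp [← hs0, St.zero], ?_⟩
      · simp [← hs0, hinp, hlim, St.zero]
        ring
      · rw [show s0.reg 90 = 1 by simp [← hs0], show s0.tm = 8 by simp [← hs0, St.zero]]
        simp [List.sum_map_add, hsum]
        omega
    · rw [hinp, hlim]; simp
    · rintro s1 hI hlt
      have h1 := hI.reg.2.2.2.2.2.2.2.1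
      have h2 := hI.le
      exact ⟨⟨hI.arr, hI.out, hI.reg, hI.pos, hI.le, hI.weight, by have := hI.time; rw [St.tick_tm]; simp only [St.tick_reg]; omega⟩,
        by simp; omega⟩
  · rintro s2 ⟨⟨harr, hout, ⟨h0, h1, h2, h3, h4, h75, h76, h91, h92, h93⟩, hpos, hle, hw, ht⟩, h90⟩
    rw [h90, hlim, show 1 + t.tokens.length - 1 = t.tokens.length by omega, List.take_length, ← hlim,
      hsum] at hw
    have hc : Consts (s2.set 40 0) := ⟨by simpa, by simpa, by simpa⟩
    have hP : Pool (s2.set 40 0).arr ((s2.set 40 0).reg 2) [0] := by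
      have hi : ∀ {i e : ℕ}, [0][i]? = some e → i = 0 ∧ e = 0 := by
        intro i e h
        cases i <;> simp at h ⊢
        exact h.symm
      refine ⟨rfl, by simp, fun h => ?_, fun h => ?_, fun _ h => ?_⟩
      · obtain ⟨rfl, rfl⟩ := hi h
        simp [harr]
      · obtain ⟨rfl, rfl⟩ := hi h
        refine ⟨[], ?_, isNaf_nil, by simp, by simp [harr]⟩
        simp [harr]
        exact heapList_nil _ _ _
      · simp [harr] at h
    refine wp_mono (Q := fun s3 => BuildInv (32 * S)
      (s2.tm + 20 * (S + 10) * (32 * S + 3) * (32 * S) + 2) (20 * (S + 10) * (32 * S + 3))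
      (s2.set 40 0) s3 ∧ s3.reg 40 = 32 * S) ?_ ?_
    · refine wp_loop (BuildInv (32 * S) (s2.tm + 20 * (S + 10) * (32 * S + 3) * (32 * S) + 1)
        (20 * (S + 10) * (32 * S + 3)) (s2.set 40 0)) (fun s => s.reg 85 - s.reg 40) ?_
        (fun s1 hI hlt => wp_buildBody hc (by simpa) hI hlt) ?_
      · refine ⟨?_, by simp, by simp, by simp; omega⟩
        simpa using Grow.refl 41 hP (by simpa using h1)
      · rintro s1 ⟨hg, hle, hsu, ht⟩ hlt
        rw [hg.reg 85 (by omega)] at hlt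
        simp [hw] at hlt
        exact ⟨⟨hg.of_tick, hle, hsu, by simp; omega⟩, by simp; omega⟩
    · rintro s3 ⟨⟨hg, -, hsu, ht3⟩, h40⟩
      rw [h40] at hg hsu ht3
      have hf : Frame 91 s3 (s3.set 90 1) := (Frame.refl _ _).of_set (by norm_num) (by norm_num)
      refine ⟨⟨⟨hf.pool hg.pool, hf.consts (hg.consts hc), by simpa using hg.size, fun e he => ?_,
        fun x hx => ⟨x, List.getElem?_range (by omega), hsu x hx⟩⟩, List.prefix_refl _, by simp, ?_,
        ?_, ?_, ?_, ?_, ?_⟩, by simp, ?_⟩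
      · simp at he
        exact (Wt.natCast_of_le (by omega)).mono (by omega)
      · simp only [List.length_range, St.set_arr]
        rw [unset_add (Nat.zero_le _) (Nat.le_succ (32 * S)), unset_eq_zero hsu]
        have := unset_le (A := s3.arr) (a := 32 * S) (b := (32 * S).succ)
        omega
      · simp [hg.reg 91, h91]
      · simp [hg.reg 92, h92]
      · simp [hg.reg 93, h93]
      · simpa [hout] using hg.out
      · simp
      · have hS1 : 1 ≤ S := by omega
        have a1 : 20 * (S + 10) * (32 * S + 3) * (32 * S) ≤ 20 * (11 * S) * (35 * S) * (32 * S) :=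
          Nat.mul_le_mul (Nat.mul_le_mul (by omega) (by omega)) le_rfl
        have a2 : 20 * (11 * S) * (35 * S) * (32 * S) = 246400 * S ^ 3 := by ring
        have a3 : S ≤ S ^ 3 := Nat.le_self_pow (by norm_num) S
        simp at ht3 ⊢
        omega

/-! ### Normal circuits and digits -/

theorem exists_naf (n : ℤ) : ∃ L, IsNaf L ∧ val L = n := by
  obtain ⟨L, h1, h2, -⟩ := Wt.natCast n.natAbs
  rcases le_total 0 n with h | h
  · exact ⟨L, h1, by rw [h2]; omega⟩
  · exact ⟨addList true [] L, isNaf_addList isNaf_nil, by rw [val_addList, h2]; simp [abs_of_nonpos h]⟩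

theorem digit_mem (i : ℕ) (n : ℤ) : digit i n = -1 ∨ digit i n = 0 ∨ digit i n = 1 := by
  obtain ⟨L, h1, rfl⟩ := exists_naf n
  rw [digit_val h1]
  unfold coeff; split_ifs <;> simp

theorem digit_sparse {i j : ℕ} {n : ℤ} (hi : digit i n ≠ 0) (hj : digit j n ≠ 0) (hij : i ≠ j) :
    i + 2 ≤ j ∨ j + 2 ≤ i := by
  obtain ⟨L, h1, rfl⟩ := exists_naf n
  rw [digit_val h1] at hi hj
  obtain ⟨b, hb⟩ := coeff_ne_zero.1 hi
  obtain ⟨c, hc⟩ := coeff_ne_zero.1 hj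
  have := isNaf_pair h1 hb hc
  simp at this
  omega

theorem lt_of_digit_ne_zero {i n : ℕ} (h : digit i n ≠ 0) : i < n := by
  obtain ⟨L, h1, h2⟩ := exists_naf n
  rw [← h2, digit_val h1] at h
  obtain ⟨b, hb⟩ := coeff_ne_zero.1 h
  exact lt_of_mem_naf h1 h2 hb

theorem exists_digit_ne_zero {n : ℤ} (h : n ≠ 0) : ∃ i, digit i n ≠ 0 := by
  obtain ⟨L, h1, rfl⟩ := exists_naf n
  obtain ⟨⟨i, b⟩, hx⟩ := List.exists_mem_of_ne_nil L (by rintro rfl; simp at h)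
  exact ⟨i, by rw [digit_val h1]; exact coeff_ne_zero.2 ⟨b, hx⟩⟩

theorem sum_digit {n : ℤ} {N : ℕ} (h : ∀ i, digit i n ≠ 0 → i < N) :
    ∑ i ∈ Finset.range N, digit i n * 2 ^ i = n := by
  obtain ⟨L, h1, rfl⟩ := exists_naf n
  simp only [digit_val h1] at h ⊢
  exact (val_eq_sum_coeff h1 fun x hx => h _ (coeff_ne_zero.2 ⟨x.2, hx⟩)).symm

section

variable {V : Type} [Fintype V] {z : V} {e : V → ℕ}

open Classical in
/-- A sum over the vertices, in terms of their exponents. -/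
theorem sum_exponents (he : ∀ u v, u ≠ z → v ≠ z → e u = e v → u = v) (g : ℕ → ℤ) (N : ℕ)
    (hN : ∀ v, v ≠ z → e v < N) (hg : ∀ i, g i ≠ 0 → ∃ v, v ≠ z ∧ e v = i) :
    ∑ v, (if v = z then 0 else g (e v)) = ∑ i ∈ Finset.range N, g i := by
  have h1 : ∑ v, (if v = z then 0 else g (e v)) =
      ∑ v ∈ Finset.univ.filter (fun v => v ≠ z), g (e v) := by
    rw [Finset.sum_filter]
    exact Finset.sum_congr rfl fun v _ => by by_cases h : v = z <;> simp [h]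
  rw [h1, ← Finset.sum_image (s := Finset.univ.filter fun v => v ≠ z) (g := e) (f := g)]
  · refine Finset.sum_subset (fun i hi => ?_) fun i _ hi => ?_
    · obtain ⟨v, hv, rfl⟩ := Finset.mem_image.1 hi
      exact Finset.mem_range.2 (hN v (by simpa using hv))
    · by_contra hc
      obtain ⟨v, hv, rfl⟩ := hg i hc
      exact hi (Finset.mem_image_of_mem _ (by simpa using hv))
  · intro u hu v hv h
    exact he u v (by simpa using hu) (by simpa using hv) h

open Classical in
/-- The labels in a compact sum are the digits of its value. -/
theorem digit_eq_label (he : ∀ u v, u ≠ z → v ≠ z → e u = e v → u = v) (l : V → SignType) {x : ℤ}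
    (hx : ∑ v, (if v = z then 0 else (l v : ℤ) * 2 ^ e v) = x)
    (hl : ∀ u v, u ≠ z → v ≠ z → u ≠ v → l u ≠ 0 → l v ≠ 0 → e u + 2 ≤ e v ∨ e v + 2 ≤ e u) :
    (∀ v, v ≠ z → digit (e v) x = l v) ∧ ∀ i, digit i x ≠ 0 → ∃ v, v ≠ z ∧ e v = i := by
  -- `f` spreads the labels over all positions, with `0` where no vertex has that exponent.
  -- Compactness makes it non-adjacent, so `digit_eq_of_sum` identifies it with the digits of `x`.
  let f : ℕ → ℤ := fun i => if h : ∃ v, v ≠ z ∧ e v = i then (l h.choose : ℤ) else 0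
  have hf : ∀ v, v ≠ z → f (e v) = l v := by
    intro v hv
    have h : ∃ u, u ≠ z ∧ e u = e v := ⟨v, hv, rfl⟩
    have h1 := h.choose_spec
    simp only [f, dif_pos h, he _ _ h1.1 hv h1.2]
  have hf0 : ∀ i, f i ≠ 0 → ∃ v, v ≠ z ∧ e v = i := fun i hi => by
    by_contra h
    simp [f, h] at hi
  obtain ⟨N, hN⟩ : ∃ N, ∀ v, v ≠ z → e v < N :=
    ⟨∑ v, e v + 1, fun v _ => Nat.lt_succ_of_le
      (Finset.single_le_sum (f := e) (fun _ _ => Nat.zero_le _) (Finset.mem_univ v))⟩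
  have hsum : ∑ i ∈ Finset.range N, f i * 2 ^ i = x := by
    rw [← hx, ← sum_exponents he (fun i => f i * 2 ^ i) N hN fun i hi =>
      hf0 i (left_ne_zero_of_mul hi)]
    refine Finset.sum_congr rfl fun v _ => ?_
    by_cases h : v = z
    · simp [h]
    · rw [if_neg h, if_neg h, hf v h]
  have hdig : ∀ i, digit i x = f i := by
    intro i
    rw [← hsum]
    refine digit_eq_of_sum i f N (fun j => ?_) (fun j hj => ?_) fun j hj => ?_
    · by_cases h : f j = 0
      · exact Or.inr (Or.inl h)
      · obtain ⟨v, hv, rfl⟩ := hf0 j h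
        rw [hf v hv]
        cases l v <;> simp
    · by_contra h
      obtain ⟨v, hv, h1⟩ := hf0 _ h
      obtain ⟨u, hu, rfl⟩ := hf0 _ hj
      rw [hf u hu] at hj
      rw [← h1, hf v hv] at h
      have h2 : u ≠ v := by rintro rfl; omega
      have := hl u v hu hv h2 (by rintro h; simp [h] at hj) (by rintro h'; simp [h'] at h)
      omega
    · by_contra h
      obtain ⟨v, hv, rfl⟩ := hf0 _ h
      have := hN v hv
      omega
  exact ⟨fun v hv => (hdig _).trans (hf v hv), fun i hi => hf0 i (by rwa [← hdig])⟩

/-- The circuit is determined by the exponents `e` of the vertices other than the zero vertex. -/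
structure Coded (P : PowerCircuit V) (z : V) (e : V → ℕ) (n : ℤ) : Prop where
  inj : ∀ u v, u ≠ z → v ≠ z → e u = e v → u = v
  edge_zero : ∀ v, P.edge z v = 0
  edge_to_zero : ∀ v, v ≠ z → P.edge v z = if e v = 0 then 1 else 0
  edge : ∀ u v, u ≠ z → v ≠ z → (P.edge u v : ℤ) = digit (e v) (e u)
  mark_zero : P.mark z = 0
  mark : ∀ v, v ≠ z → (P.mark v : ℤ) = digit (e v) n
  closed : ∀ v, v ≠ z → ∀ i, digit i (e v) ≠ 0 → ∃ u, u ≠ z ∧ e u = i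
  closed_mark : ∀ i, digit i n ≠ 0 → ∃ u, u ≠ z ∧ e u = i
  trimmed : P.IsTrimmed

theorem signType_cast_inj {a b : SignType} (h : (a : ℤ) = b) : a = b := by
  revert h; cases a <;> cases b <;> decide

end

section

variable {V W : Type} {z : V} {e : V → ℕ} {z' : W} {e' : W → ℕ} {n : ℤ}

/-- Along a path from a marked vertex, every exponent is the position of a nonzero digit of `n` or
of the preceding exponent, and the exponents of the other circuit are closed under both. -/
theorem Coded.exists_eq {P : PowerCircuit V} {Q : PowerCircuit W} (h : Coded P z e n)
    (h' : Coded Q z' e' n) {v : V} (hv : v ≠ z) : ∃ w, w ≠ z' ∧ e' w = e v := by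
  obtain ⟨m, hm, hmv⟩ := h.trimmed v
  revert hv
  induction hmv with
  | refl =>
    intro hv
    refine h'.closed_mark _ ?_
    rw [← h.mark m hv]
    intro h0
    exact hm (signType_cast_inj (by simpa using h0))
  | @tail b c hb hbc ih =>
    intro hv
    have hbz : b ≠ z := by rintro rfl; exact hbc (h.edge_zero c)
    obtain ⟨w, hw, hwe⟩ := ih hbz
    refine h'.closed w hw _ ?_
    rw [hwe, ← h.edge b c hbz hv]
    intro h0
    exact hbc (signType_cast_inj (by simpa using h0))

open Classical in
-- Vertices are matched by their exponents, which is bijective by `Coded.exists_eq` in both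
-- directions. Labels and marks agree, being digits of the same numbers.
theorem Coded.isomorphic {P : PowerCircuit V} {Q : PowerCircuit W} (h : Coded P z e n)
    (h' : Coded Q z' e' n) : P.Isomorphic Q := by
  have hex : ∀ v : V, ∃ w : W, (v = z → w = z') ∧ (v ≠ z → w ≠ z' ∧ e' w = e v) := fun v => by
    by_cases hv : v = z
    · exact ⟨z', fun _ => rfl, fun h => absurd hv h⟩
    · obtain ⟨w, hw⟩ := h.exists_eq h' hv
      exact ⟨w, fun h => absurd h hv, fun _ => hw⟩
  choose φ hφz hφ using hex
  have hbij : Function.Bijective φ := by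
    constructor
    · intro u v huv
      by_cases hu : u = z <;> by_cases hv : v = z
      · rw [hu, hv]
      · exact absurd (huv.symm.trans (hφz u hu)) (hφ v hv).1
      · exact absurd (huv.trans (hφz v hv)) (hφ u hu).1
      · refine h.inj u v hu hv ?_
        rw [← (hφ u hu).2, ← (hφ v hv).2, huv]
    · intro w
      by_cases hw : w = z'
      · exact ⟨z, (hφz z rfl).trans hw.symm⟩
      · obtain ⟨v, hv, hve⟩ := h'.exists_eq h hw
        refine ⟨v, h'.inj _ _ (hφ v hv).1 hw ?_⟩
        rw [(hφ v hv).2, hve]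
  refine ⟨Equiv.ofBijective φ hbij, fun u v => ?_, fun v => ?_⟩
  · simp only [Equiv.ofBijective_apply]
    by_cases hu : u = z
    · rw [hφz u hu, hu, h.edge_zero, h'.edge_zero]
    · obtain ⟨h1, h2⟩ := hφ u hu
      by_cases hv : v = z
      · rw [hφz v hv, hv, h.edge_to_zero u hu, h'.edge_to_zero _ h1, h2]
      · obtain ⟨h3, h4⟩ := hφ v hv
        apply signType_cast_inj
        rw [h.edge u v hu hv, h'.edge _ _ h1 h3, h2, h4]
  · simp only [Equiv.ofBijective_apply]
    by_cases hv : v = z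
    · rw [hφz v hv, hv, h.mark_zero, h'.mark_zero]
    · obtain ⟨h3, h4⟩ := hφ v hv
      apply signType_cast_inj
      rw [h.mark v hv, h'.mark _ h3, h4]

end

section

variable {V : Type} [Fintype V] {P : PowerCircuit V} {n : ℤ}

theorem value_of_isLeaf {v : V} (h : P.IsLeaf v) : P.value v = 0 := by
  rw [P.value_eq, if_pos h]

open Classical in
-- The exponent is a signed sum of natural numbers, hence an integer; it is not negative, because
-- then the value would lie strictly between `0` and `1`.
theorem exists_exponent_eq (hP : P.IsProper) {v : V} (hv : ¬ P.IsLeaf v) :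
    ∃ m : ℕ, P.exponent v = m ∧ P.value v = 2 ^ m := by
  choose val hval using hP
  obtain ⟨x, hx⟩ : ∃ x : ℤ, P.exponent v = x := by
    refine ⟨∑ u, (P.edge v u : ℤ) * val u, ?_⟩
    unfold PowerCircuit.exponent
    push_cast
    refine Finset.sum_congr rfl fun u _ => ?_
    rw [hval u]
  have h1 : P.value v = 2 ^ x := by
    rw [P.value_eq, if_neg hv, hx, Real.rpow_intCast]
  have h2 : 0 ≤ x := by
    by_contra hc
    have h3 : (0 : ℝ) < 2 ^ x := by positivity
    have h4 : (2 : ℝ) ^ x < 1 := zpow_lt_one_of_neg₀ (by norm_num) (by omega)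
    rw [← h1, hval v] at h3 h4
    have h5 : 0 < val v := by exact_mod_cast h3
    have h6 : val v < 1 := by exact_mod_cast h4
    omega
  obtain ⟨m, rfl⟩ := Int.eq_ofNat_of_zero_le h2
  exact ⟨m, by simpa using hx, by simpa using h1⟩

/-- A normal circuit is trivial, or determined by exponents. -/
theorem coded_of_isNormal (hP : P.IsNormal) (hn : P.total = n) :
    (P.IsTrivial ∧ n = 0) ∨ ∃ z e, Coded P z e n := by
  classical
  obtain ⟨hproper, ⟨hstd, hinj, -, -⟩, hcomp, hcompM⟩ := hP
  rcases hstd with ht | ⟨htrim, z, hzm, hleaf, hez⟩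
  · refine Or.inl ⟨ht, ?_⟩
    obtain ⟨z, hz, -⟩ := ht
    have : P.total = 0 := by
      unfold PowerCircuit.total
      refine Finset.sum_eq_zero fun v _ => ?_
      rw [value_of_isLeaf, mul_zero]
      intro u
      by_contra h
      rw [hz v, hz u] at h
      exact P.acyclic z (Relation.TransGen.single h)
    exact_mod_cast hn.symm.trans this
  · right
    have hval0 : P.value z = 0 := value_of_isLeaf ((hleaf z).2 rfl)
    have hex : ∀ v, ∃ m : ℕ, v ≠ z → P.exponent v = m ∧ P.value v = 2 ^ m := fun v => by
      by_cases hv : v = z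
      · exact ⟨0, fun h => absurd hv h⟩
      · obtain ⟨m, hm⟩ := exists_exponent_eq hproper fun h => hv ((hleaf v).1 h)
        exact ⟨m, fun _ => hm⟩
    choose e he using hex
    have heinj : ∀ u v, u ≠ z → v ≠ z → e u = e v → u = v := fun u v hu hv h =>
      hinj u v (by rw [(he u hu).2, (he v hv).2, h])
    have hsum : ∀ (l : V → SignType) (x : ℤ), ∑ v, (l v : ℝ) * P.value v = x →
        ∑ v, (if v = z then 0 else (l v : ℤ) * 2 ^ e v) = x := by
      intro l x hx
      have : ((∑ v, (if v = z then 0 else (l v : ℤ) * 2 ^ e v) : ℤ) : ℝ) = x := by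
        rw [← hx]
        push_cast
        refine Finset.sum_congr rfl fun v _ => ?_
        by_cases hv : v = z
        · simp [hv, hval0]
        · rw [if_neg hv, (he v hv).2]
      exact_mod_cast this
    have hsp : ∀ (T : Set V), P.CompactOn T → ∀ u v, u ≠ z → v ≠ z → u ≠ v → u ∈ T → v ∈ T →
        e u + 2 ≤ e v ∨ e v + 2 ≤ e u := by
      intro T hT u v hu hv huv huT hvT
      have h1 := hT u huT v hvT (fun h => hu ((hleaf u).1 h)) (fun h => hv ((hleaf v).1 h)) huv
      rw [(he u hu).1, (he v hv).1] at h1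
      have h2 : (2 : ℤ) ≤ |(e u : ℤ) - e v| := by exact_mod_cast h1
      rcases abs_cases ((e u : ℤ) - e v) with h3 | h3 <;> omega
    have hedge : ∀ u, u ≠ z → (∀ v, v ≠ z → digit (e v) (e u) = P.edge u v) ∧
        ∀ i, digit i (e u) ≠ 0 → ∃ v, v ≠ z ∧ e v = i := fun u hu =>
      digit_eq_label heinj (P.edge u) (hsum _ _ ((he u hu).1.trans (by simp)))
        fun v w hv hw hvw h1 h2 => hsp _ (hcomp u) v w hv hw hvw h1 h2
    have hmark := digit_eq_label heinj P.mark (hsum _ _ hn)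
      fun v w hv hw hvw h1 h2 => hsp _ hcompM v w hv hw hvw h1 h2
    refine ⟨z, e, heinj, (hleaf z).2 rfl, fun v hv => ?_, fun u v hu hv => ((hedge u hu).1 v hv).symm, hzm,
      fun v hv => (hmark.1 v hv).symm, fun v hv => (hedge v hv).2, hmark.2, htrim⟩
    split_ifs with h0
    -- A vertex with exponent `0` is no leaf, and an edge to a nonzero vertex would be a nonzero
    -- digit of `0`; so it has an edge to the zero vertex.
    · obtain ⟨u, hu⟩ : ∃ u, P.edge v u ≠ 0 := by
        by_contra hc
        push Not at hc
        exact hv ((hleaf v).1 hc)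
      by_cases huz : u = z
      · subst huz
        exact (hez v hu).1
      · refine absurd ?_ hu
        apply signType_cast_inj
        rw [← (hedge v hv).1 u huz]
        by_contra hc
        have := lt_of_digit_ne_zero (show digit (e u) (e v) ≠ 0 from hc)
        omega
    -- A nonzero exponent has a nonzero digit, hence an edge to a nonzero vertex, which excludes an
    -- edge to the zero vertex.
    · by_contra hc
      obtain ⟨i, hi⟩ := exists_digit_ne_zero (n := (e v : ℤ)) (by exact_mod_cast h0)
      obtain ⟨u, hu, rfl⟩ := (hedge v hv).2 i hi
      refine hu ((hez v hc).2 u fun h => ?_)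
      rw [(hedge v hv).1 u hu, h] at hi
      simp at hi

/-- A circuit that is determined by exponents is normal. -/
theorem Coded.isNormalCircuitOf {z : V} {e : V → ℕ} (h : Coded P z e n) :
    P.IsNormalCircuitOf n := by
  classical
  have hzleaf : P.IsLeaf z := h.edge_zero
  have hleaf : ∀ v, P.IsLeaf v ↔ v = z := by
    refine fun v => ⟨fun hv => ?_, fun hv => hv ▸ hzleaf⟩
    by_contra hvz
    by_cases h0 : e v = 0
    · have := hv z
      rw [h.edge_to_zero v hvz, if_pos h0] at this
      simp at this
    · obtain ⟨i, hi⟩ := exists_digit_ne_zero (n := (e v : ℤ)) (by exact_mod_cast h0)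
      obtain ⟨u, hu, rfl⟩ := h.closed v hvz i hi
      rw [← h.edge v u hvz hu, hv u] at hi
      simp at hi
  have hval0 : P.value z = 0 := value_of_isLeaf hzleaf
  obtain ⟨N, hN⟩ : ∃ N, ∀ v, v ≠ z → e v < N :=
    ⟨∑ v, e v + 1, fun v _ => Nat.lt_succ_of_le
      (Finset.single_le_sum (f := e) (fun _ _ => Nat.zero_le _) (Finset.mem_univ v))⟩
  have hsum : ∀ x : ℤ, (∀ i, digit i x ≠ 0 → ∃ u, u ≠ z ∧ e u = i) →
      ∑ v, (if v = z then 0 else digit (e v) x * 2 ^ e v) = x := by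
    intro x hx
    rw [sum_exponents h.inj (fun i => digit i x * 2 ^ i) N hN fun i hi =>
      hx i (left_ne_zero_of_mul hi)]
    refine sum_digit fun i hi => ?_
    obtain ⟨u, hu, rfl⟩ := hx i hi
    exact hN u hu
  have hsumR : ∀ (x : ℤ) (l : V → SignType), (∀ v, v ≠ z → (l v : ℤ) = digit (e v) x) →
      (∀ i, digit i x ≠ 0 → ∃ u, u ≠ z ∧ e u = i) →
      (∀ v, v ≠ z → l v ≠ 0 → P.value v = 2 ^ e v) → ∑ v, (l v : ℝ) * P.value v = x := by
    intro x l hl hx hv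
    rw [← hsum x hx]
    push_cast
    refine Finset.sum_congr rfl fun v _ => ?_
    by_cases hvz : v = z
    · simp [hvz, hval0]
    · rw [if_neg hvz, ← hl v hvz]
      by_cases hlv : l v = 0
      · simp [hlv]
      · rw [hv v hvz hlv]
        cases l v <;> simp
  have hlt : ∀ u v, u ≠ z → v ≠ z → P.edge u v ≠ 0 → e v < e u := fun u v hu hv huv => by
    refine lt_of_digit_ne_zero ?_
    rw [← h.edge u v hu hv]
    intro h0
    exact huv (signType_cast_inj (by simpa using h0))
  -- Strong induction on the exponent: edges between nonzero vertices lead to smaller exponents by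
  -- `hlt`, and the labels sum up to the exponent because they are its digits.
  have hmain : ∀ k : ℕ, ∀ v, v ≠ z → e v = k → P.exponent v = e v ∧ P.value v = 2 ^ e v := by
    intro k
    induction k using Nat.strong_induction_on with
    | _ k ih =>
      rintro v hv rfl
      have h1 : P.exponent v = e v := by
        have := hsumR (e v) (P.edge v) (fun u hu => h.edge v u hv hu) (h.closed v hv)
          fun u hu hvu => (ih _ (hlt v u hv hu hvu) u hu rfl).2
        simpa [PowerCircuit.exponent] using this
      refine ⟨h1, ?_⟩
      rw [P.value_eq, if_neg fun h' => hv ((hleaf v).1 h'), h1, Real.rpow_natCast]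
  have hexp : ∀ v, v ≠ z → P.exponent v = e v := fun v hv => (hmain _ v hv rfl).1
  have hval : ∀ v, v ≠ z → P.value v = 2 ^ e v := fun v hv => (hmain _ v hv rfl).2
  have hproper : P.IsProper := fun v => by
    by_cases hv : v = z
    · exact ⟨0, by rw [hv, hval0]; simp⟩
    · exact ⟨2 ^ e v, by rw [hval v hv]; simp⟩
  have hpow : ∀ a b : ℕ, (2 : ℝ) ^ a = 2 ^ b → a = b := fun a b hab =>
    pow_right_injective₀ (by norm_num) (by norm_num) hab
  have hinj : ∀ u v, P.value u = P.value v → u = v := by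
    intro u v huv
    by_cases hu : u = z <;> by_cases hv : v = z
    · rw [hu, hv]
    · rw [hu, hval0, hval v hv] at huv
      exact absurd huv.symm (by positivity)
    · rw [hv, hval0, hval u hu] at huv
      exact absurd huv (by positivity)
    · rw [hval u hu, hval v hv] at huv
      exact h.inj u v hu hv (hpow _ _ huv)
  have hez : ∀ v, P.edge v z ≠ 0 → P.edge v z = 1 ∧ ∀ u, P.edge v u ≠ 0 → u = z := by
    intro v hv
    have hvz : v ≠ z := by rintro rfl; exact hv (h.edge_zero _)
    have h1 := h.edge_to_zero v hvz
    by_cases h0 : e v = 0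
    · rw [if_pos h0] at h1
      refine ⟨h1, fun u hu => ?_⟩
      by_contra hc
      have := hlt v u hvz hc hu
      omega
    · rw [if_neg h0] at h1
      exact absurd h1 hv
  have hsparse : ∀ (x : ℤ) (T : Set V), (∀ v, v ∈ T → v ≠ z → digit (e v) x ≠ 0) →
      P.CompactOn T := by
    intro x T hT u hu v hv hul hvl huv
    have hu' : u ≠ z := fun h' => hul ((hleaf u).2 h')
    have hv' : v ≠ z := fun h' => hvl ((hleaf v).2 h')
    rw [hexp u hu', hexp v hv']
    have h1 := digit_sparse (hT u hu hu') (hT v hv hv') fun h' => huv (h.inj u v hu' hv' h')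
    have h2 : (2 : ℤ) ≤ |(e u : ℤ) - e v| := by
      rcases abs_cases ((e u : ℤ) - e v) with h3 | h3 <;> omega
    exact_mod_cast h2
  have hne : ∀ (s : SignType), s ≠ 0 → (s : ℤ) ≠ 0 := fun s hs h0 =>
    hs (signType_cast_inj (by simpa using h0))
  have hcomp : ∀ v, P.CompactOn {u | P.edge v u ≠ 0} := by
    intro v
    by_cases hv : v = z
    · intro u hu
      exact absurd (hv ▸ h.edge_zero u) hu
    · refine hsparse (e v) _ fun u hu huz => ?_
      rw [← h.edge v u hv huz]
      exact hne _ hu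
  -- Termini of opposite edges are distinct vertices, so equal values are impossible; a value twice
  -- the other would mean exponents differing by one, against compactness.
  have hopp : ∀ v u w, P.edge v u ≠ 0 → P.edge v u = -P.edge v w →
      P.value u ≠ P.value w ∧ P.value u ≠ 2 * P.value w := by
    intro v u w hu huw
    have hw : P.edge v w ≠ 0 := by intro h0; rw [h0] at huw; simp [huw] at hu
    have huw' : u ≠ w := by
      rintro rfl
      revert hu huw
      cases P.edge v u <;> decide
    refine ⟨fun h' => huw' (hinj u w h'), fun h' => ?_⟩
    by_cases huz : u = z
    · rw [huz] at hu
      exact huw' (huz.trans ((hez v hu).2 w hw).symm)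
    · by_cases hwz : w = z
      · rw [hwz] at hw
        exact huz ((hez v hw).2 u (by assumption))
      · have h1 := hcomp v u hu w hw (fun h' => huz ((hleaf u).1 h'))
          (fun h' => hwz ((hleaf w).1 h')) huw'
        rw [hval u huz, hval w hwz, ← pow_succ'] at h'
        rw [hexp u huz, hexp w hwz, hpow _ _ h'] at h1
        norm_num at h1
  have hnormal : P.IsNormal := by
    refine ⟨hproper, ⟨Or.inr ⟨h.trimmed, z, h.mark_zero, hleaf, hez⟩, hinj,
      fun v u w hu huw => (hopp v u w hu huw).1, fun v u w hu huw => (hopp v u w hu huw).2⟩,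
      hcomp, hsparse n _ fun v hv hvz => ?_⟩
    rw [← h.mark v hvz]
    exact hne _ hv
  -- Marks are digits of `n` and `0` has no nonzero digit. This separates the present case from the
  -- trivial circuit.
  have hnz : n ≠ 0 := by
    obtain ⟨v, hv⟩ := P.marked_nonempty
    have hvz : v ≠ z := by rintro rfl; exact hv h.mark_zero
    have h1 := hne _ hv
    rw [h.mark v hvz] at h1
    rintro rfl
    have := lt_of_digit_ne_zero (n := 0) (by simpa using h1)
    omega
  refine ⟨hnormal, ⟨hproper, hsumR n P.mark h.mark h.closed_mark fun v hv _ => hval v hv⟩, ?_⟩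
  intro W _ Q hQ hQn
  rcases coded_of_isNormal hQ hQn.2 with ⟨-, h0⟩ | ⟨z', e', h'⟩
  · exact absurd h0 hnz
  · exact h.isomorphic h'

end

/-- The trivial circuit. -/
def trivialCircuit : PowerCircuit (Fin 1) where
  edge _ _ := 0
  mark _ := 1
  acyclic v h := by
    obtain ⟨w, h, -⟩ := Relation.TransGen.head'_iff.1 h
    exact h rfl
  marked_nonempty := ⟨0, by decide⟩

theorem trivialCircuit_isNormalCircuitOf : trivialCircuit.IsNormalCircuitOf 0 := by
  have hl : ∀ v, trivialCircuit.IsLeaf v := fun v u => rfl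
  have hv : ∀ v, trivialCircuit.value v = 0 := fun v => value_of_isLeaf (hl v)
  have ht : trivialCircuit.total = 0 := by simp [PowerCircuit.total, hv]
  have hp : trivialCircuit.IsProper := fun v => ⟨0, by simp [hv]⟩
  refine ⟨⟨hp, ⟨Or.inl ⟨0, fun v => Subsingleton.elim _ _, rfl⟩, fun u v _ => Subsingleton.elim _ _,
    fun v u w h => absurd rfl h, fun v u w h => absurd rfl h⟩, fun v u hu => absurd rfl hu,
    fun u _ w _ h => absurd (hl u) h⟩, ⟨hp, by simpa using ht⟩, ?_⟩
  intro W _ Q hQ hQn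
  rcases coded_of_isNormal hQ hQn.2 with ⟨⟨z, hz, hm⟩, -⟩ | ⟨z, e, h⟩
  · refine ⟨⟨fun _ => z, fun _ => 0, fun v => Subsingleton.elim _ _, fun w => (hz w).symm⟩,
      fun u v => ?_, fun v => hm⟩
    by_contra hc
    exact Q.acyclic z (Relation.TransGen.single hc)
  -- All marks of a circuit coded for `0` would be digits of `0`, contrary to the existence of a
  -- marked vertex.
  · obtain ⟨v, hv⟩ := Q.marked_nonempty
    have hvz : v ≠ z := by rintro rfl; exact hv h.mark_zero
    have h1 := h.mark v hvz
    have h2 : digit (e v) (0 : ℤ) = 0 := by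
      by_contra hc
      have := lt_of_digit_ne_zero (n := 0) (by simpa using hc)
      omega
    rw [h2] at h1
    exact absurd (signType_cast_inj (by simpa using h1)) hv

/-! ### Output -/

/-- The word for the digit at the position `e` of a list. -/
def digitCode (L : List (ℕ × Bool)) (e : ℕ) : ℕ :=
  if (e, false) ∈ L then 1 else if (e, true) ∈ L then 2 else 0

theorem digitCode_eq {L : List (ℕ × Bool)} (hL : IsNaf L) (e : ℕ) :
    digitCode L e = signCode (SignType.sign (digit e (val L))) := by
  rw [digit_val hL]
  unfold digitCode coeff
  split_ifs
  · simp; rfl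
  · simp; rfl
  · simp; rfl

theorem digitCode_append_singleton {L : List (ℕ × Bool)} {f : ℕ} {b : Bool}
    (hL : IsNaf (L ++ [(f, b)])) (e : ℕ) :
    digitCode (L ++ [(f, b)]) e = if e = f then code b else digitCode L e := by
  by_cases h : e = f
  · subst h
    have h1 : ∀ c, (e, c) ∉ L := fun c hc => by
      have := (isNaf_append_singleton.1 hL).2 _ hc
      simp at this
    cases b <;> simp [digitCode, h1, code]
  · simp [digitCode, h]

def lookupBody : Prog := .ld 14 4 10 ;; .ifEq 14 12 (.ld 13 5 10) (.mov 14 0) ;; .inc 10 1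

/-- Look for the index in register `12` in the list from `10` to `11`. -/
def lookupP : Prog := .mov 13 0 ;; .loop 10 11 lookupBody

structure LookupInv (s : St) (E : List ℕ) (L : List (ℕ × Bool)) (e n : ℕ) (s1 : St) : Prop where
  quiet : Quiet 15 s s1
  finish : s1.reg 11 = s.reg 11
  idx : s1.reg 12 = s.reg 12
  lists : ∃ M R, L = M ++ R ∧ HeapList s.arr E (s1.reg 10) (s.reg 11) R ∧
    s1.reg 13 = digitCode M e ∧ s1.tm + 5 * R.length ≤ s.tm + n

theorem wp_lookupP {inp s} {E : List ℕ} {L : List (ℕ × Bool)} {e : ℕ} (hP : Pool s.arr (s.reg 2) E) (h0 : s.reg 0 = 0)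
    (hL : HeapList s.arr E (s.reg 10) (s.reg 11) L) (hLn : IsNaf L) (he : E[s.reg 12]? = some e) :
    wp inp lookupP (fun s' => Quiet 15 s s' ∧ s'.reg 13 = digitCode L e ∧
      s'.tm ≤ s.tm + 5 * L.length + 2) s := by
  simp only [lookupP, wp_seq, wp_mov]
  refine wp_loop (LookupInv s E L e (5 * L.length + 1)) (fun s => s.reg 11 - s.reg 10) ?_ ?_ ?_
  · refine ⟨(Quiet.refl _ _).of_set (by norm_num) (by norm_num), by simp, by simp,
      [], L, rfl, by simpa, by simp [h0, digitCode], by simp; omega⟩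
  · rintro s1 ⟨hq, h11, h12, M, R, rfl, hR, h13, ht⟩ hlt
    obtain ⟨f, b, R', rfl, hf, hb, hR'⟩ := hR.cons_inv (by omega)
    have hn : IsNaf (M ++ [(f, b)]) := isNaf_prefix (L' := R') (by simpa using hLn)
    have key := digitCode_append_singleton hn e
    simp only [lookupBody, wp_seq, wp_ld, wp_ifEq, wp_mov, wp_inc]
    simp [hq.arr, h12, hb]
    rw [hP.idx_eq hf he]
    refine ⟨fun h => ⟨⟨?_, by simpa, by simpa, M ++ [(f, b)], R', by simp, by simpa, ?_, ?_⟩, by omega⟩,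
      fun h => ⟨⟨?_, by simpa, by simpa, M ++ [(f, b)], R', by simp, by simpa, ?_, ?_⟩, by omega⟩⟩
    · repeat' (first | exact hq | refine Quiet.of_tick ?_ |
          refine Quiet.of_set ?_ (by norm_num) (by norm_num))
    · simpa using (key.trans (if_pos h.symm)).symm
    · simp at ht ⊢; omega
    · repeat' (first | exact hq | refine Quiet.of_tick ?_ |
          refine Quiet.of_set ?_ (by norm_num) (by norm_num))
    · simp [key, Ne.symm h, h13]
    · simp at ht ⊢; omega
  · rintro s1 ⟨hq, h11, h12, M, R, rfl, hR, h13, ht⟩ hlt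
    obtain rfl := hR.nil_inv (by omega)
    refine ⟨hq.of_tick, by simpa using h13, by simp at ht ⊢; omega⟩

def emitRowBody : Prog :=
  .mov 10 104 ;; .mov 11 105 ;; .ld 12 11 106 ;; lookupP ;; .write 13 ;; .inc 106 1

/-- Output the labels of the edges to the vertices in the array `11`, for the list from `104` to
`105`. -/
def emitRowP : Prog := .const 106 0 ;; .loop 106 102 emitRowBody

/-- The memory, and all registers but those from `5` to `14` and those in the set `D`, are unchanged. -/
structure Emit (D : Finset ℕ) (out : List ℕ) (s s' : St) : Prop where
  reg : ∀ r, r < 5 ∨ 15 ≤ r → r ∉ D → s'.reg r = s.reg r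
  arr : s'.arr = s.arr
  out : s'.out = s.out ++ out

theorem wp_emitRowP {inp s} {E Es : List ℕ} {L : List (ℕ × Bool)} (hP : Pool s.arr (s.reg 2) E) (h0 : s.reg 0 = 0)
    (hL : HeapList s.arr E (s.reg 104) (s.reg 105) L) (hLn : IsNaf L)
    (h102 : s.reg 102 = Es.length)
    (hEs : ∀ {p e : ℕ}, Es[p]? = some e → E[s.arr 11 p]? = some e) :
    wp inp emitRowP (fun s' => Emit {106} (Es.map (digitCode L)) s s' ∧
      s'.tm ≤ s.tm + (5 * L.length + 10) * Es.length + 2) s := by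
  simp only [emitRowP, wp_seq, wp_const]
  refine wp_loop (fun s1 => Emit {106} ((Es.take (s1.reg 106)).map (digitCode L)) s s1 ∧
    s1.reg 106 ≤ Es.length ∧ s1.tm + (5 * L.length + 10) * (Es.length - s1.reg 106) ≤
      s.tm + (5 * L.length + 10) * Es.length + 1) (fun s => s.reg 102 - s.reg 106) ?_ ?_ ?_
  · refine ⟨⟨fun r hr hr' => ?_, rfl, by simp⟩, by simp, by simp; omega⟩
    simp at hr'; simp [hr']
  · rintro s1 ⟨⟨hreg, harr, hout⟩, hle, ht⟩ hlt
    have k102 := hreg 102 (by norm_num) (by simp)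
    have k104 := hreg 104 (by norm_num) (by simp)
    have k105 := hreg 105 (by norm_num) (by simp)
    have hq : s1.reg 106 < Es.length := by omega
    obtain ⟨e, he⟩ : ∃ e, Es[s1.reg 106]? = some e := ⟨_, List.getElem?_eq_getElem hq⟩
    have htk : Es.take (s1.reg 106 + 1) = Es.take (s1.reg 106) ++ [e] := by
      rw [List.take_add_one, he]; rfl
    simp only [emitRowBody, wp_seq, wp_mov, wp_ld]
    generalize hs2 : (((s1.tick.set 10 _).set 11 _).set 12 _) = s2
    have hq2 : Quiet 15 s1 s2 := by
      rw [← hs2]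
      repeat' (first | exact Quiet.refl _ _ | refine Quiet.of_tick ?_ |
          refine Quiet.of_set ?_ (by norm_num) (by norm_num))
    refine wp_mono (wp_lookupP (E := E) (L := L) (e := e) ?_ ?_ ?_ hLn ?_) ?_
    · rw [hq2.arr, hq2.reg 2 (by omega), harr, hreg 2 (by omega) (by simp)]; exact hP
    · rw [hq2.reg 0 (by omega), hreg 0 (by omega) (by simp), h0]
    · rw [hq2.arr, harr]
      simpa [← hs2, k104, k105] using hL
    · simpa [← hs2, harr] using hEs he
    · rintro s3 ⟨hq3, h13, ht3⟩
      have hq4 : Quiet 15 s1 s3 := hq2.trans hq3 le_rfl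
      have k106 := hq4.reg 106 (by omega)
      have htm : s2.tm = s1.tm + 4 := by simp [← hs2]
      have hT : (5 * L.length + 10) * (Es.length - s1.reg 106) =
          (5 * L.length + 10) * (Es.length - (s1.reg 106 + 1)) + (5 * L.length + 10) := by
        rw [show Es.length - s1.reg 106 = Es.length - (s1.reg 106 + 1) + 1 by omega]; ring
      simp only [wp_write, wp_inc]
      refine ⟨⟨⟨fun r hr hr' => ?_, by simp [hq4.arr, harr], ?_⟩, by simp [k106]; omega, ?_⟩, ?_⟩
      · have h1 : r ≠ 106 := by simpa using hr'
        simp [h1, hq4.reg r hr, hreg r hr hr']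
      · simp [k106, hq4.out, hout, htk, h13]
      · simp [k106]; omega
      · simp [k106, hq4.reg 102]; omega
  · rintro s1 ⟨⟨hreg, harr, hout⟩, hle, ht⟩ hlt
    have k102 := hreg 102 (by norm_num) (by simp)
    have h106 : s1.reg 106 = Es.length := by omega
    rw [h106] at hout ht
    exact ⟨⟨hreg, harr, by simpa using hout⟩, by simp at ht ⊢; omega⟩

def zeroRowBody : Prog := .write 0 ;; .inc 103 1

/-- Index `0` in the pool is the exponent `0`, and the vertex with this exponent is the only one
with an edge to the zero vertex; hence the test against `0`. -/
def rowsBody : Prog :=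
  .ld 108 11 103 ;; .ifEq 108 0 (.write 3) (.write 0) ;; .ld 104 0 108 ;; .ld 105 1 108 ;;
  emitRowP ;; .inc 103 1

/-- Output the circuit. -/
def emitP : Prog :=
  .write 3 ;; .mov 107 102 ;; .inc 107 1 ;; .write 107 ;; .write 0 ;; .mov 104 100 ;;
  .mov 105 101 ;; emitRowP ;; .const 103 0 ;; .loop 103 107 zeroRowBody ;;
  .const 103 0 ;; .loop 103 102 rowsBody

theorem wp_zeroRow {inp} {s : St} (h0 : s.reg 0 = 0) (h103 : s.reg 103 = 0) :
    wp inp (.loop 103 107 zeroRowBody) (fun s' =>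
      Emit {103} (List.replicate (s.reg 107) 0) s s' ∧ s'.tm ≤ s.tm + 3 * s.reg 107 + 1) s := by
  refine wp_loop (fun s1 => Emit {103} (List.replicate (s1.reg 103) 0) s s1 ∧
    s1.reg 103 ≤ s.reg 107 ∧ s1.tm ≤ s.tm + 3 * s1.reg 103) (fun s => s.reg 107 - s.reg 103)
    ?_ ?_ ?_
  · exact ⟨⟨fun _ _ _ => rfl, rfl, by simp [h103]⟩, by omega, by omega⟩
  · rintro s1 ⟨⟨hreg, harr, hout⟩, hle, ht⟩ hlt
    have k107 := hreg 107 (by norm_num) (by simp)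
    have k0 := hreg 0 (by norm_num) (by simp)
    simp only [zeroRowBody, wp_seq, wp_write, wp_inc]
    refine ⟨⟨⟨fun r hr hr' => ?_, by simpa, ?_⟩, by simp; omega, by simp; omega⟩, by simp; omega⟩
    · have h1 : r ≠ 103 := by simpa using hr'
      simp [h1, hreg r hr hr']
    · simp [hout, k0, h0, List.replicate_succ']
  · rintro s1 ⟨⟨hreg, harr, hout⟩, hle, ht⟩ hlt
    have k107 := hreg 107 (by norm_num) (by simp)
    have h103' : s1.reg 103 = s.reg 107 := by omega
    rw [h103'] at hout ht
    exact ⟨⟨hreg, harr, hout⟩, by simp; omega⟩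

/-- The row of the matrix of edge labels for the vertex with the exponent `x`. -/
noncomputable def rowCode (Es : List ℕ) (x : ℕ) : List ℕ :=
  (if x = 0 then 1 else 0) :: Es.map fun e => signCode (SignType.sign (digit e x))

theorem wp_rows {inp s} {E Es : List ℕ} {W : ℕ} (hP : Pool s.arr (s.reg 2) E) (h0 : s.reg 0 = 0) (h3 : s.reg 3 = 1)
    (h102 : s.reg 102 = Es.length) (h103 : s.reg 103 = 0)
    (hEs : ∀ {p e : ℕ}, Es[p]? = some e → E[s.arr 11 p]? = some e)
    (hW : ∀ e ∈ E, Wt (e : ℤ) W) :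
    wp inp (.loop 103 102 rowsBody) (fun s' =>
      Emit {103, 104, 105, 106, 108} (Es.flatMap (rowCode Es)) s s' ∧
      s'.tm ≤ s.tm + (5 * W + 20) * (Es.length + 1) * Es.length + 1) s := by
  refine wp_loop (fun s1 => Emit {103, 104, 105, 106, 108}
    ((Es.take (s1.reg 103)).flatMap (rowCode Es)) s s1 ∧
    s1.reg 103 ≤ Es.length ∧ s1.tm + (5 * W + 20) * (Es.length + 1) * (Es.length - s1.reg 103) ≤
      s.tm + (5 * W + 20) * (Es.length + 1) * Es.length) (fun s => s.reg 102 - s.reg 103) ?_ ?_ ?_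
  · exact ⟨⟨fun _ _ _ => rfl, rfl, by simp [h103]⟩, by omega, by simp [h103]⟩
  · rintro s1 ⟨⟨hreg, harr, hout⟩, hle, ht⟩ hlt
    have k102 := hreg 102 (by norm_num) (by simp)
    have k0 := hreg 0 (by norm_num) (by simp)
    have k3 := hreg 3 (by norm_num) (by simp)
    have k2 := hreg 2 (by norm_num) (by simp)
    have hq : s1.reg 103 < Es.length := by omega
    obtain ⟨x, hx⟩ : ∃ e, Es[s1.reg 103]? = some e := ⟨_, List.getElem?_eq_getElem hq⟩
    have htk : Es.take (s1.reg 103 + 1) = Es.take (s1.reg 103) ++ [x] := by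
      rw [List.take_add_one, hx]; rfl
    have hxE := hEs hx
    obtain ⟨L, hL, hLn, hLv, -⟩ := hP.row hxE
    have hLw := (hW x (List.mem_of_getElem? hxE)).length_le hLn hLv
    have hL' := hL.congr (fun _ _ => ⟨rfl, rfl⟩) (List.take_prefix _ _)
    have hix := hP.idx_eq hxE hP.zero
    have hrow : Es.map (digitCode L) = Es.map fun e => signCode (SignType.sign (digit e x)) := by
      refine List.map_congr_left fun e _ => ?_
      rw [digitCode_eq hLn, hLv]
    have hT : (5 * W + 20) * (Es.length + 1) * (Es.length - s1.reg 103) =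
        (5 * W + 20) * (Es.length + 1) * (Es.length - (s1.reg 103 + 1)) +
        (5 * W + 20) * (Es.length + 1) := by
      rw [show Es.length - s1.reg 103 = Es.length - (s1.reg 103 + 1) + 1 by omega]; ring
    have hT2 : (5 * L.length + 10) * Es.length + 10 ≤ (5 * W + 20) * (Es.length + 1) := by
      have : (5 * L.length + 10) * Es.length ≤ (5 * W + 20) * Es.length :=
        Nat.mul_le_mul_right _ (by omega)
      rw [mul_add]; omega
    rw [hT] at ht
    have key : ∀ s2 : St, s2.arr = s1.arr →
        (∀ r, r ≠ 104 → r ≠ 105 → r ≠ 108 → s2.reg r = s1.reg r) →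
        s2.out = s1.out ++ [if x = 0 then 1 else 0] → s2.tm = s1.tm + 6 →
        s2.reg 104 = s.arr 0 (s.arr 11 (s1.reg 103)) → s2.reg 105 = s.arr 1 (s.arr 11 (s1.reg 103)) →
        wp inp emitRowP (fun s' => wp inp (.inc 103 1) (fun s1' => (Emit {103, 104, 105, 106, 108}
          ((Es.take (s1'.reg 103)).flatMap (rowCode Es)) s s1' ∧
          s1'.reg 103 ≤ Es.length ∧
          s1'.tm + (5 * W + 20) * (Es.length + 1) * (Es.length - s1'.reg 103) ≤
          s.tm + (5 * W + 20) * (Es.length + 1) * Es.length) ∧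
          s1'.reg 102 - s1'.reg 103 < s1.reg 102 - s1.reg 103) s') s2 := by
      intro s2 g1 g2 g3 g4 g5 g6
      refine wp_mono (wp_emitRowP (E := E) (L := L) (Es := Es) ?_ ?_ ?_ hLn ?_ ?_) ?_
      · rw [g1, harr, g2 2 (by norm_num) (by norm_num) (by norm_num), k2]; exact hP
      · rw [g2 0 (by norm_num) (by norm_num) (by norm_num), k0, h0]
      · rw [g1, harr, g5, g6]; exact hL'
      · rw [g2 102 (by norm_num) (by norm_num) (by norm_num), k102, h102]
      · rw [g1, harr]; exact hEs
      · rintro s3 ⟨⟨hr3, ha3, ho3⟩, ht3⟩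
        have e103 : s3.reg 103 = s1.reg 103 := by
          rw [hr3 103 (by norm_num) (by simp), g2 103 (by norm_num) (by norm_num) (by norm_num)]
        have e102 : s3.reg 102 = s1.reg 102 := by
          rw [hr3 102 (by norm_num) (by simp), g2 102 (by norm_num) (by norm_num) (by norm_num)]
        simp only [wp_inc]
        refine ⟨⟨⟨fun r hr hr' => ?_, by simp [ha3, g1, harr], ?_⟩, by simp [e103]; omega, ?_⟩, ?_⟩
        · have h2 := hreg r hr hr'
          simp at hr'
          simp [hr'.1]
          rw [hr3 r hr (by simpa using hr'.2.2.2.1), g2 r hr'.2.1 hr'.2.2.1 hr'.2.2.2.2, h2]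
        · simp [e103, ho3, g3, hout, htk, rowCode, hrow]
        · simp [e103]; omega
        · simp [e103, e102]; omega
    simp only [rowsBody, wp_seq, wp_ld, wp_ifEq, wp_write]
    simp [-wp_inc, harr, k0, h0, k3, h3]
    refine ⟨fun h => key _ ?_ (fun r _ _ _ => ?_) ?_ ?_ ?_ ?_,
      fun h => key _ ?_ (fun r _ _ _ => ?_) ?_ ?_ ?_ ?_⟩
    · simp [harr]
    · simp [*]
    · simp [hix.1 h]
    · simp
    · simp
    · simp
    · simp [harr]
    · simp [*]
    · simp [mt hix.2 h]
    · simp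
    · simp
    · simp
  · rintro s1 ⟨⟨hreg, harr, hout⟩, hle, ht⟩ hlt
    have k102 := hreg 102 (by norm_num) (by simp)
    have h103' : s1.reg 103 = Es.length := by omega
    rw [h103'] at hout ht
    exact ⟨⟨hreg, harr, by simpa using hout⟩, by simp at ht ⊢; omega⟩

theorem Emit.trans {D D' D'' : Finset ℕ} {o o' : List ℕ} {s s' s'' : St} (h : Emit D o s s')
    (h' : Emit D' o' s' s'') (hD : D ⊆ D'') (hD' : D' ⊆ D'') : Emit D'' (o ++ o') s s'' :=
  ⟨fun r hr hr' => by rw [h'.reg r hr fun hc => hr' (hD' hc), h.reg r hr fun hc => hr' (hD hc)],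
    h'.arr.trans h.arr, by rw [h'.out, h.out, List.append_assoc]⟩

/-- Each of the at most `(Es.length + 1)^2` labels costs at most one search through an expansion of
length at most `W`. -/
theorem wp_emitP {inp s} {E Es : List ℕ} {L : List (ℕ × Bool)} {W : ℕ}
    (hP : Pool s.arr (s.reg 2) E) (hc : Consts s)
    (hL : HeapList s.arr E (s.reg 100) (s.reg 101) L) (hLn : IsNaf L)
    (h102 : s.reg 102 = Es.length)
    (hEs : ∀ {p e : ℕ}, Es[p]? = some e → E[s.arr 11 p]? = some e)
    (hW : ∀ e ∈ E, Wt (e : ℤ) W) (hLW : L.length ≤ W) :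
    wp inp emitP (fun s' => s'.out = s.out ++ (1 :: (Es.length + 1) :: (0 :: Es.map (digitCode L)) ++
      (List.replicate (Es.length + 1) 0 ++ Es.flatMap (rowCode Es))) ∧
      s'.tm ≤ s.tm + (5 * W + 40) * (Es.length + 1) ^ 2) s := by
  simp only [emitP, wp_seq, wp_write, wp_mov, wp_inc, wp_const]
  generalize hs1 : (((((((s.emit _).set 107 _).set 107 _).emit _).emit _).set 104 _).set 105 _) = s1
  have e1 : Emit {104, 105, 107} [1, Es.length + 1, 0] s s1 := by
    refine ⟨fun r _ hr => ?_, by simp [← hs1], by simp [← hs1, hc.one, hc.zero, h102]⟩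
    simp at hr
    simp [← hs1, hr]
  have t1 : s1.tm = s.tm + 7 := by simp [← hs1]
  have k2 := e1.reg 2 (by norm_num) (by simp)
  refine wp_mono (wp_emitRowP (E := E) (L := L) (Es := Es) ?_ ?_ ?_ hLn ?_ ?_) ?_
  · rw [e1.arr, k2]; exact hP
  · rw [e1.reg 0 (by norm_num) (by simp), hc.zero]
  · rw [e1.arr]; simpa [← hs1] using hL
  · rw [e1.reg 102 (by norm_num) (by simp), h102]
  · rw [e1.arr]; exact hEs
  rintro s2 ⟨e2, t2⟩
  have e12 := e1.trans e2 (D'' := {104, 105, 106, 107}) (by simp) (by decide)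
  have e107 : s2.reg 107 = Es.length + 1 := by
    rw [e2.reg 107 (by norm_num) (by simp)]; simp [← hs1, h102]
  refine wp_mono (wp_zeroRow ?_ ?_) ?_
  · simp [e12.reg 0, hc.zero]
  · simp
  rintro s3 ⟨e3, t3⟩
  have e3' : Emit {103} (List.replicate (Es.length + 1) 0) s2 s3 := by
    refine ⟨fun r hr hr' => ?_, by simpa using e3.arr, by simpa [e107] using e3.out⟩
    have := e3.reg r hr hr'
    simp at hr'
    simpa [hr'] using this
  have e13 := e12.trans e3' (D'' := {103, 104, 105, 106, 107}) (by decide) (by decide)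
  refine wp_mono (wp_rows (E := E) (Es := Es) (W := W) ?_ ?_ ?_ ?_ ?_ ?_ hW) ?_
  · simpa [e13.arr, e13.reg 2] using hP
  · simp [e13.reg 0, hc.zero]
  · simp [e13.reg 3, hc.one]
  · simp [e13.reg 102, h102]
  · simp
  · intro p e hp; simpa [e13.arr] using hEs hp
  rintro s4 ⟨e4, t4⟩
  refine ⟨?_, ?_⟩
  · rw [e4.out]; simp [e13.out]
  · simp [e107] at t3 t4
    have h1 : (5 * L.length + 10) * Es.length ≤ (5 * W + 10) * Es.length :=
      Nat.mul_le_mul_right _ (by omega)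
    have h2 : (5 * W + 40) * (Es.length + 1) ^ 2 = (5 * W + 20) * (Es.length + 1) * Es.length +
      (5 * W + 10) * Es.length + 10 * Es.length + 5 * W + 20 +
        20 * (Es.length * Es.length) + 40 * Es.length + 20 := by ring
    omega

/-! ### Search for the vertices -/

/-- What the search leaves unchanged. -/
structure Search (s s' : St) : Prop where
  reg : ∀ r, r < 5 ∨ 15 ≤ r → r ≠ 102 → r ≠ 103 → s'.reg r = s.reg r
  arr : ∀ c, c ≠ 10 → c ≠ 11 → s'.arr c = s.arr c
  out : s'.out = s.out

namespace Search

variable {s s' s'' : St}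

theorem refl (s : St) : Search s s := ⟨fun _ _ _ _ => rfl, fun _ _ _ => rfl, rfl⟩

theorem trans (h : Search s s') (h' : Search s' s'') : Search s s'' :=
  ⟨fun r h1 h2 h3 => (h'.reg r h1 h2 h3).trans (h.reg r h1 h2 h3),
    fun c h1 h2 => (h'.arr c h1 h2).trans (h.arr c h1 h2), h'.out.trans h.out⟩

theorem of_tick (h : Search s s') : Search s s'.tick := ⟨h.reg, h.arr, h.out⟩

theorem of_set (h : Search s s') {d v : ℕ} (hd : 5 ≤ d) (hd' : d < 15 ∨ d = 102 ∨ d = 103) :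
    Search s (s'.set d v) :=
  ⟨fun r h1 h2 h3 => by
    rw [St.set_reg, if_neg (by omega)]
    exact h.reg r h1 h2 h3, h.arr, h.out⟩

theorem of_put (h : Search s s') {c i v : ℕ} (hc : c = 10 ∨ c = 11) :
    Search s (s'.put c i v) :=
  ⟨h.reg, fun c' h1 h2 => by
    funext j
    rw [St.put_arr, if_neg (by omega), h.arr c' h1 h2], h.out⟩

theorem consts (h : Search s s') (hc : Consts s) : Consts s' :=
  ⟨by rw [h.reg 0 (by omega) (by omega) (by omega), hc.zero],
    by rw [h.reg 3 (by omega) (by omega) (by omega), hc.one],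
    by rw [h.reg 4 (by omega) (by omega) (by omega), hc.three]⟩

theorem heapList (h : Search s s') {E a b L} (hL : HeapList s.arr E a b L) :
    HeapList s'.arr E a b L :=
  hL.congr (fun x _ => by simp [h.arr]) (List.prefix_refl _)

theorem pool (h : Search s s') {E} (hP : Pool s.arr (s.reg 2) E) : Pool s'.arr (s'.reg 2) E :=
  hP.congr (fun x _ => by simp [h.arr]) (fun c hc => h.arr c (by omega) (by omega))
    (h.reg 2 (by omega) (by omega) (by omega)).ge

end Search

def clearBody : Prog := .st 10 103 0 ;; .inc 103 1

/-- Remove all marks. -/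
def clearP : Prog := .const 103 0 ;; .loop 103 1 clearBody

theorem wp_clearP {inp} {s : St} (h0 : s.reg 0 = 0) :
    wp inp clearP (fun s' => Search s s' ∧ (∀ i < s.reg 1, s'.arr 10 i = 0) ∧
      s'.tm ≤ s.tm + 3 * s.reg 1 + 2) s := by
  simp only [clearP, wp_seq, wp_const]
  refine wp_loop (fun s1 => Search s s1 ∧ s1.reg 103 ≤ s.reg 1 ∧ (∀ i < s1.reg 103, s1.arr 10 i = 0) ∧
    s1.tm ≤ s.tm + 3 * s1.reg 103 + 1) (fun s1 => s1.reg 1 - s1.reg 103) ?_ ?_ ?_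
  · exact ⟨(Search.refl s).of_set (by norm_num) (by norm_num), by simp, by simp, by simp⟩
  · rintro s1 ⟨h1, h2, h3, h4⟩ hlt
    have k0 := h1.reg 0 (by norm_num) (by norm_num) (by norm_num)
    have k1 := h1.reg 1 (by norm_num) (by norm_num) (by norm_num)
    simp only [clearBody, wp_seq, wp_st, wp_inc]
    refine ⟨⟨(h1.of_tick.of_put (by norm_num)).of_set (by norm_num) (by norm_num),
      by simp; omega, fun i hi => ?_, by simp; omega⟩, by simp; omega⟩
    simp at hi
    simp [k0, h0]
    intro hi'
    exact h3 i (by omega)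
  · rintro s1 ⟨h1, h2, h3, h4⟩ hlt
    have k1 := h1.reg 1 (by norm_num) (by norm_num) (by norm_num)
    exact ⟨h1.of_tick, fun i hi => h3 i (by omega), by simp; omega⟩

def markSegBody : Prog := .ld 12 4 10 ;; .st 10 12 3 ;; .inc 10 1

/-- Mark the indices in the list from `10` to `11`. -/
def markSegP : Prog := .loop 10 11 markSegBody

structure MarkSegInv (s : St) (E : List ℕ) (L : List (ℕ × Bool)) (n : ℕ) (s1 : St) : Prop where
  search : Search s s1
  finish : s1.reg 11 = s.reg 11
  pos : s1.reg 103 = s.reg 103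
  lists : ∃ M R, L = M ++ R ∧ HeapList s.arr E (s1.reg 10) (s.reg 11) R ∧
    (∀ i, s1.arr 10 i = 1 ↔ s.arr 10 i = 1 ∨ ∃ x ∈ M, E[i]? = some x.1) ∧
    s1.tm + 4 * R.length ≤ s.tm + n

theorem wp_markSegP {inp s} {E : List ℕ} {L : List (ℕ × Bool)} (hP : Pool s.arr (s.reg 2) E)
    (h3 : s.reg 3 = 1) (hL : HeapList s.arr E (s.reg 10) (s.reg 11) L) :
    wp inp markSegP (fun s' => Search s s' ∧ s'.reg 103 = s.reg 103 ∧
      (∀ i, s'.arr 10 i = 1 ↔ s.arr 10 i = 1 ∨ ∃ x ∈ L, E[i]? = some x.1) ∧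
      s'.tm ≤ s.tm + 4 * L.length + 1) s := by
  refine wp_loop (MarkSegInv s E L (4 * L.length)) (fun s => s.reg 11 - s.reg 10) ?_ ?_ ?_
  · exact ⟨Search.refl s, rfl, rfl, [], L, rfl, hL, by simp, by omega⟩
  · rintro s1 ⟨hs, h11, h103, M, R, rfl, hR, hm, ht⟩ hlt
    obtain ⟨f, b, R', rfl, hf, hb, hR'⟩ := hR.cons_inv (by omega)
    have k3 := hs.reg 3 (by norm_num) (by norm_num) (by norm_num)
    have k4 := hs.arr 4 (by norm_num) (by norm_num)
    simp only [markSegBody, wp_seq, wp_ld, wp_st, wp_inc]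
    refine ⟨⟨(((hs.of_tick.of_set (by norm_num) (by norm_num)).of_put (by norm_num)).of_set
      (by norm_num) (by norm_num)), by simpa, by simpa, M ++ [(f, b)], R', by simp, by simpa,
      fun i => ?_, by simp at ht ⊢; omega⟩, by simp; omega⟩
    simp [k3, h3, k4]
    by_cases hi : i = s.arr 4 (s1.reg 10)
    · simp [hi, hf]
    · have : E[i]? ≠ some f := fun hc => hi (hP.inj hc hf)
      simp [hi, hm i, this]
  · rintro s1 ⟨hs, h11, h103, M, R, rfl, hR, hm, ht⟩ hlt
    obtain rfl := hR.nil_inv (by omega)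
    exact ⟨hs.of_tick, h103, by simpa using hm, by simp at ht ⊢; omega⟩

/-- The exponents of the vertices of the normal circuit for `n`. -/
inductive Reach (n : ℤ) : ℕ → Prop
  | mark {e : ℕ} (h : digit e n ≠ 0) : Reach n e
  | step {x e : ℕ} (hx : Reach n x) (h : digit e x ≠ 0) : Reach n e

theorem digit_ne_zero_iff {L : List (ℕ × Bool)} {e : ℕ} {n : ℤ} (hL : IsNaf L) (hv : val L = n) :
    digit e n ≠ 0 ↔ ∃ x ∈ L, x.1 = e := by
  rw [← hv, digit_val hL, coeff_ne_zero]
  constructor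
  · rintro ⟨b, hb⟩; exact ⟨_, hb, rfl⟩
  · rintro ⟨⟨_, b⟩, hb, rfl⟩; exact ⟨b, hb⟩

theorem HeapList.exists_index {A : ℕ → ℕ → ℕ} {E : List ℕ} {a b : ℕ} {L : List (ℕ × Bool)}
    (h : HeapList A E a b L) {x : ℕ × Bool} (hx : x ∈ L) :
    ∃ i : ℕ, E[i]? = some x.1 := by
  obtain ⟨q, hq, rfl⟩ := List.getElem_of_mem hx
  exact ⟨_, (h.get q hq).1⟩

/-- The pool contains the exponents of the list and of each of its own rows, so it contains
everything reachable. -/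
theorem Reach.exists_index {A : ℕ → ℕ → ℕ} {E : List ℕ} {a b hp : ℕ} {L : List (ℕ × Bool)} {n : ℤ}
    (hP : Pool A hp E) (hL : HeapList A E a b L) (hLn : IsNaf L) (hv : val L = n) {e : ℕ} (h : Reach n e) : ∃ i : ℕ, E[i]? = some e := by
  induction h with
  | mark h =>
    obtain ⟨x, hx, rfl⟩ := (digit_ne_zero_iff hLn hv).1 h
    exact hL.exists_index hx
  | step _ h ih =>
    obtain ⟨i, hi⟩ := ih
    obtain ⟨M, hM, hMn, hMv, -⟩ := hP.row hi
    obtain ⟨x, hx, rfl⟩ := (digit_ne_zero_iff hMn hMv).1 h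
    exact (hM.congr (fun _ _ => ⟨rfl, rfl⟩) (List.take_prefix _ _)).exists_index hx

/-- Rows refer to smaller indices only, so a single pass through the indices in descending order
marks everything that can be reached. -/
def closureBody : Prog :=
  .sub 103 103 3 ;; .ld 13 10 103 ;;
  .ifEq 13 3 (.ld 10 0 103 ;; .ld 11 1 103 ;; markSegP) (.mov 13 0)

/-- Mark the indices of all vertices that can be reached. -/
def closureP : Prog := .mov 103 1 ;; .loop 0 103 closureBody

structure ClosureInv (s : St) (E : List ℕ) (n : ℤ) (T m : ℕ) (s1 : St) : Prop where
  search : Search s s1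
  le : s1.reg 103 ≤ E.length
  sound : ∀ i e : ℕ, E[i]? = some e → s1.arr 10 i = 1 → Reach n e
  base : ∀ i e : ℕ, digit e n ≠ 0 → E[i]? = some e → s1.arr 10 i = 1
  closed : ∀ i x j e : ℕ, s1.reg 103 ≤ i → s1.arr 10 i = 1 → E[i]? = some x → digit e x ≠ 0 →
    E[j]? = some e → s1.arr 10 j = 1
  time : s1.tm + T * s1.reg 103 ≤ s.tm + m

theorem wp_closureBody {inp s s1} {E : List ℕ} {n : ℤ} {W m : ℕ}
    (hP : Pool s.arr (s.reg 2) E) (hc : Consts s) (hW : ∀ e ∈ E, Wt (e : ℤ) W)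
    (hI : ClosureInv s E n (4 * W + 10) m s1) (hlt : s1.reg 0 < s1.reg 103) :
    wp inp closureBody (fun s2 => ClosureInv s E n (4 * W + 10) m s2 ∧
      s2.reg 103 < s1.reg 103) s1.tick := by
  obtain ⟨hs, hle, hsound, hbase, hclosed, ht⟩ := hI
  have hc1 := hs.consts hc
  have hP1 := hs.pool hP
  obtain ⟨j, hj⟩ : ∃ j, s1.reg 103 = j + 1 := ⟨s1.reg 103 - 1, by omega⟩
  rw [hj, mul_add] at ht
  obtain ⟨x, hx⟩ : ∃ x, E[j]? = some x := ⟨_, List.getElem?_eq_getElem (by omega)⟩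
  obtain ⟨L, hL, hLn, hLv, -⟩ := hP1.row hx
  have hLw := (hW x (List.mem_of_getElem? hx)).length_le hLn hLv
  have hL' := hL.congr (A' := s1.arr) (fun _ _ => ⟨rfl, rfl⟩) (List.take_prefix _ _)
  simp only [closureBody, wp_seq, wp_sub, wp_ld, wp_ifEq, wp_mov]
  simp [hc1.one, hj]
  refine ⟨fun h => ?_, fun h => ⟨?_, ?_, by simpa using hsound, by simpa using hbase, ?_, ?_⟩⟩
  · generalize hs2 : ((((s1.tick.set 103 _).set 13 _).tick.set 10 _).set 11 _) = s2
    have hs12 : Search s1 s2 := by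
      rw [← hs2]
      repeat' (first | exact Search.refl _ | refine Search.of_tick ?_ |
          refine Search.of_set ?_ (by norm_num) (by norm_num))
    have a2 : s2.arr = s1.arr := by simp [← hs2]
    have r2 : s2.reg 103 = j := by simp [← hs2]
    have t2 : s2.tm = s1.tm + 6 := by simp [← hs2]
    refine wp_mono (wp_markSegP (E := E) (L := L) (hs12.pool hP1) (hs12.consts hc1).one ?_) ?_
    · rw [a2]; simpa [← hs2] using hL'
    rintro s3 ⟨hs23, r3, m3, t3⟩
    have hmono : ∀ i, s1.arr 10 i = 1 → s3.arr 10 i = 1 := fun i hi =>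
      (m3 i).2 (Or.inl (by rwa [a2]))
    refine ⟨⟨(hs.trans hs12).trans hs23, by omega, fun i e hi hmi => ?_, fun i e he hi =>
      hmono i (hbase i e he hi), fun i y i' e hi hmi hy he hi' => ?_, ?_⟩, by omega⟩
    · rcases (m3 i).1 hmi with hi' | ⟨y, hy, hi'⟩
      · exact hsound i e hi (by rwa [← a2])
      · exact (hsound j x hx h).step ((digit_ne_zero_iff hLn hLv).2
          ⟨y, hy, by simpa using hi'.symm.trans hi⟩)
    · rw [r3, r2] at hi
      by_cases hij : i = j
      · subst hij
        obtain rfl : x = y := by simpa using hx.symm.trans hy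
        obtain ⟨w, hw, rfl⟩ := (digit_ne_zero_iff hLn hLv).1 he
        exact (m3 i').2 (Or.inr ⟨w, hw, hi'⟩)
      -- Marks set in this pass have indices below `j`. A marked index above `j` was therefore
      -- marked before, and the invariant applies to it.
      · refine hmono i' (hclosed i y i' e (by omega) ?_ hy he hi')
        rcases (m3 i).1 hmi with h' | ⟨w, hw, hwi⟩
        · rwa [← a2]
        · obtain ⟨i₂, h₂⟩ := hL.exists_index hw
          have h₃ := (List.getElem?_eq_some_iff.1 h₂).1
          rw [List.getElem?_take_of_lt (by simp at h₃; omega)] at h₂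
          have := hP1.inj hwi h₂
          simp at h₃
          omega
    · rw [r3, r2]; omega
  · repeat' (first | exact hs | refine Search.of_tick ?_ |
          refine Search.of_set ?_ (by norm_num) (by norm_num))
  · simp; omega
  · intro i y i' e hi hmi hy he hi'
    simp at hi hmi ⊢
    refine hclosed i y i' e ?_ hmi hy he hi'
    by_contra hc
    obtain rfl : i = j := by omega
    exact h hmi
  · simp; omega

theorem wp_closureP {inp s} {E : List ℕ} {L : List (ℕ × Bool)} {n : ℤ} {W a b : ℕ}
    (hP : Pool s.arr (s.reg 2) E) (hc : Consts s) (hm : s.reg 1 = E.length)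
    (hW : ∀ e ∈ E, Wt (e : ℤ) W) (hL : HeapList s.arr E a b L) (hLn : IsNaf L) (hv : val L = n)
    (hmark : ∀ {i e : ℕ}, E[i]? = some e → (s.arr 10 i = 1 ↔ digit e n ≠ 0)) :
    wp inp closureP (fun s' => Search s s' ∧
      (∀ {i e : ℕ}, E[i]? = some e → (s'.arr 10 i = 1 ↔ Reach n e)) ∧
      s'.tm ≤ s.tm + (4 * W + 10) * E.length + 2) s := by
  simp only [closureP, wp_seq, wp_mov]
  refine wp_loop (ClosureInv s E n (4 * W + 10) ((4 * W + 10) * E.length + 1))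
    (fun s => s.reg 103) ?_ (fun s1 => wp_closureBody hP hc hW) ?_
  · refine ⟨(Search.refl s).of_set (by norm_num) (by norm_num), by simp [hm], ?_, ?_, ?_,
      by simp [hm]; omega⟩
    · exact fun i e hi h => .mark ((hmark hi).1 h)
    · exact fun i e he hi => (hmark hi).2 he
    · intro i x j e hi _ hx
      have := (List.getElem?_eq_some_iff.1 hx).1
      simp [hm] at hi
      omega
  · rintro s1 ⟨hs, hle, hsound, hbase, hclosed, ht⟩ hlt
    have h0 := (hs.consts hc).zero
    refine ⟨hs.of_tick, fun {i e} hi => ⟨hsound i e hi, fun h => ?_⟩, ?_⟩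
    · induction h generalizing i with
      | mark h => exact hbase i _ h hi
      | step hx h ih =>
        obtain ⟨j, hj⟩ := hx.exists_index hP hL hLn hv
        exact hclosed j _ i _ (by omega) (ih hj) hj h hi
    · simp; omega

def collectBody : Prog :=
  .ld 13 10 103 ;; .ifEq 13 3 (.st 11 102 103 ;; .inc 102 1) (.mov 13 0) ;; .inc 103 1

/-- List the marked indices in the array `11`. -/
def collectP : Prog := .const 102 0 ;; .const 103 0 ;; .loop 103 1 collectBody

structure CollectInv (s : St) (E : List ℕ) (n : ℤ) (s1 : St) : Prop where
  search : Search s s1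
  le : s1.reg 103 ≤ E.length
  marks : s1.arr 10 = s.arr 10
  time : s1.tm ≤ s.tm + 6 * s1.reg 103 + 2
  list : ∃ Es : List ℕ, s1.reg 102 = Es.length ∧ Es.length ≤ s1.reg 103 ∧ Es.Nodup ∧
    (∀ {p e : ℕ}, Es[p]? = some e → E[s1.arr 11 p]? = some e) ∧
    ∀ e, e ∈ Es ↔ Reach n e ∧ e ∈ E.take (s1.reg 103)

theorem wp_collectP {inp s} {E : List ℕ} {n : ℤ} (hE : E.Nodup) (h3 : s.reg 3 = 1)
    (hm : s.reg 1 = E.length)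
    (hmark : ∀ {i e : ℕ}, E[i]? = some e → (s.arr 10 i = 1 ↔ Reach n e)) :
    wp inp collectP (fun s' => Search s s' ∧ s'.tm ≤ s.tm + 6 * E.length + 3 ∧
      ∃ Es : List ℕ, s'.reg 102 = Es.length ∧ Es.length ≤ E.length ∧ Es.Nodup ∧
        (∀ {p e : ℕ}, Es[p]? = some e → E[s'.arr 11 p]? = some e) ∧
        ∀ e, e ∈ Es ↔ Reach n e ∧ e ∈ E) s := by
  simp only [collectP, wp_seq, wp_const]
  refine wp_loop (CollectInv s E n) (fun s => s.reg 1 - s.reg 103) ?_ ?_ ?_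
  · refine ⟨((Search.refl s).of_set (by norm_num) (by norm_num)).of_set (by norm_num) (by norm_num),
      by simp, by simp, by simp, [], by simp⟩
  · rintro s1 ⟨hs, hle, hmk, ht, Es, h102, hlen, hnd, hEs, hmem⟩ hlt
    have k1 := hs.reg 1 (by norm_num) (by norm_num) (by norm_num)
    have k3 := hs.reg 3 (by norm_num) (by norm_num) (by norm_num)
    have hj : s1.reg 103 < E.length := by omega
    obtain ⟨x, hx⟩ : ∃ x, E[s1.reg 103]? = some x := ⟨_, List.getElem?_eq_getElem hj⟩
    have htk : E.take (s1.reg 103 + 1) = E.take (s1.reg 103) ++ [x] := by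
      rw [List.take_add_one, hx]; rfl
    have hxn : x ∉ E.take (s1.reg 103) := by
      have h4 := hE.sublist (List.take_sublist (s1.reg 103 + 1) E)
      rw [htk, List.nodup_append] at h4
      intro hc
      exact h4.2.2 x hc x (by simp) rfl
    have hmx := hmark hx
    simp only [collectBody, wp_seq, wp_ld, wp_ifEq, wp_st, wp_inc, wp_mov]
    simp only [St.tick_reg, St.tick_arr, St.set_reg, if_true, hmk, k3, h3]
    refine ⟨fun h => ⟨⟨?_, ?_, ?_, ?_, Es ++ [x], ?_, ?_, ?_, ?_, ?_⟩, ?_⟩,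
      fun h => ⟨⟨?_, ?_, ?_, ?_, Es, ?_, ?_, hnd, ?_, ?_⟩, ?_⟩⟩
    · repeat' (first | exact hs | refine Search.of_tick ?_ |
          refine Search.of_set ?_ (by norm_num) (by norm_num) | refine Search.of_put ?_ (by norm_num))
    · simp; omega
    · funext i; simp [hmk]
    · simp; omega
    · simp [h102]
    · simp; omega
    · rw [List.nodup_append]
      refine ⟨hnd, by simp, fun a ha b hb => ?_⟩
      rintro rfl
      obtain rfl : a = x := by simpa using hb
      exact hxn ((hmem a).1 ha).2
    · intro p e hp
      simp [h102]
      rcases lt_trichotomy p Es.length with hp' | hp' | hp'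
      · rw [List.getElem?_append_left hp'] at hp
        simpa [hp'.ne] using hEs hp
      · subst hp'
        obtain rfl : x = e := by simpa using hp
        simpa using hx
      · rw [List.getElem?_eq_none (by simp; omega)] at hp
        simp at hp
    · intro e
      have h4 := hmx.1 h
      simp [htk, hmem]
      constructor
      · rintro (⟨h5, h6⟩ | rfl)
        · exact ⟨h5, Or.inl h6⟩
        · exact ⟨h4, Or.inr rfl⟩
      · rintro ⟨h5, h6 | h6⟩
        · exact Or.inl ⟨h5, h6⟩
        · exact Or.inr h6
    · simp; omega
    · repeat' (first | exact hs | refine Search.of_tick ?_ |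
          refine Search.of_set ?_ (by norm_num) (by norm_num))
    · simp; omega
    · simp [hmk]
    · simp; omega
    · simp [h102]
    · simp; omega
    · intro p e hp; simpa using hEs hp
    · intro e
      have h4 := mt hmx.2 h
      simp [htk, hmem]
      exact fun h5 h6 => absurd (h6 ▸ h5) h4
    · simp; omega
  · rintro s1 ⟨hs, hle, hmk, ht, Es, h102, hlen, hnd, hEs, hmem⟩ hlt
    have k1 := hs.reg 1 (by norm_num) (by norm_num) (by norm_num)
    have h103 : s1.reg 103 = E.length := by omega
    rw [h103] at ht hlen hmem
    exact ⟨hs.of_tick, by simp; omega, Es, h102, hlen, hnd, hEs, by simpa using hmem⟩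

/-- Output the normal circuit for the number given by the list from `100` to `101`. -/
def circuitP : Prog :=
  clearP ;; .mov 10 100 ;; .mov 11 101 ;; markSegP ;; closureP ;; collectP ;; emitP

theorem wp_circuitP {inp s} {E : List ℕ} {L : List (ℕ × Bool)} {n : ℤ} {W : ℕ}
    (hP : Pool s.arr (s.reg 2) E) (hc : Consts s) (hm : s.reg 1 = E.length)
    (hW : ∀ e ∈ E, Wt (e : ℤ) W) (hL : HeapList s.arr E (s.reg 100) (s.reg 101) L)
    (hLn : IsNaf L) (hv : val L = n) (hLW : L.length ≤ W) :
    wp inp circuitP (fun s' => ∃ Es : List ℕ, Es.Nodup ∧ (∀ e, e ∈ Es ↔ Reach n e) ∧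
      s'.out = s.out ++ (1 :: (Es.length + 1) :: (0 :: Es.map (digitCode L)) ++
        (List.replicate (Es.length + 1) 0 ++ Es.flatMap (rowCode Es))) ∧
      s'.tm ≤ s.tm + (20 * W + 80) * (E.length + 1) ^ 2) s := by
  simp only [circuitP, wp_seq]
  refine wp_mono (wp_clearP hc.zero) ?_
  rintro s1 ⟨hs1, hz, t1⟩
  simp only [wp_mov]
  have hs2 := (hs1.of_set (d := 10) (v := s1.reg 100) (by norm_num) (by norm_num)).of_set (d := 11)
    (v := (s1.set 10 (s1.reg 100)).reg 101) (by norm_num) (by norm_num)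
  have a100 := hs1.reg 100 (by norm_num) (by norm_num) (by norm_num)
  have a101 := hs1.reg 101 (by norm_num) (by norm_num) (by norm_num)
  refine wp_mono (wp_markSegP (E := E) (L := L) (hs2.pool hP) (hs2.consts hc).one
    (hs2.heapList (by simpa [a100, a101] using hL))) ?_
  rintro s3 ⟨hs3, -, m3, t3⟩
  have hs13 := hs2.trans hs3
  refine wp_mono (wp_closureP (E := E) (L := L) (n := n) (W := W) (a := s.reg 100) (b := s.reg 101)
    (hs13.pool hP) (hs13.consts hc) ?_ hW (hs13.heapList hL) hLn hv fun {i e} hi => ?_) ?_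
  · rw [hs13.reg 1 (by norm_num) (by norm_num) (by norm_num), hm]
  · have h1 := hz i (by rw [hm]; exact (List.getElem?_eq_some_iff.1 hi).1)
    rw [m3 i, digit_ne_zero_iff hLn hv, hi]
    simp [h1, eq_comm]
  rintro s4 ⟨hs4, m4, t4⟩
  have hs14 := hs13.trans hs4
  refine wp_mono (wp_collectP (E := E) (n := n) hP.nodup (hs14.consts hc).one ?_ m4) ?_
  · rw [hs14.reg 1 (by norm_num) (by norm_num) (by norm_num), hm]
  rintro s5 ⟨hs5, t5, Es, h102, hlen, hnd, hEs, hmem⟩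
  have hs15 := hs14.trans hs5
  refine wp_mono (wp_emitP (E := E) (Es := Es) (L := L) (W := W) (hs15.pool hP) (hs15.consts hc) ?_
    hLn h102 hEs hW hLW) ?_
  · rw [hs15.reg 100 (by norm_num) (by norm_num) (by norm_num),
      hs15.reg 101 (by norm_num) (by norm_num) (by norm_num)]
    exact hs15.heapList hL
  rintro s6 ⟨o6, t6⟩
  refine ⟨Es, hnd, fun e => ⟨fun h => ((hmem e).1 h).1, fun h => (hmem e).2 ⟨h, ?_⟩⟩,
    by rw [o6, hs15.out], ?_⟩
  · obtain ⟨i, hi⟩ := h.exists_index hP hL hLn hv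
    exact List.mem_of_getElem? hi
  · have h1 : (5 * W + 40) * (Es.length + 1) ^ 2 ≤ (5 * W + 40) * (E.length + 1) ^ 2 := by gcongr
    have h2 : (20 * W + 80) * (E.length + 1) ^ 2 = (5 * W + 40) * (E.length + 1) ^ 2 +
      15 * (W * (E.length * E.length)) + 30 * (W * E.length) + 15 * W + 40 * (E.length * E.length) +
        80 * E.length + 40 := by ring
    have h3 : (4 * W + 10) * E.length = 4 * (W * E.length) + 10 * E.length := by ring
    simp [hm] at t1 t3
    omega

/-! ### The circuit with given exponents -/

theorem cast_sign_digit (i : ℕ) (n : ℤ) : (SignType.sign (digit i n) : ℤ) = digit i n := by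
  rcases digit_mem i n with h | h | h <;> rw [h] <;> rfl

/-- The circuit with the exponents `Es`, for the number `n`; the vertex `0` is the zero vertex. -/
noncomputable def listCircuit (Es : List ℕ) (n : ℤ) (hn : ∃ e ∈ Es, digit e n ≠ 0) :
    PowerCircuit (Fin (Es.length + 1)) where
  edge := Fin.cons (fun _ => 0) fun u =>
    Fin.cons (if Es[u] = 0 then 1 else 0) fun v => SignType.sign (digit Es[v] Es[u])
  mark := Fin.cons 0 fun v => SignType.sign (digit Es[v] n)
  acyclic v h := by
    -- The level of a vertex, `0` for the zero vertex and otherwise the exponent plus one, decreases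
    -- along every edge.
    have key : ∀ u w : Fin (Es.length + 1),
        Relation.TransGen (fun a b => (Fin.cons (α := fun _ => Fin (Es.length + 1) → SignType)
          (fun _ => 0) (fun u : Fin Es.length => Fin.cons (α := fun _ => SignType)
          (if Es[u] = 0 then 1 else 0) fun v => SignType.sign (digit Es[v] Es[u])) a) b ≠ 0) u w →
        (Fin.cons (α := fun _ => ℕ) 0 (fun i : Fin Es.length => Es[i] + 1) : _ → ℕ) w <
          (Fin.cons (α := fun _ => ℕ) 0 (fun i : Fin Es.length => Es[i] + 1) : _ → ℕ) u := by
      intro u w h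
      refine Relation.TransGen.trans_induction_on (motive := fun {u w} _ =>
        (Fin.cons (α := fun _ => ℕ) 0 (fun i : Fin Es.length => Es[i] + 1) : _ → ℕ) w <
          (Fin.cons (α := fun _ => ℕ) 0 (fun i : Fin Es.length => Es[i] + 1) : _ → ℕ) u) h ?_
        (fun _ _ h1 h2 => h2.trans h1)
      intro a b hab
      cases a using Fin.cases with
      | zero => simp at hab
      | succ a =>
        cases b using Fin.cases with
        | zero => simp
        | succ b =>
          simp only [Fin.cons_succ, ne_eq, sign_eq_zero_iff] at hab ⊢
          exact Nat.succ_lt_succ (lt_of_digit_ne_zero hab)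
    exact (key v v h).false
  marked_nonempty := by
    obtain ⟨e, he, h⟩ := hn
    obtain ⟨i, hi, rfl⟩ := List.getElem_of_mem he
    exact ⟨Fin.succ ⟨i, hi⟩, by rw [Fin.cons_succ]; simpa using h⟩

section

variable {Es : List ℕ} {n : ℤ} {hn : ∃ e ∈ Es, digit e n ≠ 0}

theorem exists_succ_getElem {e : ℕ} (he : e ∈ Es) : ∃ v : Fin Es.length, Es[v] = e := by
  obtain ⟨i, hi, rfl⟩ := List.getElem_of_mem he
  exact ⟨⟨i, hi⟩, rfl⟩

theorem listCircuit_coded (hnd : Es.Nodup) (hEs : ∀ e, e ∈ Es ↔ Reach n e) :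
    Coded (listCircuit Es n hn) 0 (Fin.cons 0 fun i => Es[i]) n := by
  have hmem : ∀ v : Fin Es.length, Es[v] ∈ Es := fun v => List.getElem_mem v.2
  have hedge : ∀ u v : Fin Es.length, (listCircuit Es n hn).edge u.succ v.succ =
      SignType.sign (digit Es[v] Es[u]) := fun u v => by simp [listCircuit]
  have hedge0 : ∀ u : Fin Es.length, (listCircuit Es n hn).edge u.succ 0 =
      if Es[u] = 0 then 1 else 0 := fun u => by simp [listCircuit]
  have hmark : ∀ v : Fin Es.length, (listCircuit Es n hn).mark v.succ =
      SignType.sign (digit Es[v] n) := fun v => by simp [listCircuit]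
  have hreach : ∀ e, Reach n e → ∀ v : Fin Es.length, Es[v] = e →
      ∃ m, (listCircuit Es n hn).mark m ≠ 0 ∧
        Relation.ReflTransGen (fun a b => (listCircuit Es n hn).edge a b ≠ 0) m v.succ := by
    intro e h
    induction h with
    | mark h =>
      rintro v rfl
      exact ⟨_, by rw [hmark]; simpa using h, .refl⟩
    | step hx h ih =>
      rintro v rfl
      obtain ⟨u, rfl⟩ := exists_succ_getElem ((hEs _).2 hx)
      obtain ⟨m, h1, h2⟩ := ih u rfl
      exact ⟨m, h1, h2.tail (by rw [hedge]; simpa using h)⟩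
  -- Descending through nonzero digits from any reachable exponent ends at `0`; so the zero vertex
  -- is reachable too.
  have hzero : ∀ k e : ℕ, e = k → Reach n e → Reach n 0 := by
    intro k
    induction k using Nat.strong_induction_on with
    | _ k ih =>
      rintro e rfl h
      by_cases h0 : e = 0
      · rwa [h0] at h
      · obtain ⟨i, hi⟩ := exists_digit_ne_zero (n := (e : ℤ)) (by exact_mod_cast h0)
        exact ih i (lt_of_digit_ne_zero hi) i rfl (h.step hi)
  refine ⟨fun u v hu hv h => ?_, fun v => by simp [listCircuit], fun v hv => ?_,
    fun u v hu hv => ?_, by simp [listCircuit], fun v hv => ?_, fun v hv i hi => ?_,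
    fun i hi => ?_, fun v => ?_⟩
  · obtain ⟨u, rfl⟩ := Fin.exists_succ_eq.2 hu
    obtain ⟨v, rfl⟩ := Fin.exists_succ_eq.2 hv
    simp only [Fin.cons_succ] at h
    rw [Fin.ext ((List.Nodup.getElem_inj_iff hnd).1 h)]
  · obtain ⟨v, rfl⟩ := Fin.exists_succ_eq.2 hv
    rw [hedge0, Fin.cons_succ]
  · obtain ⟨u, rfl⟩ := Fin.exists_succ_eq.2 hu
    obtain ⟨v, rfl⟩ := Fin.exists_succ_eq.2 hv
    rw [hedge, Fin.cons_succ, Fin.cons_succ, cast_sign_digit]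
  · obtain ⟨v, rfl⟩ := Fin.exists_succ_eq.2 hv
    rw [hmark, Fin.cons_succ, cast_sign_digit]
  · obtain ⟨v, rfl⟩ := Fin.exists_succ_eq.2 hv
    rw [Fin.cons_succ] at hi
    obtain ⟨u, rfl⟩ := exists_succ_getElem ((hEs _).2 (((hEs _).1 (hmem v)).step hi))
    exact ⟨u.succ, Fin.succ_ne_zero u, by rw [Fin.cons_succ]⟩
  · obtain ⟨u, rfl⟩ := exists_succ_getElem ((hEs _).2 (.mark hi))
    exact ⟨u.succ, Fin.succ_ne_zero u, by rw [Fin.cons_succ]⟩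
  · cases v using Fin.cases with
    | zero =>
      obtain ⟨e, he, -⟩ := id hn
      have h0 := hzero e e rfl ((hEs e).1 he)
      obtain ⟨v, hv⟩ := exists_succ_getElem ((hEs 0).2 h0)
      obtain ⟨m, h1, h2⟩ := hreach 0 h0 v hv
      exact ⟨m, h1, h2.tail (by rw [hedge0, if_pos hv]; decide)⟩
    | succ v => exact hreach _ ((hEs _).1 (hmem v)) v rfl

theorem ofFn_getElem_map {α : Type} (f : ℕ → α) :
    (List.ofFn fun v : Fin Es.length => f Es[v]) = Es.map f := by
  refine List.ext_getElem (by simp) fun i h1 h2 => by simp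

theorem encodeCircuit_listCircuit {L : List (ℕ × Bool)} (hL : IsNaf L) (hv : val L = n) :
    encodeCircuit (listCircuit Es n hn) = (Es.length + 1) :: (0 :: Es.map (digitCode L)) ++
      (List.replicate (Es.length + 1) 0 ++ Es.flatMap (rowCode Es)) := by
  unfold encodeCircuit
  simp only [List.ofFn_succ (n := Es.length), listCircuit, Fin.cons_zero, Fin.cons_succ]
  have h1 : (Es.map fun e => signCode (SignType.sign (digit e n))) = Es.map (digitCode L) :=
    List.map_congr_left fun e _ => by rw [digitCode_eq hL, hv]
  have h2 : ∀ x : ℕ, (signCode (if x = 0 then 1 else 0) ::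
      List.ofFn fun v : Fin Es.length => signCode (SignType.sign (digit Es[v] x))) = rowCode Es x := by
    intro x
    rw [ofFn_getElem_map fun e => signCode (SignType.sign (digit e x)), rowCode]
    congr 1
    split_ifs <;> rfl
  rw [ofFn_getElem_map fun e => signCode (SignType.sign (digit e n)), h1]
  simp only [h2]
  rw [ofFn_getElem_map fun x => rowCode Es x]
  have h3 : signCode 0 = 0 := rfl
  simp [h3, List.replicate_succ, List.flatMap]

end

def trivialP : Prog := .write 3 ;; .write 3 ;; .write 3 ;; .write 0

/-- Output the normal circuit for the number at the bottom of the stack. -/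
def outP : Prog := .ld 100 6 0 ;; .ld 101 7 0 ;; .ifLt 100 101 circuitP trivialP

theorem wp_outP {inp s} {E : List ℕ} {L : List (ℕ × Bool)} {n : ℤ} {W : ℕ}
    (hP : Pool s.arr (s.reg 2) E) (hc : Consts s) (hm : s.reg 1 = E.length)
    (hW : ∀ e ∈ E, Wt (e : ℤ) W) (hL : HeapList s.arr E (s.arr 6 0) (s.arr 7 0) L)
    (hLn : IsNaf L) (hv : val L = n) (hLW : L.length ≤ W) (hout : s.out = []) :
    wp inp outP (fun s' => (∃ (m : ℕ) (P : PowerCircuit (Fin m)),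
      P.IsNormalCircuitOf n ∧ s'.out = 1 :: encodeCircuit P) ∧
      s'.tm ≤ s.tm + (20 * W + 90) * (E.length + 1) ^ 2) s := by
  have h1 : 1 ≤ (E.length + 1) ^ 2 := Nat.one_le_pow _ _ (by omega)
  have h2 : (20 * W + 90) * (E.length + 1) ^ 2 = (20 * W + 80) * (E.length + 1) ^ 2 +
    10 * (E.length + 1) ^ 2 := by ring
  simp only [outP, wp_seq, wp_ld, wp_ifLt]
  simp only [St.set_reg, St.set_arr, hc.zero]
  refine ⟨fun h => ?_, fun h => ?_⟩
  · generalize hs1 : ((s.set 100 _).set 101 _).tick = s1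
    have a1 : s1.arr = s.arr := by simp [← hs1]
    have r1 : ∀ r < 100, s1.reg r = s.reg r := fun r hr => by
      simp [← hs1, show r ≠ 100 by omega, show r ≠ 101 by omega]
    have t1 : s1.tm = s.tm + 3 := by simp [← hs1]
    refine wp_mono (wp_circuitP (E := E) (L := L) (n := n) (W := W) ?_ ?_ ?_ hW ?_ hLn hv hLW) ?_
    · rw [a1, r1 2 (by norm_num)]; exact hP
    · exact ⟨by rw [r1 0 (by norm_num), hc.zero], by rw [r1 3 (by norm_num), hc.one],
        by rw [r1 4 (by norm_num), hc.three]⟩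
    · rw [r1 1 (by norm_num), hm]
    · rw [a1]; simpa [← hs1, hc.zero] using hL
    rintro s2 ⟨Es, hnd, hEs, ho, ht⟩
    have hne : ∃ e ∈ Es, digit e n ≠ 0 := by
      obtain ⟨e, b, M, rfl, -⟩ := hL.cons_inv (by simpa [hc.zero] using h)
      have h3 := (digit_ne_zero_iff hLn hv).2 ⟨_, List.mem_cons_self, rfl⟩
      exact ⟨_, (hEs _).2 (.mark h3), h3⟩
    refine ⟨⟨_, listCircuit Es n hne, (listCircuit_coded hnd hEs).isNormalCircuitOf, ?_⟩, by omega⟩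
    rw [ho, encodeCircuit_listCircuit hLn hv]
    simp [← hs1, hout]
  · obtain rfl := hL.nil_inv (by simpa [hc.zero] using h)
    obtain rfl : 0 = n := by simpa using hv
    simp only [trivialP, wp_seq, wp_write]
    refine ⟨⟨1, trivialCircuit, trivialCircuit_isNormalCircuitOf, ?_⟩, by simp; omega⟩
    simp [hc.one, hc.zero, hout, encodeCircuit, trivialCircuit]
    exact ⟨rfl, rfl⟩

/-! ### The input -/

theorem getD_append_append {pre l post : List ℕ} {i : ℕ} (hi : i < l.length) :
    (pre ++ l ++ post).getD (pre.length + i) 0 = l.getD i 0 := by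
  rw [List.append_assoc, List.getD_append_right _ _ _ _ (by omega), Nat.add_sub_cancel_left,
    List.getD_append _ _ _ _ hi]

theorem numeralAt_of_append {pre post : List ℕ} {n : ℤ} {p : ℕ}
    (h : (pre ++ numeral n ++ post).getD p 0 = pre.length) :
    NumeralAt (pre ++ numeral n ++ post) p n := by
  have hl : (numeral n).length = n.natAbs.bits.length + 2 := by simp [numeral]
  refine ⟨_, h, ?_, ?_, fun i hi => ?_⟩
  · have := getD_append_append (pre := pre) (l := numeral n) (post := post) (i := 0) (by omega)
    rw [add_zero] at this
    rw [this]; rfl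
  · rw [getD_append_append (by omega)]; rfl
  · rw [add_assoc pre.length, add_assoc, getD_append_append (by omega), add_comm, Nat.testBit_eq_inth]
    simp only [numeral]
    rw [List.getI_eq_getElem _ hi, List.getD_eq_getElem _ _ (by simpa using hi)]
    simp [Bool.cond_eq_ite]

section

variable {k : ℕ}

theorem exists_numeral_split (η : Fin k → ℤ) (x : Fin k) : ∃ pre post,
    (List.ofFn fun i => numeral (η i)).flatten = pre ++ numeral (η x) ++ post ∧
      pre.length = ∑ j : Fin k, if j < x then (numeral (η j)).length else 0 := by
  refine ⟨((List.ofFn fun i => numeral (η i)).take x).flatten,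
    ((List.ofFn fun i => numeral (η i)).drop (x + 1)).flatten, ?_, ?_⟩
  · have h1 : (List.ofFn fun i => numeral (η i))[(x : ℕ)]'(by simp) = numeral (η x) := by simp
    rw [← h1, List.append_assoc, ← List.flatten_cons, List.getElem_cons_drop, ← List.flatten_append,
      List.take_append_drop]
  · rw [List.length_flatten, List.map_take, List.map_ofFn, List.sum_take_ofFn, Finset.sum_filter]
    rfl

theorem exists_encodeInput_split (t : ExpTerm k) (η : Fin k → ℤ) (x : Fin k) : ∃ pre post,
    encodeInput t η = pre ++ numeral (η x) ++ post ∧ pre.length = 1 + t.tokens.length + k +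
      ∑ j : Fin k, if j < x then (numeral (η j)).length else 0 := by
  obtain ⟨pre, post, h1, h2⟩ := exists_numeral_split η x
  refine ⟨[t.tokens.length] ++ t.tokens ++ List.ofFn (fun i : Fin k => 1 + t.tokens.length + k +
      ∑ j : Fin k, if j < i then (numeral (η j)).length else 0) ++ pre, post, ?_, ?_⟩
  · rw [encodeInput, h1]; simp only [List.append_assoc]
  · simp [h2]; ring

theorem numeralAt_encodeInput (t : ExpTerm k) (η : Fin k → ℤ) (x : Fin k) :
    NumeralAt (encodeInput t η) (1 + t.tokens.length + x) (η x) := by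
  obtain ⟨pre, post, h1, h2⟩ := exists_encodeInput_split t η x
  rw [h1]
  refine numeralAt_of_append ?_
  rw [← h1, h2, encodeInput, show 1 + t.tokens.length + (x : ℕ) =
    ([t.tokens.length] ++ t.tokens).length + x by simp; ring, getD_append_append (by simp)]
  simp

theorem le_of_mem_encodeInput (t : ExpTerm k) (η : Fin k → ℤ) {w : ℕ} (hw : w ∈ encodeInput t η) :
    w ≤ (encodeInput t η).length + 5 := by
  have hlen : 1 + t.tokens.length + k ≤ (encodeInput t η).length := by
    simp [encodeInput]; omega
  simp only [encodeInput, List.mem_append, List.mem_singleton, List.mem_ofFn, List.mem_flatten] at hw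
  rcases hw with ((rfl | hw) | ⟨x, rfl⟩) | ⟨l, ⟨x, rfl⟩, hw⟩
  · omega
  · have : ∀ t : ExpTerm k, ∀ w ∈ t.tokens, w ≤ k + 5 := by
      intro t
      induction t with
      | zero | one => simp [ExpTerm.tokens]
      | var x => simp [ExpTerm.tokens]; omega
      | add t u ht hu | sub t u ht hu | mulPow t u ht hu | divPow t u ht hu =>
        intro w hw
        simp only [ExpTerm.tokens, List.mem_append, List.mem_singleton] at hw
        rcases hw with (hw | hw) | rfl
        · exact ht w hw
        · exact hu w hw
        · omega
    have := this t w hw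
    omega
  · obtain ⟨pre, post, h1, h2⟩ := exists_encodeInput_split t η x
    rw [← h2, h1]
    simp; omega
  · obtain ⟨pre, post, h1, -⟩ := exists_encodeInput_split t η x
    rw [h1]
    simp only [numeral, List.mem_cons, List.mem_map] at hw
    rcases hw with rfl | rfl | ⟨b, -, rfl⟩
    · split_ifs <;> omega
    · simp [numeral]; omega
    · cases b <;> simp

theorem length_tokens_lt_length_encodeInput (t : ExpTerm k) (η : Fin k → ℤ) :
    t.tokens.length < (encodeInput t η).length := by
  simp [encodeInput]

/-- Every symbol weighs at most the length of the input, since the numeral of a variable is part of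
it. This makes the running time, and with it the size of the words, polynomial in the length of the
input. -/
theorem weight_le (t : ExpTerm k) (η : Fin k → ℤ) :
    t.weight η ≤ t.tokens.length * (encodeInput t η).length := by
  have hL := length_tokens_lt_length_encodeInput t η
  have hT := t.length_tokens
  have hx : ∀ x : Fin k, Nat.clog 2 ((η x).natAbs + 1) + 2 ≤ (encodeInput t η).length := fun x => by
    obtain ⟨pre, post, h1, -⟩ := exists_encodeInput_split t η x
    rw [h1, ← length_bits_eq]
    simp [numeral]; omega
  generalize (encodeInput t η).length = m at *
  have hm : 2 ≤ m := by omega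
  clear hL hT
  induction t with
  | zero | one => simp [ExpTerm.weight, ExpTerm.tokens]; omega
  | var x => simpa [ExpTerm.weight, ExpTerm.tokens] using hx x
  | add t u ht hu | sub t u ht hu | mulPow t u ht hu | divPow t u ht hu =>
    simp only [ExpTerm.weight, ExpTerm.tokens, List.length_append, List.length_singleton, add_mul]
    omega

/-! ### The program -/

/-- Evaluate the term, and output the circuit. -/
def mainP : Prog := initP ;; .loop 90 91 evalBody ;; .ifEq 93 3 (.write 0) outP

/-- The summands are the initial pool, the operations with `O(N^3 * S^3)` each, the leaves with
`O(S^2)` in total, two steps of control, and the output, which is `O(S)` times the square of the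
pool size `O(N^2 * S)`. -/
theorem mainP_time {o N S e W : ℕ} (hN : N = o + 1) (hS : 1 ≤ S) (hoS : o ≤ S)
    (hW : W = S + 4 + 3 * o) (he : e ≤ 32 * S + 1 + o * (3 * (1 + N * S) + S)) :
    300000 * S ^ 3 + (o * opTime S N + S * (20 * S + 30)) + 2 + (20 * W + 90) * (e + 1) ^ 2 ≤
      1000000 * (N ^ 4 * S ^ 3) := by
  have hN1 : 1 ≤ N := by omega
  have h1 : S ^ 3 ≤ N ^ 4 * S ^ 3 := Nat.le_mul_of_pos_left _ (by positivity)
  have h2 : o * opTime S N ≤ 200000 * (N ^ 4 * S ^ 3) := by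
    rw [show 200000 * (N ^ 4 * S ^ 3) = N * (200000 * (N ^ 3 * S ^ 3)) by ring]
    exact Nat.mul_le_mul_right _ (by omega)
  have h3 : S ≤ S ^ 2 := by nlinarith
  have h4 : S ^ 2 ≤ S ^ 3 := Nat.pow_le_pow_right hS (by norm_num)
  have h5 : S * (20 * S + 30) = 20 * S ^ 2 + 30 * S := by ring
  have h6 : 20 * W + 90 ≤ 250 * S := by omega
  have h7 : e + 1 ≤ 41 * (N ^ 2 * S) := by
    have a1 : o * (3 * (1 + N * S) + S) ≤ N * (7 * (N * S)) := by
      refine Nat.mul_le_mul (by omega) ?_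
      have : S ≤ N * S := Nat.le_mul_of_pos_left _ hN1
      omega
    have a2 : N * (7 * (N * S)) = 7 * (N ^ 2 * S) := by ring
    have a3 : S ≤ N ^ 2 * S := Nat.le_mul_of_pos_left _ (by positivity)
    omega
  have h8 : (20 * W + 90) * (e + 1) ^ 2 ≤ 250 * S * (41 * (N ^ 2 * S)) ^ 2 :=
    Nat.mul_le_mul h6 (Nat.pow_le_pow_left h7 2)
  have h9 : 250 * S * (41 * (N ^ 2 * S)) ^ 2 = 420250 * (N ^ 4 * S ^ 3) := by ring
  omega

theorem wp_mainP (t : ExpTerm k) (η : Fin k → ℤ) :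
    wp (encodeInput t η) mainP (fun s => (t.eval η = none → s.out = [0]) ∧
      (∀ n : ℤ, t.eval η = some n → ∃ (m : ℕ) (P : PowerCircuit (Fin m)),
        P.IsNormalCircuitOf n ∧ s.out = 1 :: encodeCircuit P) ∧
      s.tm ≤ 1000000 * ((t.numOps + 1) ^ 4 * t.weight η ^ 3)) St.zero := by
  have hNS := t.numOps_lt_weight η
  have hη := numeralAt_encodeInput t η
  have hsplit : encodeInput t η = t.tokens.length :: t.tokens ++
      (List.ofFn (fun i : Fin k => 1 + t.tokens.length + k +
      ∑ j : Fin k, if j < i then (numeral (η j)).length else 0) ++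
      (List.ofFn fun i : Fin k => numeral (η i)).flatten) := by
    simp [encodeInput]
  simp only [mainP, wp_seq]
  refine wp_mono (wp_initP (N := t.numOps + 1) t hη rfl ⟨_, hsplit⟩) ?_
  rintro s1 ⟨hR, h90, t1⟩
  have htime := fun e => mainP_time (e := e) (N := t.numOps + 1) rfl (by omega) hNS.le rfl
  refine evalSpec (N := t.numOps + 1) hNS hη t s1 _ 0 [] [t.tokens.length] _ _ hR
    hsplit h90 (by simp) le_rfl (by omega) ?_ ?_
  · intro s2 E L v hv hR2 hL h90' t2
    rw [zero_add] at hR2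
    have hle : ¬ s2.reg 90 < s2.reg 91 := by rw [h90', hR2.lim]; simp
    obtain ⟨hs1, hs2⟩ := hR2.stack (i := 0) (L := L) (by simp)
    have hW := hR2.good.wt
    rw [wp_loop_unfold]
    refine ⟨fun h => absurd h hle, fun _ => ?_⟩
    rw [wp_ifEq]
    have h93 := hR2.flag
    have h3 := hR2.good.consts.one
    refine ⟨fun h => by simp at h; omega, fun _ => ?_⟩
    refine wp_mono (wp_outP (E := E) (L := L) (n := v) (W := t.weight η + 4 + 3 * t.numOps)
      hR2.good.pool ⟨hR2.good.consts.zero, h3, hR2.good.consts.three⟩ hR2.good.size hW hs1 hL.naf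
      hL.val (by have := hL.len; omega) hR2.out) ?_
    rintro s3 ⟨hC, t3⟩
    refine ⟨fun h => by simp [hv] at h, fun n hn => ?_, ?_⟩
    · obtain rfl : v = n := by simpa [hv] using hn
      exact hC
    · have := htime E.length hR2.size
      simp at t3
      omega
  · intro s2 hv hF t2
    rw [wp_loop_unfold]
    refine ⟨fun h => by rw [hF.pos, hF.lim] at h; omega, fun _ => ?_⟩
    rw [wp_ifEq]
    refine ⟨fun _ => ?_, fun h => absurd (hF.flag.trans hF.consts.one.symm) h⟩
    rw [wp_write]
    refine ⟨fun _ => by simp [hF.out, hF.consts.zero], fun n hn => by simp [hv] at hn, ?_⟩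
    have := htime 0 (by omega)
    simp at this ⊢
    omega

theorem exec_mainP (t : ExpTerm k) (η : Fin k → ℤ) {C : ℕ} (hC : 16000000 ≤ C) :
    ∃ (out : List ℕ) (steps : ℕ),
      RunsTo (compile mainP) (encodeInput t η) ((encodeInput t η).length ^ C) out steps ∧
      steps ≤ C * ((t.numOps + 1) ^ 4 * t.weight η ^ 3) ∧
      (t.eval η = none → out = [0]) ∧
      (∀ n : ℤ, t.eval η = some n → ∃ (m : ℕ) (P : PowerCircuit (Fin m)),
        P.IsNormalCircuitOf n ∧ out = 1 :: encodeCircuit P) := by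
  obtain ⟨s, hrun, h1, h2, ht⟩ := wp_mainP t η
  have hL := length_tokens_lt_length_encodeInput t η
  have hT := t.length_tokens
  have hw := weight_le t η
  have hword := fun w => le_of_mem_encodeInput t η (w := w)
  have hinp : ∀ i, (encodeInput t η).getD i 0 ≤ (encodeInput t η).length + 5 := fun i => by
    rcases lt_or_ge i (encodeInput t η).length with hi | hi
    · rw [List.getD_eq_getElem _ _ hi]; exact hword _ (List.getElem_mem hi)
    · rw [List.getD_eq_default _ _ hi]; omega
  have hB : 32 * ((encodeInput t η).length + 5 + 64 * s.tm) + 128 ≤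
      (encodeInput t η).length ^ C := by
    clear hinp hword hrun
    generalize (encodeInput t η).length = m at *
    have hm : 2 ≤ m := by omega
    have h3 : t.weight η ≤ m ^ 2 := hw.trans (by rw [sq]; exact Nat.mul_le_mul_right _ (by omega))
    have h4 : (t.numOps + 1) ^ 4 * t.weight η ^ 3 ≤ m ^ 10 := by
      calc _ ≤ m ^ 4 * (m ^ 2) ^ 3 := Nat.mul_le_mul (Nat.pow_le_pow_left (by omega) 4)
            (Nat.pow_le_pow_left h3 3)
        _ = m ^ 10 := by ring
    have h5 : m ≤ m ^ 10 := Nat.le_self_pow (by norm_num) m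
    -- The time is at most `10^6 * m^10`, so all words stay below `2^32 * m^10`; the constant is
    -- absorbed into a power of `m` because `m ≥ 2`.
    have h6 : 2 ^ 32 * m ^ 10 ≤ m ^ 32 * m ^ 10 := Nat.mul_le_mul_right _ (Nat.pow_le_pow_left hm 32)
    have h7 : m ^ 32 * m ^ 10 ≤ m ^ C := by
      rw [← pow_add]; exact Nat.pow_le_pow_right (by omega) (by omega)
    norm_num at h6
    omega
  obtain ⟨σ, n, hσ, hr, -, hn⟩ := exec_compile hinp hrun (by decide) State.init
    ⟨fun _ => rfl, fun _ _ _ => rfl, rfl⟩ ⟨fun _ => Nat.zero_le _, fun _ _ => Nat.zero_le _⟩ hB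
  refine ⟨s.out, n, ⟨σ, hσ, hr.out⟩, ?_, h1, h2⟩
  -- The constant is `16 * 1000000`: sixteen machine steps for each unit of time of the While
  -- program.
  refine le_trans ?_ (Nat.mul_le_mul_right _ hC)
  simp only [St.zero] at hn
  omega

end

end PowerCircuits

theorem mainTheorem7 :
    ∃ (prog : PowerCircuits.Cmd) (C : ℕ),
      ∀ (k : ℕ) (t : PowerCircuits.ExpTerm k) (η : Fin k → ℤ),
        ∃ (out : List ℕ) (steps : ℕ),
          PowerCircuits.RunsTo prog (PowerCircuits.encodeInput t η)
            ((PowerCircuits.encodeInput t η).length ^ C) out steps ∧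
          steps ≤ C * ((t.numOps + 1) ^ 4 *
            ((∑ x : Fin k, t.numVar x * (Nat.clog 2 ((η x).natAbs + 1) + 2)) +
              2 * t.numOne + t.numZero) ^ 3) ∧
          (t.eval η = none → out = [0]) ∧
          (∀ n : ℤ, t.eval η = some n →
            ∃ (m : ℕ) (P : PowerCircuits.PowerCircuit (Fin m)),
              P.IsNormalCircuitOf n ∧ out = 1 :: PowerCircuits.encodeCircuit P) := by
  refine ⟨PowerCircuits.compile PowerCircuits.mainP, 16000000, fun k t η => ?_⟩
  rw [← PowerCircuits.ExpTerm.weight_eq]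
  exact PowerCircuits.exec_mainP t η le_rfl
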